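/- **Conventions.** Surfaces are closed (compact, without boundary), connected, oriented and smooth. A torus is a surface diffeomorphic to $\mathbb R^2/\mathbb Z^2$. An Abelian differential on $M$ is a nonzero smooth complex-valued $1$-form $\omega$ that is holomorphic for some complex structure compatible with the orientation and smooth structure of $M$; $\widetilde\Omega(M)$ is the space of these, with the $C^\infty$ topology. Write $d_\omega$ for the singular flat distance (the infimum of $\int_\gamma|\omega|$ over paths $\gamma$), and, on a torus $T$, $\operatorname{area}(\omega)=\frac i2\int_T\omega\wedge\bar\omega$. The flow $g_t=\mathrm{diag}(e^{t/2},e^{-t/2})$ acts by $g_t\omega=e^{t/2}\operatorname{Re}\omega+i\,e^{-t/2}\operatorname{Im}\omega$. A branched cover $p:S\to T$ (smooth, locally $z\mapsto z^m$ in oriented smooth charts) is *branched over one point* if its set of branch points in $T$ consists of exactly one point; it is *regular* if its deck group acts transitively on fibres. A differential $\omega_T\in\widetilde\Omega(T)$ is *eventually $\epsilon$-thick* if there is $N$ such that for all $t>N$ every essential simple closed curve on $T$ has length $\ge\epsilon$ in the flat metric of $g_t\omega_T$. Let $F^t$ be the unit-speed vertical flow of $\omega_T$ (so $\omega_T(\tfrac{d}{dt}F^tx)=i$).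 A pair $(x,y)$ of points of $T$ is *$B$-badly approximable* if there is $N$ with $t\cdot d_{\omega_T}(F^tx,y)\ge B$ for all $t\ge N$, and $F^tx\ne y$ for all $t\neq0$. A differential $\omega\in\widetilde\Omega(S)$ is *$(\epsilon,B)$-torus good with respect to $q_1,\dots,q_k\in S$, via $(p,\omega_T)$*, if $p:S\to T$ is a branched cover of a torus, branched over one point, $\omega_T\in\widetilde\Omega(T)$ is eventually $\epsilon$-thick, $\omega=p^*\omega_T$, and for all $i\ne j$ the pair $(p(q_i),p(q_j))$ is $B$-badly approximable for the vertical flow of $\omega_T$. It is *$(\epsilon,B)$-torus good* if this holds via some $(p,\omega_T)$ with $p$ regular. **Proposition.** There are a universal constant $\epsilon>0$ and constants $B_k>0$, depending only on $k\in\mathbb N$, such that the following holds. Let $S$ be a closed surface of genus $g\ge2$, let $q_1,\dots,q_k\in S$ be distinct, let $p:S\to T$ be a branched cover of a torus, branched over one point, and let $\omega\in\widetilde\Omega(S)$, $\omega_T\in\widetilde\Omega(T)$ with $\omega=p^*\omega_T$. Put $A=\operatorname{area}(\omega_T)$. Then for every neighbourhood $U$ of $\omega_T$ in $\widetilde\Omega(T)$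 and every $\delta>0$ there are $\omega_T'\in U$ with $\operatorname{area}(\omega_T')=A$ and distinct points $q_1',\dots,q_k'\in S$ with $d_\omega(q_i,q_i')<\delta$ for all $i$, such that $p^*\omega_T'\in\widetilde\Omega(S)$ and $p^*\omega_T'$ is $(\epsilon\sqrt A,\,B_kA)$-torus good with respect to $q_1',\dots,q_k'$ via $(p,\omega_T')$. In particular, if $p$ is regular, then $p^*\omega_T'$ is $(\epsilon\sqrt A,\,B_kA)$-torus good with respect to $q'_1,\dots,q'_k$. For tori of area $1$ the constants are $\epsilon$ and $B_k$ themselves. -/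

import Mathlib

open Set Topology MeasureTheory Function
open scoped Manifold ContDiff

universe u v

noncomputable section

namespace FlatSurface

/-! ### Closed oriented smooth surfaces

Surfaces are charted on `ℂ`, which is regarded as a real two-dimensional vector space with its
standard orientation. -/

/-- A closed oriented smooth surface: connected, compact, Hausdorff, with a smooth atlas whose
transition maps preserve the orientation of `ℂ`. -/
class ClosedSurface (M : Type*) [TopologicalSpace M] [ChartedSpace ℂ M] : Prop
    extends IsManifold 𝓘(ℝ, ℂ) ∞ M, T2Space M, CompactSpace M, ConnectedSpace M where
  oriented : ∀ φ ∈ atlas ℂ M, ∀ ψ ∈ atlas ℂ M, ∀ z ∈ (φ.symm.trans ψ).source,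
    0 < (fderiv ℝ (ψ ∘ φ.symm) z).det

/-- The genus of a closed oriented surface: half the rank of the first homology group, the latter
being the abelianization of the fundamental group. -/
def genus (M : Type*) [TopologicalSpace M] [ConnectedSpace M] : ℕ :=
  Module.finrank ℤ (Additive (Abelianization
    (FundamentalGroup M (Classical.arbitrary M)))) / 2

section Surface

variable {M : Type*} [TopologicalSpace M] [ChartedSpace ℂ M]

/-- `φ` is a smooth chart of `M` that is compatible with the orientation of `M`. -/
def IsOrientedChart (φ : OpenPartialHomeomorph M ℂ) : Prop :=
  φ ∈ IsManifold.maximalAtlas 𝓘(ℝ, ℂ) ∞ M ∧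
    ∀ ψ ∈ atlas ℂ M, ∀ z ∈ (φ.symm.trans ψ).source, 0 < (fderiv ℝ (ψ ∘ φ.symm) z).det

variable (M) in
/-- A complex structure on the smooth surface `M` that is compatible with the orientation and the
smooth structure, given by an atlas of holomorphic charts. -/
structure ComplexStructure where
  charts : Set (OpenPartialHomeomorph M ℂ)
  cover : ∀ x : M, ∃ φ ∈ charts, x ∈ φ.source
  compatible : ∀ φ ∈ charts, IsOrientedChart φ
  holomorphic : ∀ φ ∈ charts, ∀ ψ ∈ charts,
    DifferentiableOn ℂ (ψ ∘ φ.symm) (φ.symm.trans ψ).source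

variable (M) in
/-- Complex-valued (real-linear) `1`-forms on `M`; smoothness is `IsSmooth` below. -/
abbrev OneForm := (x : M) → TangentSpace 𝓘(ℝ, ℂ) x →L[ℝ] ℂ

/-- `γ` is a `C^1` path (of possibly vanishing speed, so that all piecewise `C^1` curves occur up
to reparametrization). -/
def IsC1Path {x y : M} (γ : Path x y) : Prop :=
  ContMDiffOn 𝓘(ℝ, ℝ) 𝓘(ℝ, ℂ) 1 γ.extend (Icc 0 1)

namespace OneForm

/-- The pullback `f^* α` of a `1`-form along a (differentiable) map. -/
def pullback {N : Type*} [TopologicalSpace N] [ChartedSpace ℂ N]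
    (f : M → N) (α : OneForm N) : OneForm M :=
  fun x => (α (f x)).comp (mfderiv 𝓘(ℝ, ℂ) 𝓘(ℝ, ℂ) f x)

/-- A `1`-form on `ℂ` as a function with values in the real-linear maps `ℂ → ℂ`. -/
def onPlane (α : OneForm ℂ) : ℂ → ℂ →L[ℝ] ℂ := α

/-- The expression of `α` in the chart `φ`, a `1`-form on `φ.target ⊆ ℂ`. -/
def inChart (φ : OpenPartialHomeomorph M ℂ) (α : OneForm M) : ℂ → ℂ →L[ℝ] ℂ :=
  (pullback φ.symm α).onPlane

/-- Smooth `1`-forms. -/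
def IsSmooth (α : OneForm M) : Prop :=
  ∀ φ ∈ atlas ℂ M, ContDiffOn ℝ ∞ (inChart φ α) φ.target

/-- `α` is holomorphic for the complex structure `J`: in every holomorphic chart it is `f(z) dz`
with `f` holomorphic. -/
def IsHolomorphic (J : ComplexStructure M) (α : OneForm M) : Prop :=
  ∀ φ ∈ J.charts, ∃ f : ℂ → ℂ, DifferentiableOn ℂ f φ.target ∧
    ∀ z ∈ φ.target, ∀ v : ℂ, inChart φ α z v = f z * v

/-- The `C^∞` topology on `1`-forms: uniform convergence of all derivatives of the coefficients on
compact subsets of charts. -/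
@[reducible] def cInftyTopology : TopologicalSpace (OneForm M) :=
  ⨅ φ ∈ atlas ℂ M, ⨅ r : ℕ, TopologicalSpace.induced
    (fun α => UniformOnFun.ofFun {K : Set ℂ | IsCompact K ∧ K ⊆ φ.target}
      (iteratedFDerivWithin ℝ r (inChart φ α) φ.target))
    (UniformOnFun.topologicalSpace ℂ (ℂ [×r]→L[ℝ] (ℂ →L[ℝ] ℂ))
      {K : Set ℂ | IsCompact K ∧ K ⊆ φ.target})

/-- The action of the Teichmüller flow `g_t = diag(e^{t/2}, e^{-t/2})`: postcomposition of the
flat charts `∫ α` with `g_t`. -/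
def teichmuller (t : ℝ) (α : OneForm M) : OneForm M :=
  fun x => (Real.exp (t / 2) • Complex.ofRealCLM.comp Complex.reCLM +
    Real.exp (-t / 2) • Complex.I • Complex.ofRealCLM.comp Complex.imCLM : ℂ →L[ℝ] ℂ).comp (α x)

/-- The length `∫_γ |α|` of a path in the flat metric of `α`. -/
def length (α : OneForm M) {x y : M} (γ : Path x y) : ENNReal :=
  ∫⁻ t in Icc (0 : ℝ) 1,
    ‖α (γ.extend t) (mfderivWithin 𝓘(ℝ, ℝ) 𝓘(ℝ, ℂ) γ.extend (Icc 0 1) t (1 : ℝ))‖ₑ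

/-- The singular flat distance `d_α`: the infimum of the lengths of paths. -/
def flatDist (α : OneForm M) (x y : M) : ENNReal :=
  ⨅ (γ : Path x y) (_ : IsC1Path γ), α.length γ

end OneForm

variable (M) in
/-- The space of (nonzero) Abelian differentials on the smooth surface `M`: smooth `1`-forms which
are holomorphic for some complex structure compatible with orientation and smooth structure. It
carries the `C^∞` topology. -/
def AbelianDifferential : Type _ :=
  {α : OneForm M // α.IsSmooth ∧ (∃ J : ComplexStructure M, α.IsHolomorphic J) ∧ α ≠ 0}

/-- The `1`-form underlying an Abelian differential. -/
def AbelianDifferential.form (α : AbelianDifferential M) : OneForm M := α.1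

instance : TopologicalSpace (AbelianDifferential M) :=
  TopologicalSpace.induced AbelianDifferential.form OneForm.cInftyTopology

/-- A closed path is simple if it does not meet itself except at its endpoints. -/
def IsSimpleLoop {x : M} (γ : Path x x) : Prop :=
  ∀ s t : unitInterval, s < t → γ s = γ t → s = 0 ∧ t = 1

/-- `α` is eventually `ε`-thick: there is `N` such that for all `t > N` every essential (that is,
not null-homotopic) simple closed curve has length at least `ε` for the flat metric of `g_t α`. -/
def IsEventuallyThick (ε : ℝ) (α : OneForm M) : Prop :=
  ∃ N : ℝ, ∀ t > N, ∀ (x : M) (γ : Path x x), IsC1Path γ → IsSimpleLoop γ →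
    ¬ γ.Homotopic (Path.refl x) → ENNReal.ofReal ε ≤ (α.teichmuller t).length γ

/-- `F` is the vertical straight line flow of `α`: the orbits `t ↦ F t x` satisfy
`α(d/dt F t x) = i`, so they move vertically with unit speed in the flat charts. -/
def IsVerticalFlow (α : OneForm M) (F : ℝ → M → M) : Prop :=
  ∀ x, F 0 x = x ∧ ContMDiff 𝓘(ℝ, ℝ) 𝓘(ℝ, ℂ) 1 (fun t => F t x) ∧
    ∀ t : ℝ, α (F t x) (mfderiv 𝓘(ℝ, ℝ) 𝓘(ℝ, ℂ) (fun s => F s x) t (1 : ℝ)) = Complex.I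

end Surface

/-- The pair `(x, y)` is `B`-badly approximable for the flow `F` with respect to the distance
`d`: one has `t * d (F t x) y ≥ B` for all large `t`, and `F t x ≠ y` for all `t ≠ 0`. -/
def IsBadlyApproximable {X : Type*} (d : X → X → ENNReal) (F : ℝ → X → X) (B : ℝ) (x y : X) : Prop :=
  (∃ N : ℝ, ∀ t ≥ N, ENNReal.ofReal B ≤ ENNReal.ofReal t * d (F t x) y) ∧
    ∀ t ≠ 0, F t x ≠ y

section Torus

variable {T : Type*} [TopologicalSpace T] [ChartedSpace ℂ T]

/-- `π : ℂ → T` induces an orientation-preserving diffeomorphism from the standard smooth torus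
`ℂ / (ℤ + ℤ i)` onto `T`. -/
structure IsTorusParametrization (π : ℂ → T) : Prop where
  smooth : ContMDiff 𝓘(ℝ, ℂ) 𝓘(ℝ, ℂ) ∞ π
  surjective : Surjective π
  fibres : ∀ z w : ℂ, π z = π w ↔ ∃ m n : ℤ, z - w = m + n * Complex.I
  oriented : ∀ φ ∈ atlas ℂ T, ∀ z : ℂ, π z ∈ φ.source → 0 < (fderiv ℝ (φ ∘ π) z).det

/-- The area `∫_T Re α ∧ Im α = (i/2) ∫_T α ∧ conj α` of the flat metric of `α` on a torus, computed
on the fundamental square of the parametrization `π`. -/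
def torusArea (π : ℂ → T) (α : OneForm T) : ℝ :=
  ∫ z in {z : ℂ | z.re ∈ Ico (0 : ℝ) 1 ∧ z.im ∈ Ico (0 : ℝ) 1},
    ((OneForm.pullback π α).onPlane z).det

end Torus

section Cover

variable {S : Type*} [TopologicalSpace S] [ChartedSpace ℂ S]
  {T : Type*} [TopologicalSpace T] [ChartedSpace ℂ T]

/-- In suitable oriented smooth charts centred at `x` and `p x`, the map `p` is `z ↦ z ^ m`. -/
def HasLocalDegree (p : S → T) (x : S) (m : ℕ) : Prop :=
  ∃ (φ : OpenPartialHomeomorph S ℂ) (ψ : OpenPartialHomeomorph T ℂ),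
    IsOrientedChart φ ∧ IsOrientedChart ψ ∧ x ∈ φ.source ∧ φ x = 0 ∧ p x ∈ ψ.source ∧
      ψ (p x) = 0 ∧ MapsTo p φ.source ψ.source ∧ ∀ y ∈ φ.source, ψ (p y) = φ y ^ m

/-- A (smooth, orientation-preserving) branched cover of closed surfaces whose set of branch
points is exactly one point `b` of the base. -/
structure IsBranchedOverOnePoint (p : S → T) : Prop where
  smooth : ContMDiff 𝓘(ℝ, ℂ) 𝓘(ℝ, ℂ) ∞ p
  surjective : Surjective p
  local_form : ∀ x, ∃ m ≥ 1, HasLocalDegree p x m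
  branch_point : ∃ b : T, ∀ t : T, (∃ x, p x = t ∧ ∃ m ≥ 2, HasLocalDegree p x m) ↔ t = b

/-- A branched cover is regular (Galois) if its deck transformations act transitively on fibres. -/
def IsRegularCover (p : S → T) : Prop :=
  ∀ x y : S, p x = p y → ∃ f : S ≃ₜ S, (∀ z, p (f z) = p z) ∧ f x = y

/-- The cover `p : S → T`, branched over one point, and the differential `αT` on the torus `T`
exhibit `α` as `(ε, B)`-torus good with respect to the marked points `q 1, …, q k`. -/
structure IsTorusGoodVia (ε B : ℝ) {k : ℕ} (α : AbelianDifferential S) (q : Fin k → S)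
    (p : S → T) (αT : AbelianDifferential T) : Prop where
  torus : ∃ π : ℂ → T, IsTorusParametrization π
  branched : IsBranchedOverOnePoint p
  thick : IsEventuallyThick ε αT.form
  pullback_eq : α.form = OneForm.pullback p αT.form
  badly_approximable : ∃ F : ℝ → T → T, IsVerticalFlow αT.form F ∧
    ∀ i j, i ≠ j → IsBadlyApproximable αT.form.flatDist F B (p (q i)) (p (q j))

end Cover

/-- `α` is `(ε, B)`-torus good with respect to the marked points `q 1, …, q k`: there are a regular
cover of a torus, branched over one point, and a differential on that torus exhibiting this. -/
def IsTorusGood {S : Type u} [TopologicalSpace S] [ChartedSpace ℂ S]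
    (ε B : ℝ) {k : ℕ} (α : AbelianDifferential S) (q : Fin k → S) : Prop :=
  ∃ (T : Type v) (_ : TopologicalSpace T) (_ : ChartedSpace ℂ T) (_ : ClosedSurface T)
    (p : S → T) (αT : AbelianDifferential T), IsRegularCover p ∧ IsTorusGoodVia ε B α q p αT

end FlatSurface

end

namespace FlatSurface

/-! The torus differential is changed by a small shear that fixes it near the branch point. With `u`
a cutoff of a local primitive of the imaginary part, `α + s (Im α - du)` equals `α` near the branch
point, and its periods are `v + s Im v`. Shears have determinant one, so the area is kept. Near the
fibre over the branch point the pullback keeps its old holomorphic charts. Elsewhere a closed form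
with positive Jacobian has its local primitives as flat charts. So the pullback is holomorphic for a
new complex structure (`IsBranchedOverOnePoint.exists_abelianDifferential`).

The shear is chosen arithmetically (`exists_shear_norm_form_bound`). Arbitrarily small `s` put the
vertical direction at a golden-mean slope with respect to some basis of the period lattice. Since
`|P² - Pq - q²| ≥ 1` for nonzero integer vectors, all nonzero periods `X + iY` satisfy `A/3 ≤ |X||Y|
+ K X²`. The flow `g_t` preserves `XY` and expands `X`, which gives eventual thickness with constant
`√(A/3)`.

The points are chosen on the vertical leaves through `(i/k) v₁`. For two of them, `k` times the
displacement is a nonzero period up to a vertical vector, so the same bound, divided by `k²`, gives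
bad approximability. These leaves are dense and `p` is open, so such points exist in `S` arbitrarily
near the given ones.

Lattice estimates become estimates on the torus through the developing map, a primitive of the form
on the plane. Its bijectivity comes from a degree-one area argument
(`injective_of_lattice_equivariant`). Lengths of paths are bounded below by distances between
endpoints of lifts, and the vertical flow is translation in developed coordinates. -/

/-! ### Lattices with a golden-mean vertical direction -/

/-- The condition is open and invariant under scaling, so a rational approximation of the vertical
vector can be cleared of denominators and divided by its gcd. The result is a primitive, nearly
vertical lattice vector. -/
theorem exists_isCoprime_direction {x₁ x₂ y₁ y₂ : ℝ} (hA : 0 < x₁ * y₂ - x₂ * y₁) {η : ℝ}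
    (hη : 0 < η) : ∃ a b : ℤ, IsCoprime a b ∧ |a * x₁ + b * x₂| < η * |a * y₁ + b * y₂| := by
  set A := x₁ * y₂ - x₂ * y₁ with hAdef
  have hopen : IsOpen {z : ℝ × ℝ | |z.1 * x₁ + z.2 * x₂| < η * |z.1 * y₁ + z.2 * y₂|} :=
    isOpen_lt (by fun_prop) (by fun_prop)
  -- These are the coordinates of the vertical unit vector in the given basis.
  have hne : (-x₂ / A, x₁ / A) ∈
      {z : ℝ × ℝ | |z.1 * x₁ + z.2 * x₂| < η * |z.1 * y₁ + z.2 * y₂|} := by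
    have h1 : -x₂ / A * x₁ + x₁ / A * x₂ = 0 := by ring
    have h2 : -x₂ / A * y₁ + x₁ / A * y₂ = 1 := by
      field_simp
      rw [hAdef]; ring
    simp only [mem_ofPred_eq, h1, h2]
    simpa using hη
  obtain ⟨⟨r₁, r₂⟩, hr⟩ := (Rat.denseRange_cast (𝕜 := ℝ)).prodMap (Rat.denseRange_cast (𝕜 := ℝ))
    |>.exists_mem_open hopen ⟨_, hne⟩
  simp only [Prod.map_apply, mem_ofPred_eq] at hr
  set m : ℤ := r₁.num * r₂.den
  set n : ℤ := r₂.num * r₁.den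
  have hd : (0 : ℝ) < r₁.den * r₂.den := by
    have := r₁.den_pos; have := r₂.den_pos; positivity
  have hm : (m : ℝ) = (r₁.den * r₂.den) * r₁ := by
    have : (r₁ : ℝ) = r₁.num / r₁.den := by exact_mod_cast (Rat.num_div_den r₁).symm
    rw [this]; have := r₁.den_pos; simp only [m]; push_cast; field_simp
  have hn : (n : ℝ) = (r₁.den * r₂.den) * r₂ := by
    have : (r₂ : ℝ) = r₂.num / r₂.den := by exact_mod_cast (Rat.num_div_den r₂).symm
    rw [this]; have := r₂.den_pos; simp only [n]; push_cast; field_simp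
  have hmn : |m * x₁ + n * x₂| < η * |m * y₁ + n * y₂| := by
    have e1 : m * x₁ + n * x₂ = (r₁.den * r₂.den) * (r₁ * x₁ + r₂ * x₂) := by rw [hm, hn]; ring
    have e2 : m * y₁ + n * y₂ = (r₁.den * r₂.den) * (r₁ * y₁ + r₂ * y₂) := by rw [hm, hn]; ring
    rw [e1, e2, abs_mul _ (r₁ * x₁ + r₂ * x₂), abs_mul _ (r₁ * y₁ + r₂ * y₂), abs_of_pos hd]
    nlinarith
  have hg : 0 < Int.gcd m n := by
    rcases Nat.eq_zero_or_pos (Int.gcd m n) with h | h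
    · rw [Int.gcd_eq_zero_iff] at h
      rw [h.1, h.2] at hmn
      simp at hmn
    · exact h
  obtain ⟨a, b, hab, ha, hb⟩ := Int.exists_gcd_one hg
  refine ⟨a, b, Int.isCoprime_iff_gcd_eq_one.2 hab, ?_⟩
  have hg' : (0 : ℝ) < Int.gcd m n := by exact_mod_cast hg
  have ha' : (m : ℝ) = a * Int.gcd m n := by exact_mod_cast ha
  have hb' : (n : ℝ) = b * Int.gcd m n := by exact_mod_cast hb
  rw [ha', hb'] at hmn
  have e1 : a * (Int.gcd m n : ℝ) * x₁ + b * (Int.gcd m n : ℝ) * x₂ =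
    (Int.gcd m n) * (a * x₁ + b * x₂) := by ring
  have e2 : a * (Int.gcd m n : ℝ) * y₁ + b * (Int.gcd m n : ℝ) * y₂ =
    (Int.gcd m n) * (a * y₁ + b * y₂) := by ring
  rw [e1, e2, abs_mul, abs_mul, abs_of_pos hg'] at hmn
  by_contra! h
  nlinarith

/-- The form has discriminant 5, so a nontrivial zero would make `√5` rational. -/
theorem norm_form_ne_zero {P q : ℤ} (h : P ≠ 0 ∨ q ≠ 0) : P ^ 2 - P * q - q ^ 2 ≠ 0 := by
  intro h0
  have hq : q ≠ 0 := by
    rintro rfl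
    simp at h h0
    exact h h0
  have h5 : (2 * P - q) ^ 2 = 5 * q ^ 2 := by linear_combination 4 * h0
  have hirr : Irrational (√5) := by
    have := (show Nat.Prime 5 by norm_num).irrational_sqrt
    exact_mod_cast this
  apply hirr
  refine ⟨|(2 * P - q : ℤ)| / |(q : ℤ)|, ?_⟩
  have hq' : (0 : ℝ) < |(q : ℝ)| := by positivity
  symm
  rw [Real.sqrt_eq_iff_mul_self_eq (by norm_num) (by positivity)]
  have h5' : ((2 * P - q : ℤ) : ℝ) ^ 2 = 5 * (q : ℝ) ^ 2 := by exact_mod_cast h5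
  push_cast at h5' ⊢
  rw [div_mul_div_comm, abs_mul_abs_self, abs_mul_abs_self, eq_comm, div_eq_iff (by positivity)]
  nlinarith

/-- Arbitrarily small shears turn a given lattice into one whose vectors satisfy the norm form
bound of the golden mean, up to an error that only matters far from the vertical direction. -/
theorem exists_shear_norm_form_bound {x₁ x₂ y₁ y₂ : ℝ} (hA : 0 < x₁ * y₂ - x₂ * y₁) {η : ℝ}
    (hη : 0 < η) : ∃ s : ℝ, |s| < η ∧ ∃ K : ℝ, 0 ≤ K ∧ ∀ m n : ℤ, (m ≠ 0 ∨ n ≠ 0) →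
      (x₁ * y₂ - x₂ * y₁) / 3 ≤
        |m * (x₁ + s * y₁) + n * (x₂ + s * y₂)| * |m * y₁ + n * y₂| +
          K * (m * (x₁ + s * y₁) + n * (x₂ + s * y₂)) ^ 2 := by
  obtain ⟨a, b, ⟨d, c', hab⟩, hlt⟩ := exists_isCoprime_direction hA hη
  obtain ⟨c, rfl⟩ : ∃ c, c' = -c := ⟨-c', by ring⟩
  set A := x₁ * y₂ - x₂ * y₁ with hAdef
  have hdet : (d : ℝ) * a - c * b = 1 := by
    have : d * a - c * b = 1 := by linarith
    exact_mod_cast this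
  set P := a * x₁ + b * x₂ with hP
  set Q := a * y₁ + b * y₂ with hQ
  set P₁ := c * x₁ + d * x₂ with hP₁
  set Q₁ := c * y₁ + d * y₂ with hQ₁
  have hAPQ : P * Q₁ - P₁ * Q = A := by
    simp only [P, Q, P₁, Q₁]
    linear_combination (x₁ * y₂ - x₂ * y₁) * hdet
  have hQ0 : Q ≠ 0 := by
    rintro h
    rw [h] at hlt
    simp at hlt
    linarith [abs_nonneg P]
  set τ : ℝ := (√5 - 1) / 2 with hτ
  -- With `w = (P, Q)` and `w₁ = (P₁, Q₁)` as basis, the shear making `(N - τ) w + w₁` vertical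
  -- tends to `-P / Q` as `N → ∞`. This limit is below `η` in absolute value because `w` is nearly
  -- vertical.
  have hlim : Filter.Tendsto (fun r : ℝ => -(P + r * P₁) / (Q + r * Q₁)) (𝓝 0) (𝓝 (-P / Q)) := by
    have : ContinuousAt (fun r : ℝ => -(P + r * P₁) / (Q + r * Q₁)) 0 := by
      apply ContinuousAt.div (by fun_prop) (by fun_prop)
      simpa using hQ0
    simpa [ContinuousAt] using this
  have hlim2 : Filter.Tendsto (fun r : ℝ => (Q + r * Q₁)) (𝓝 0) (𝓝 Q) := by
    have : ContinuousAt (fun r : ℝ => (Q + r * Q₁)) 0 := by fun_prop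
    simpa [ContinuousAt] using this
  have hN : Filter.Tendsto (fun N : ℕ => ((N : ℝ) - τ)) Filter.atTop Filter.atTop :=
    Filter.tendsto_atTop_add_const_right _ _ tendsto_natCast_atTop_atTop
  have hNinv := tendsto_inv_atTop_zero.comp hN
  have hlt' : |-P / Q| < η := by
    rw [abs_div, abs_neg, div_lt_iff₀ (by positivity)]
    exact hlt
  obtain ⟨N, hN1, hN2, hN3⟩ := (((hlim.abs.comp hNinv).eventually_lt_const hlt').and
    (((hlim2.comp hNinv).eventually_ne hQ0).and (hN.eventually_gt_atTop 0))).exists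
  simp only [comp_apply] at hN1 hN2
  set r := (N : ℝ) - τ with hr
  set s := -(P + r⁻¹ * P₁) / (Q + r⁻¹ * Q₁) with hs
  have hrQ : r * Q + Q₁ ≠ 0 := by
    intro h
    apply hN2
    field_simp
    linarith
  have hrel : r * (P + s * Q) + (P₁ + s * Q₁) = 0 := by
    have : s * (Q + r⁻¹ * Q₁) = -(P + r⁻¹ * P₁) := by rw [hs]; field_simp
    have h2 : r * (s * (Q + r⁻¹ * Q₁)) = r * -(P + r⁻¹ * P₁) := by rw [this]
    have h3 : r * r⁻¹ = 1 := mul_inv_cancel₀ hN3.ne'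
    linear_combination h2 - (s * Q₁ + P₁) * h3
  set μ := P + s * Q with hμ
  set D := r * Q + Q₁ with hD
  have hμD : μ * D = A := by
    rw [← hAPQ]
    linear_combination Q * hrel
  have hμ0 : μ ≠ 0 := by
    rintro h
    rw [h] at hμD
    linarith
  have h5 : √5 * √5 = 5 := Real.mul_self_sqrt (by norm_num)
  have h5pos : 0 < √5 := by positivity
  have h53 : √5 ≤ 3 := by rw [Real.sqrt_le_left (by norm_num)]; norm_num
  -- This `K` is the absolute value of the coefficient of the squared horizontal coordinate in
  -- `hprod` below.
  refine ⟨s, hN1, |(Q + D / √5) / μ|, abs_nonneg _, fun m n hmn => ?_⟩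
  set q : ℤ := n * a - m * b with hq
  set p : ℤ := m * d - n * c with hp
  -- In the basis `w`, `w₁ + N w` the horizontal coordinates are `μ` and `μ τ`, so that of a general
  -- vector is `μ (P' + q τ)`, a factor of the norm form.
  set P' : ℤ := p - q * N with hP'
  have hm : m = p * a + q * c := by
    have : d * a - c * b = 1 := by linarith
    simp only [p, q]; linear_combination -m * this
  have hn : n = p * b + q * d := by
    have : d * a - c * b = 1 := by linarith
    simp only [p, q]; linear_combination -n * this
  have hnz : P' ≠ 0 ∨ q ≠ 0 := by
    by_contra! h
    have hp0 : p = 0 := by have := h.1; rw [hP', h.2] at this; simpa using this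
    rw [hp0, h.2] at hm hn
    simp at hm hn
    omega
  have hnorm : (1 : ℝ) ≤ |(P' : ℝ) ^ 2 - P' * q - q ^ 2| := by
    have := Int.one_le_abs (norm_form_ne_zero hnz)
    exact_mod_cast this
  have hm' : (m : ℝ) = p * a + q * c := by exact_mod_cast hm
  have hn' : (n : ℝ) = p * b + q * d := by exact_mod_cast hn
  have hpP : (p : ℝ) = P' + q * N := by simp [P']
  set ξ : ℝ := P' + q * τ with hξ
  have hX : m * (x₁ + s * y₁) + n * (x₂ + s * y₂) = μ * ξ := by
    rw [hm', hn']
    have : (p * a + q * c) * (x₁ + s * y₁) + (p * b + q * d) * (x₂ + s * y₂) =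
      p * μ + q * (P₁ + s * Q₁) := by simp only [μ, P, Q, P₁, Q₁]; ring
    rw [this, hpP, hξ]
    have hN' : (N : ℝ) = r + τ := by simp [r]
    rw [hN']
    linear_combination q * hrel
  have hY : m * y₁ + n * y₂ = ξ * Q + q * D := by
    rw [hm', hn']
    have : (p * a + q * c) * y₁ + (p * b + q * d) * y₂ = p * Q + q * Q₁ := by
      simp only [Q, Q₁]; ring
    rw [this, hpP, hξ, hD]
    have hN' : (N : ℝ) = r + τ := by simp [r]
    rw [hN']
    ring
  rw [hX, hY]
  have hprod : (μ * ξ) * (ξ * Q + q * D) =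
      (μ * ξ) ^ 2 * ((Q + D / √5) / μ) - A * ((P' : ℝ) ^ 2 - P' * q - q ^ 2) / √5 := by
    have hnf : (P' : ℝ) ^ 2 - P' * q - q ^ 2 = ξ * (ξ - q * √5) := by
      rw [hξ, hτ]; linear_combination (q : ℝ) ^ 2 / 4 * h5
    rw [hnf, ← hμD]
    field_simp
    ring
  rw [← abs_mul, hprod]
  have hA3 : A / 3 ≤ |A * ((P' : ℝ) ^ 2 - P' * q - q ^ 2) / √5| := by
    rw [abs_div, abs_mul, abs_of_pos hA, abs_of_pos h5pos]
    calc A / 3 ≤ A / √5 := by gcongr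
      _ ≤ A * |(P' : ℝ) ^ 2 - P' * q - q ^ 2| / √5 := by
        gcongr
        exact le_mul_of_one_le_right hA.le hnorm
  have htri := abs_sub_abs_le_abs_sub (A * ((P' : ℝ) ^ 2 - P' * q - q ^ 2) / √5)
    ((μ * ξ) ^ 2 * ((Q + D / √5) / μ))
  rw [abs_sub_comm, abs_mul _ ((Q + D / √5) / μ), abs_of_nonneg (sq_nonneg (μ * ξ))] at htri
  linarith

/-- By the arithmetic-geometric mean inequality the new squared length is at least `2|X||Y|`; it is
also at least `e^t X²`, which absorbs the `K` term once `2K ≤ e^t`. Averaging the two bounds gives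
the claim. -/
theorem norm_form_bound_le_teichmuller {A K X Y t : ℝ} (ht : 2 * K ≤ Real.exp t)
    (h : A / 3 ≤ |X| * |Y| + K * X ^ 2) :
    A / 3 ≤ (Real.exp (t / 2) * X) ^ 2 + (Real.exp (-t / 2) * Y) ^ 2 := by
  have h1 : Real.exp (t / 2) * Real.exp (-t / 2) = 1 := by
    rw [← Real.exp_add]; simp [neg_div]
  have h2 : Real.exp (t / 2) ^ 2 = Real.exp t := by
    rw [← Real.exp_nat_mul]; congr 1; push_cast; ring
  have h3 : 2 * (|X| * |Y|) ≤ (Real.exp (t / 2) * X) ^ 2 + (Real.exp (-t / 2) * Y) ^ 2 := by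
    have := two_mul_le_add_sq (Real.exp (t / 2) * |X|) (Real.exp (-t / 2) * |Y|)
    simp only [mul_pow, sq_abs] at this ⊢
    calc _ = 2 * (Real.exp (t / 2) * Real.exp (-t / 2)) * (|X| * |Y|) := by rw [h1]; ring
      _ ≤ _ := by linarith
  have h4 : 2 * K * X ^ 2 ≤ (Real.exp (t / 2) * X) ^ 2 := by
    rw [mul_pow, h2]; gcongr
  have h5 : 0 ≤ (Real.exp (-t / 2) * Y) ^ 2 := sq_nonneg _
  linarith

/-- The norm form bound for `k`-torsion translates of a vertical leaf. -/
theorem norm_form_bound_vertical {A K X Y a t : ℝ} {k : ℕ} (hk : 0 < k) (hA : 0 < A) (hK : 0 ≤ K)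
    (h : A / 3 ≤ |k * X| * |k * Y| + K * (k * X) ^ 2)
    (ht : 1 + |a| + A * (1 + K) ≤ t) :
    1 / (6 * k ^ 2) * A ≤ t * ‖((X : ℂ) + ((Y - t + a : ℝ) : ℂ) * Complex.I)‖ := by
  set D := ‖((X : ℂ) + ((Y - t + a : ℝ) : ℂ) * Complex.I)‖ with hD
  have hXD : |X| ≤ D := by
    simpa [-Complex.ofReal_add, -Complex.ofReal_sub] using
      Complex.abs_re_le_norm (X + ((Y - t + a : ℝ) : ℂ) * Complex.I)
  have hYD : |Y - t + a| ≤ D := by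
    have := Complex.abs_im_le_norm (X + ((Y - t + a : ℝ) : ℂ) * Complex.I)
    simpa [-Complex.ofReal_add, -Complex.ofReal_sub] using this
  have hk1 : (1 : ℝ) ≤ k := by exact_mod_cast hk
  have hk2 : (0 : ℝ) < k ^ 2 := by positivity
  have hD0 : 0 ≤ D := norm_nonneg _
  by_contra! hcon
  set C := 1 / (6 * (k : ℝ) ^ 2) * A with hC
  have hCA : C ≤ A := by
    rw [hC]
    have : 1 / (6 * (k : ℝ) ^ 2) ≤ 1 := by
      rw [div_le_one (by positivity)]; nlinarith
    nlinarith
  have hC0 : 0 < C := by positivity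
  have ha := abs_nonneg a
  have ht1 : 1 ≤ t := by nlinarith
  have hDC : D ≤ C := by nlinarith
  have h1 : A / (3 * k ^ 2) ≤ |X| * |Y| + K * X ^ 2 := by
    rw [div_le_iff₀ (by positivity)]
    rw [abs_mul, abs_mul, abs_of_pos (by linarith : (0 : ℝ) < k)] at h
    nlinarith
  have hY : |Y| ≤ t + |a| + D := by
    have : Y = (Y - t + a) + (t + -a) := by ring
    rw [this]
    refine (abs_add_le _ _).trans ?_
    have := abs_add_le t (-a)
    rw [abs_neg, abs_of_pos (by linarith : 0 < t)] at this
    linarith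
  have hX2 : X ^ 2 ≤ D ^ 2 := by rw [← sq_abs]; gcongr
  have h2 : A / (3 * k ^ 2) ≤ D * (t + |a| + D) + K * D ^ 2 := by
    calc _ ≤ _ := h1
      _ ≤ _ := by gcongr
  have h3 : A / (3 * k ^ 2) = 2 * C := by rw [hC]; field_simp; norm_num
  rw [h3] at h2
  -- For large `t` all error terms fit into a second copy of `D * t`. This doubling is why the
  -- constant has 6 where the hypothesis has 3.
  have h4 : D * (|a| + D + K * D) ≤ D * t := by
    gcongr
    nlinarith
  nlinarith

/-! ### Plane maps: Jacobians, degree one and critical points -/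

theorem det_eq_re_mul_im_sub (L : ℂ →L[ℝ] ℂ) :
    L.det = (L 1).re * (L Complex.I).im - (L Complex.I).re * (L 1).im := by
  have : L.det = LinearMap.det (L : ℂ →ₗ[ℝ] ℂ) := rfl
  rw [this, ← LinearMap.det_toMatrix Complex.basisOneI, Matrix.det_fin_two]
  simp [LinearMap.toMatrix_apply]

/-- The fundamental square of the Gaussian lattice. -/
def unitSquare : Set ℂ := {z : ℂ | z.re ∈ Ico (0 : ℝ) 1 ∧ z.im ∈ Ico (0 : ℝ) 1}

theorem unitSquare_eq_preimage :
    unitSquare = Complex.measurableEquivRealProd ⁻¹' (Ico (0 : ℝ) 1 ×ˢ Ico (0 : ℝ) 1) := by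
  ext z
  simp [unitSquare, Complex.measurableEquivRealProd_apply]

theorem measurableSet_unitSquare : MeasurableSet unitSquare := by
  rw [unitSquare_eq_preimage]
  exact Complex.measurableEquivRealProd.measurable (measurableSet_Ico.prod measurableSet_Ico)

theorem volume_unitSquare : volume unitSquare = 1 := by
  rw [unitSquare_eq_preimage, Complex.volume_preserving_equiv_real_prod.measure_preimage_equiv,
    Measure.volume_eq_prod, Measure.prod_prod]
  simp

theorem unitSquare_subset_reProdIm : unitSquare ⊆ Icc (0 : ℝ) 1 ×ℂ Icc (0 : ℝ) 1 :=
  fun _ hz => ⟨Ico_subset_Icc_self hz.1, Ico_subset_Icc_self hz.2⟩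

theorem exists_sub_mem_unitSquare (z : ℂ) : ∃ m n : ℤ, z - (m + n * Complex.I) ∈ unitSquare := by
  refine ⟨⌊z.re⌋, ⌊z.im⌋, ?_, ?_⟩
  · simp [Int.fract_nonneg, Int.fract_lt_one, Int.self_sub_floor]
  · simp [Int.fract_nonneg, Int.fract_lt_one, Int.self_sub_floor]

theorem _root_.Continuous.integrableOn_unitSquare {g : ℂ → ℝ} (hg : Continuous g) :
    IntegrableOn g unitSquare :=
  (hg.continuousOn.integrableOn_compact
    ((isCompact_Icc (a := (0 : ℝ)) (b := 1)).reProdIm isCompact_Icc)).mono_set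
      unitSquare_subset_reProdIm

/-- Stokes: `du ∧ dw = d(u dw)`. Since `dw` is periodic, opposite sides of the square leave only the
jumps of `u` times the increments of `w`. -/
theorem integral_jacobian_real_prod {u w : ℝ × ℝ → ℝ} (hu : ContDiff ℝ 2 u) (hw : ContDiff ℝ 2 w)
    {u₁ u₂ w₁ w₂ : ℝ} (hu₁ : ∀ y, u (1, y) = u (0, y) + u₁) (hu₂ : ∀ x, u (x, 1) = u (x, 0) + u₂)
    (hw₁ : ∀ p, w (p + (1, 0)) = w p + w₁) (hw₂ : ∀ p, w (p + (0, 1)) = w p + w₂) :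
    ∫ p in Icc ((0, 0) : ℝ × ℝ) (1, 1), (fderiv ℝ u p (1, 0) * fderiv ℝ w p (0, 1) -
      fderiv ℝ u p (0, 1) * fderiv ℝ w p (1, 0)) = u₁ * w₂ - u₂ * w₁ := by
  have hw' : ContDiff ℝ 1 (fderiv ℝ w) := hw.fderiv_right (by norm_num)
  have hu' : Continuous (fderiv ℝ u) := hu.continuous_fderiv (by norm_num)
  have hwc : Continuous (fderiv ℝ w) := hw'.continuous
  have hud : ∀ p, HasFDerivAt u (fderiv ℝ u p) p := fun p =>
    (hu.differentiable (by norm_num) p).hasFDerivAt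
  have hwd : ∀ p, HasFDerivAt w (fderiv ℝ w p) p := fun p =>
    (hw.differentiable (by norm_num) p).hasFDerivAt
  have hwd' : ∀ p, HasFDerivAt (fderiv ℝ w) (fderiv ℝ (fderiv ℝ w) p) p := fun p =>
    (hw'.differentiable (by norm_num) p).hasFDerivAt
  have hwv : ∀ (v : ℝ × ℝ) p, HasFDerivAt (fun p => fderiv ℝ w p v)
      ((ContinuousLinearMap.apply ℝ ℝ v).comp (fderiv ℝ (fderiv ℝ w) p)) p := fun v p =>
    (ContinuousLinearMap.apply ℝ ℝ v).hasFDerivAt.comp p (hwd' p)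
  have hsymm : ∀ p, fderiv ℝ (fderiv ℝ w) p (1, 0) (0, 1) =
      fderiv ℝ (fderiv ℝ w) p (0, 1) (1, 0) := fun p =>
    (hw.contDiffAt.isSymmSndFDerivAt (by simp)).eq _ _
  have huc : Continuous u := hu.continuous
  have hper1 : ∀ p v, fderiv ℝ w (p + (1, 0)) v = fderiv ℝ w p v := fun p v => by
    have : (fun p => w (p + (1, 0))) = fun p => w p + w₁ := funext hw₁
    have h2 := congrArg (fun g => fderiv ℝ g p) this
    simp only [fderiv_comp_add_right, fderiv_add_const] at h2
    rw [h2]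
  have hper2 : ∀ p v, fderiv ℝ w (p + (0, 1)) v = fderiv ℝ w p v := fun p v => by
    have : (fun p => w (p + (0, 1))) = fun p => w p + w₂ := funext hw₂
    have h2 := congrArg (fun g => fderiv ℝ g p) this
    simp only [fderiv_comp_add_right, fderiv_add_const] at h2
    rw [h2]
  -- The field is `(u ∂₂w, -u ∂₁w)`; its divergence is the Jacobian because the mixed derivatives of
  -- `w` agree.
  have key := integral_divergence_prod_Icc_of_hasFDerivAt_of_le
    (fun p => u p * fderiv ℝ w p (0, 1)) (fun p => -(u p * fderiv ℝ w p (1, 0))) _ _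
    ((0, 0) : ℝ × ℝ) (1, 1) (by simp [Prod.le_def]) (by fun_prop) (by fun_prop)
    (fun p _ => (hud p).mul (hwv (0, 1) p)) (fun p _ => ((hud p).mul (hwv (1, 0) p)).neg)
    (by
      apply Continuous.integrableOn_Icc
      have := hw'.continuous_fderiv (by norm_num)
      simp only [add_apply, neg_apply,
        smul_apply, ContinuousLinearMap.comp_apply,
        ContinuousLinearMap.apply_apply]
      fun_prop)
  have hlhs : (fun p : ℝ × ℝ => fderiv ℝ u p (1, 0) * fderiv ℝ w p (0, 1) -
      fderiv ℝ u p (0, 1) * fderiv ℝ w p (1, 0)) = fun p =>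
      (u p • (ContinuousLinearMap.apply ℝ ℝ ((0, 1) : ℝ × ℝ)).comp (fderiv ℝ (fderiv ℝ w) p) +
        fderiv ℝ w p (0, 1) • fderiv ℝ u p) (1, 0) +
      (-(u p • (ContinuousLinearMap.apply ℝ ℝ ((1, 0) : ℝ × ℝ)).comp (fderiv ℝ (fderiv ℝ w) p) +
        fderiv ℝ w p (1, 0) • fderiv ℝ u p)) (0, 1) := by
    funext p
    simp only [add_apply, neg_apply,
        smul_apply, ContinuousLinearMap.comp_apply,
        ContinuousLinearMap.apply_apply, smul_eq_mul, hsymm p]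
    ring
  rw [hlhs, key]
  simp only
  have hvert : (∫ y in (0 : ℝ)..1, u (1, y) * fderiv ℝ w (1, y) (0, 1)) -
      ∫ y in (0 : ℝ)..1, u (0, y) * fderiv ℝ w (0, y) (0, 1) = u₁ * w₂ := by
    rw [← intervalIntegral.integral_sub
      (Continuous.intervalIntegrable (by fun_prop) _ _)
      (Continuous.intervalIntegrable (by fun_prop) _ _)]
    have : ∀ y, u (1, y) * fderiv ℝ w (1, y) (0, 1) - u (0, y) * fderiv ℝ w (0, y) (0, 1) =
        u₁ * fderiv ℝ w (0, y) (0, 1) := fun y => by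
      have := hper1 (0, y) (0, 1)
      simp only [Prod.mk_add_mk, zero_add, add_zero] at this
      rw [this, hu₁]; ring
    simp only [this]
    rw [intervalIntegral.integral_const_mul]
    congr 1
    have hd : ∀ y ∈ uIcc (0 : ℝ) 1, HasDerivAt (fun y => w (0, y)) (fderiv ℝ w (0, y) (0, 1)) y :=
      fun y _ => (hwd (0, y)).comp_hasDerivAt y
        ((hasDerivAt_const y (0 : ℝ)).prodMk (hasDerivAt_id y))
    rw [intervalIntegral.integral_eq_sub_of_hasDerivAt hd
      (Continuous.intervalIntegrable (by fun_prop) _ _)]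
    have := hw₂ (0, 0)
    simp only [Prod.mk_add_mk, zero_add, add_zero] at this
    rw [this]; ring
  have hhor : (∫ x in (0 : ℝ)..1, -(u (x, 1) * fderiv ℝ w (x, 1) (1, 0))) -
      ∫ x in (0 : ℝ)..1, -(u (x, 0) * fderiv ℝ w (x, 0) (1, 0)) = -(u₂ * w₁) := by
    rw [← intervalIntegral.integral_sub
      (Continuous.intervalIntegrable (by fun_prop) _ _)
      (Continuous.intervalIntegrable (by fun_prop) _ _)]
    have : ∀ x, -(u (x, 1) * fderiv ℝ w (x, 1) (1, 0)) - -(u (x, 0) * fderiv ℝ w (x, 0) (1, 0)) =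
        (-u₂) * fderiv ℝ w (x, 0) (1, 0) := fun x => by
      have := hper2 (x, 0) (1, 0)
      simp only [Prod.mk_add_mk, zero_add, add_zero] at this
      rw [this, hu₂]; ring
    simp only [this]
    rw [intervalIntegral.integral_const_mul, neg_mul]
    congr 2
    have hd : ∀ x ∈ uIcc (0 : ℝ) 1, HasDerivAt (fun x => w (x, 0)) (fderiv ℝ w (x, 0) (1, 0)) x :=
      fun x _ => (hwd (x, 0)).comp_hasDerivAt x
        ((hasDerivAt_id x).prodMk (hasDerivAt_const x (0 : ℝ)))
    rw [intervalIntegral.integral_eq_sub_of_hasDerivAt hd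
      (Continuous.intervalIntegrable (by fun_prop) _ _)]
    have := hw₁ (0, 0)
    simp only [Prod.mk_add_mk, zero_add, add_zero] at this
    rw [this]; ring
  linarith

theorem integral_det_unitSquare {f : ℂ → ℂ} (hf : ContDiff ℝ 2 f) {v₁ v₂ : ℂ}
    (h₁ : ∀ z, f (z + 1) = f z + v₁) (h₂ : ∀ z, f (z + Complex.I) = f z + v₂) :
    ∫ z in unitSquare, (fderiv ℝ f z).det = v₁.re * v₂.im - v₂.re * v₁.im := by
  set E : ℝ × ℝ →L[ℝ] ℂ := (ContinuousLinearMap.fst ℝ ℝ ℝ).smulRight (1 : ℂ) +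
    (ContinuousLinearMap.snd ℝ ℝ ℝ).smulRight Complex.I with hE
  have hEa : ∀ p : ℝ × ℝ, E p = p.1 + p.2 * Complex.I := fun p => by
    simp [hE]
  have hu : ContDiff ℝ 2 (fun p => (f (E p)).re) :=
    Complex.reCLM.contDiff.comp (hf.comp E.contDiff)
  have hw : ContDiff ℝ 2 (fun p => (f (E p)).im) :=
    Complex.imCLM.contDiff.comp (hf.comp E.contDiff)
  have hfd : ∀ z, HasFDerivAt f (fderiv ℝ f z) z := fun z =>
    (hf.differentiable (by norm_num) z).hasFDerivAt
  have hdu : ∀ p v, fderiv ℝ (fun p => (f (E p)).re) p v = (fderiv ℝ f (E p) (E v)).re :=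
    fun p v => DFunLike.congr_fun
      (Complex.reCLM.hasFDerivAt.comp p ((hfd (E p)).comp p E.hasFDerivAt)).fderiv v
  have hdw : ∀ p v, fderiv ℝ (fun p => (f (E p)).im) p v = (fderiv ℝ f (E p) (E v)).im :=
    fun p v => DFunLike.congr_fun
      (Complex.imCLM.hasFDerivAt.comp p ((hfd (E p)).comp p E.hasFDerivAt)).fderiv v
  have hE1 : E (1, 0) = 1 := by simp [hEa]
  have hE2 : E (0, 1) = Complex.I := by simp [hEa]
  have h1' : ∀ p, f (E (p + (1, 0))) = f (E p) + v₁ := fun p => by rw [map_add, hE1, h₁]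
  have h2' : ∀ p, f (E (p + (0, 1))) = f (E p) + v₂ := fun p => by rw [map_add, hE2, h₂]
  have key := integral_jacobian_real_prod hu hw (u₁ := v₁.re) (u₂ := v₂.re) (w₁ := v₁.im)
    (w₂ := v₂.im) (fun y => by simpa using congrArg Complex.re (h1' (0, y)))
    (fun x => by simpa using congrArg Complex.re (h2' (x, 0)))
    (fun p => by simpa using congrArg Complex.im (h1' p))
    (fun p => by simpa using congrArg Complex.im (h2' p))
  rw [← key]
  have hIcc : (Icc ((0, 0) : ℝ × ℝ) (1, 1)) = Icc (0 : ℝ) 1 ×ˢ Icc (0 : ℝ) 1 := by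
    rw [Icc_prod_eq]
  have hae : (Icc (0 : ℝ) 1 ×ˢ Icc (0 : ℝ) 1 : Set (ℝ × ℝ)) =ᵐ[volume]
      (Ico (0 : ℝ) 1 ×ˢ Ico (0 : ℝ) 1 : Set (ℝ × ℝ)) :=
    Measure.set_prod_ae_eq Ico_ae_eq_Icc.symm Ico_ae_eq_Icc.symm
  rw [hIcc, setIntegral_congr_set hae, unitSquare_eq_preimage,
    ← Complex.volume_preserving_equiv_real_prod.setIntegral_preimage_emb
      Complex.measurableEquivRealProd.measurableEmbedding]
  congr 1
  funext z
  have : E (Complex.measurableEquivRealProd z) = z := by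
    rw [hEa]; simp [Complex.measurableEquivRealProd_apply]
  rw [hdu, hdw, hdu, hdw, this, hE1, hE2, det_eq_re_mul_im_sub]

/-- The volume of `G` is the sum of the volumes of the pieces of its translates lying in the
fundamental square, and these pieces cover the square. -/
theorem one_le_volume_of_translates_cover {G : Set ℂ}
    (hG : ∀ z : ℂ, ∃ m n : ℤ, z + (m + n * Complex.I) ∈ G) : 1 ≤ volume G := by
  set Λ := (Submodule.span ℤ (Set.range Complex.basisOneI)).toAddSubgroup
  have hfd : IsAddFundamentalDomain Λ (ZSpan.fundamentalDomain Complex.basisOneI) volume :=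
    ZSpan.isAddFundamentalDomain' _ _
  have hQ : ZSpan.fundamentalDomain Complex.basisOneI = unitSquare := by
    ext z
    simp [ZSpan.mem_fundamentalDomain, unitSquare, Fin.forall_fin_two]
  rw [hQ] at hfd
  have : Countable Λ :=
    inferInstanceAs (Countable (Submodule.span ℤ (Set.range Complex.basisOneI)))
  rw [hfd.measure_eq_tsum G, ← volume_unitSquare]
  refine (measure_mono ?_).trans (measure_iUnion_le _)
  intro z hz
  obtain ⟨m, n, h⟩ := hG z
  have hmem : -(m + n * Complex.I : ℂ) ∈ Λ := by
    apply neg_mem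
    change _ ∈ Submodule.span ℤ (Set.range Complex.basisOneI)
    simp only [Complex.coe_basisOneI, Matrix.range_cons, Matrix.range_empty, union_empty,
      singleton_union, Submodule.mem_span_pair]
    exact ⟨m, n, by simp⟩
  refine mem_iUnion.2 ⟨⟨_, hmem⟩, ⟨_, h, ?_⟩, hz⟩
  change -(m + n * Complex.I : ℂ) + (z + (m + n * Complex.I)) = z
  ring

theorem apply_add_lattice {f : ℂ → ℂ} {v₁ v₂ : ℂ}
    (h₁ : ∀ z, f (z + 1) = f z + v₁) (h₂ : ∀ z, f (z + Complex.I) = f z + v₂) (z : ℂ) (m n : ℤ) :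
    f (z + (m + n * Complex.I)) = f z + (m * v₁ + n * v₂) := by
  have e1 : ∀ (m : ℤ) z, f (z + m) = f z + m * v₁ := by
    intro m
    induction m using Int.induction_on with
    | zero => simp
    | succ k ih =>
      intro z
      have : z + ((k + 1 : ℤ) : ℂ) = (z + (k : ℤ)) + 1 := by push_cast; ring
      rw [this, h₁, ih]; push_cast; ring
    | pred k ih =>
      intro z
      have h := h₁ (z + ((-k - 1 : ℤ) : ℂ))
      have : z + ((-k - 1 : ℤ) : ℂ) + 1 = z + ((-k : ℤ) : ℂ) := by push_cast; ring
      rw [this, ih] at h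
      rw [← sub_eq_iff_eq_add] at h
      rw [← h]; push_cast; ring
  have e2 : ∀ (n : ℤ) z, f (z + n * Complex.I) = f z + n * v₂ := by
    intro m
    induction m using Int.induction_on with
    | zero => simp
    | succ k ih =>
      intro z
      have : z + ((k + 1 : ℤ) : ℂ) * Complex.I = (z + (k : ℤ) * Complex.I) + Complex.I := by
        push_cast; ring
      rw [this, h₂, ih]; push_cast; ring
    | pred k ih =>
      intro z
      have h := h₂ (z + ((-k - 1 : ℤ) : ℂ) * Complex.I)
      have : z + ((-k - 1 : ℤ) : ℂ) * Complex.I + Complex.I = z + ((-k : ℤ) : ℂ) * Complex.I := by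
        push_cast; ring
      rw [this, ih] at h
      rw [← sub_eq_iff_eq_add] at h
      rw [← h]; push_cast; ring
  rw [← add_assoc, e2, e1, add_assoc]

theorem volume_image_le_integral_det {f : ℂ → ℂ} (hf : ContDiff ℝ 1 f)
    (hdet : ∀ z, 0 ≤ (fderiv ℝ f z).det) {E : Set ℂ} (hE : MeasurableSet E) (hEQ : E ⊆ unitSquare) :
    volume (f '' E) ≤ ENNReal.ofReal (∫ z in E, (fderiv ℝ f z).det) := by
  have hcont : Continuous fun z => (fderiv ℝ f z).det :=
    ContinuousLinearMap.continuous_det.comp (hf.continuous_fderiv (by norm_num))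
  refine (addHaar_image_le_lintegral_abs_det_fderiv volume hE
    (fun z _ => (hf.differentiable (by norm_num) z).hasFDerivAt.hasFDerivWithinAt)).trans ?_
  rw [ofReal_integral_eq_lintegral_ofReal (hcont.integrableOn_unitSquare.mono_set hEQ)
    (Filter.Eventually.of_forall hdet)]
  simp only [abs_of_nonneg (hdet _), le_refl]

/-- A nonpositive integral would make the image of the square null, yet that image contains a
nonempty open set. -/
theorem integral_det_unitSquare_pos {f : ℂ → ℂ} (hf : ContDiff ℝ 1 f)
    (hdet : ∀ z, 0 ≤ (fderiv ℝ f z).det) (hopen : IsOpenMap f) :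
    0 < ∫ z in unitSquare, (fderiv ℝ f z).det := by
  by_contra! h
  have h1 := volume_image_le_integral_det hf hdet measurableSet_unitSquare subset_rfl
  rw [ENNReal.ofReal_of_nonpos h] at h1
  have hU : IsOpen (Ioo (0 : ℝ) 1 ×ℂ Ioo (0 : ℝ) 1) := isOpen_Ioo.reProdIm isOpen_Ioo
  have hne : (f '' (Ioo (0 : ℝ) 1 ×ℂ Ioo (0 : ℝ) 1)).Nonempty :=
    ⟨_, ⟨1 / 2, 1 / 2⟩, ⟨by norm_num, by norm_num⟩, rfl⟩
  have h2 := (hopen _ hU).measure_pos volume hne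
  have h3 : f '' (Ioo (0 : ℝ) 1 ×ℂ Ioo (0 : ℝ) 1) ⊆ f '' unitSquare :=
    image_mono fun z hz => ⟨Ioo_subset_Ico_self hz.1, Ioo_subset_Ico_self hz.2⟩
  exact absurd (h2.trans_le (measure_mono h3)) (not_lt.2 h1)

theorem bounded_of_gaussian_periodic {g : ℂ → ℂ} (hg : Continuous g) (h₁ : ∀ z, g (z + 1) = g z)
    (h₂ : ∀ z, g (z + Complex.I) = g z) : ∃ C, ∀ z, ‖g z‖ ≤ C := by
  have hK : IsCompact (Icc (0 : ℝ) 1 ×ℂ Icc (0 : ℝ) 1) := isCompact_Icc.reProdIm isCompact_Icc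
  obtain ⟨C, hC⟩ := hK.exists_bound_of_continuousOn hg.continuousOn
  refine ⟨C, fun z => ?_⟩
  obtain ⟨m, n, h⟩ := exists_sub_mem_unitSquare z
  have := apply_add_lattice (v₁ := 0) (v₂ := 0) (f := g) (by simpa using h₁) (by simpa using h₂)
    (z - (m + n * Complex.I)) m n
  simp only [sub_add_cancel, mul_zero, add_zero] at this
  rw [this]
  exact hC _ (unitSquare_subset_reProdIm h)

/-- The difference from the identity is periodic, hence bounded, so the map is proper. Being also
open, it has a clopen range. -/
theorem surjective_of_lattice_equivariant {h : ℂ → ℂ} (hh : Continuous h) (hopen : IsOpenMap h)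
    (h₁ : ∀ z, h (z + 1) = h z + 1) (h₂ : ∀ z, h (z + Complex.I) = h z + Complex.I) :
    Surjective h := by
  obtain ⟨C, hC⟩ := bounded_of_gaussian_periodic (g := fun z => z - h z)
    (continuous_id.sub hh) (fun z => by simp only [h₁]; ring) (fun z => by simp only [h₂]; ring)
  have hlim : Filter.Tendsto h (Filter.cocompact ℂ) (Filter.cocompact ℂ) := by
    rw [← Metric.cobounded_eq_cocompact, ← tendsto_norm_atTop_iff_cobounded]
    refine Filter.tendsto_atTop_mono (fun z => ?_)
      (Filter.tendsto_atTop_add_const_right _ (-C) tendsto_norm_cobounded_atTop)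
    have := norm_sub_norm_le z (h z)
    have := hC z
    linarith
  have hproper : IsProperMap h := isProperMap_iff_tendsto_cocompact.2 ⟨hh, hlim⟩
  have hclopen : IsClopen (range h) :=
    ⟨hproper.isClosedMap.isClosed_range, hopen.isOpen_range⟩
  exact range_eq_univ.1 (hclopen.eq_univ (range_nonempty h))

/-- An open `C^2` map of the plane with nonnegative Jacobian which descends to a map of degree one
of the torus is injective. -/
theorem injective_of_lattice_equivariant {X : Type*} [TopologicalSpace X] [T2Space X]
    {π : ℂ → X} (hπ : Continuous π)
    (hfib : ∀ z w : ℂ, π z = π w ↔ ∃ m n : ℤ, z - w = m + n * Complex.I)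
    {h : ℂ → ℂ} (hh : ContDiff ℝ 2 h) (hopen : IsOpenMap h)
    (h₁ : ∀ z, h (z + 1) = h z + 1) (h₂ : ∀ z, h (z + Complex.I) = h z + Complex.I)
    (hdet : ∀ z, 0 ≤ (fderiv ℝ h z).det) : Injective h := by
  have hsurj := surjective_of_lattice_equivariant hh.continuous hopen h₁ h₂
  have hlat := apply_add_lattice h₁ h₂
  have hπlat : ∀ (z : ℂ) (m n : ℤ), π (z + (m + n * Complex.I)) = π z := fun z m n =>
    (hfib _ _).2 ⟨m, n, by ring⟩
  intro z₁ z₂ h12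
  by_contra hne
  have hπne : π z₁ ≠ π z₂ := by
    intro h
    obtain ⟨m, n, hmn⟩ := (hfib _ _).1 h
    have h3 := hlat z₂ m n
    rw [← hmn, add_sub_cancel, h12, left_eq_add] at h3
    rw [mul_one, ← hmn, sub_eq_zero] at h3
    exact hne h3
  obtain ⟨N₁, N₂, hN₁, hN₂, hm₁, hm₂, hdisj⟩ := t2_separation hπne
  set W₁ := π ⁻¹' N₁
  set W₂ := π ⁻¹' N₂
  have hW₁ : IsOpen W₁ := hN₁.preimage hπ
  have hW₂ : IsOpen W₂ := hN₂.preimage hπ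
  -- Points of `V` have a second preimage outside `V`, so `V` can be removed without losing any of
  -- the image.
  set V := W₁ ∩ h ⁻¹' (h '' W₂) with hV
  have hVo : IsOpen V := hW₁.inter ((hopen _ hW₂).preimage hh.continuous)
  have hz₁V : z₁ ∈ V := ⟨hm₁, z₂, hm₂, h12.symm⟩
  have hVsat : ∀ z (m n : ℤ), z ∈ V → z + (m + n * Complex.I) ∈ V := by
    rintro z m n ⟨hz, y, hy, hyz⟩
    refine ⟨?_, y + (m + n * Complex.I), ?_, ?_⟩
    · simpa [W₁, hπlat] using hz
    · simpa [W₂, hπlat] using hy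
    · rw [hlat, hlat, hyz]
  have hQV : MeasurableSet (unitSquare ∩ V) := measurableSet_unitSquare.inter hVo.measurableSet
  have hQE : MeasurableSet (unitSquare \ V) := measurableSet_unitSquare.diff hVo.measurableSet
  have hint := integral_det_unitSquare hh (v₁ := 1) (v₂ := Complex.I) h₁ h₂
  have hh1 : ContDiff ℝ 1 h := hh.of_le (by norm_num)
  have hcont : Continuous fun z => (fderiv ℝ h z).det :=
    ContinuousLinearMap.continuous_det.comp (hh.continuous_fderiv (by norm_num))
  have hsplit := integral_inter_add_sdiff (s := unitSquare) (t := V) (μ := volume)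
    hVo.measurableSet hcont.integrableOn_unitSquare
  rw [hint] at hsplit
  -- What remains already has image of area at least one, the whole integral of the Jacobian.
  -- Nothing is left for `V`, so its image is null, contrary to openness.
  have hE1 : 1 ≤ volume (h '' (unitSquare \ V)) := by
    apply one_le_volume_of_translates_cover
    intro w
    obtain ⟨z, hz, hzV⟩ : ∃ z, h z = w ∧ z ∉ V := by
      obtain ⟨z, hz⟩ := hsurj w
      by_cases hzV : z ∈ V
      · obtain ⟨-, y, hy, hyz⟩ := hzV
        exact ⟨y, hyz.trans hz, fun hyV => hdisj.ne_of_mem hyV.1 hy rfl⟩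
      · exact ⟨z, hz, hzV⟩
    obtain ⟨m, n, hmn⟩ := exists_sub_mem_unitSquare z
    have e : z - (m + n * Complex.I) = z + (((-m : ℤ) : ℂ) + ((-n : ℤ) : ℂ) * Complex.I) := by
      push_cast; ring
    refine ⟨-m, -n, z - (m + n * Complex.I), ⟨hmn, fun hV' => hzV ?_⟩, ?_⟩
    · simpa using hVsat _ m n hV'
    · rw [e, hlat, hz]; simp
  have hle := hE1.trans (volume_image_le_integral_det hh1 hdet hQE sdiff_subset)
  rw [ENNReal.one_le_ofReal] at hle
  have h0 := volume_image_le_integral_det hh1 hdet hQV inter_subset_left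
  have hle0 : ∫ z in unitSquare ∩ V, (fderiv ℝ h z).det ≤ 0 := by
    simp at hsplit
    linarith
  rw [ENNReal.ofReal_of_nonpos hle0, nonpos_iff_eq_zero] at h0
  have hcover : h '' V ⊆ ⋃ p : ℤ × ℤ,
      (fun w => w + (p.1 + p.2 * Complex.I)) '' (h '' (unitSquare ∩ V)) := by
    rintro _ ⟨z, hz, rfl⟩
    obtain ⟨m, n, hmn⟩ := exists_sub_mem_unitSquare z
    have e : z - (m + n * Complex.I) = z + (((-m : ℤ) : ℂ) + ((-n : ℤ) : ℂ) * Complex.I) := by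
      push_cast; ring
    refine mem_iUnion.2 ⟨(m, n), h (z - (m + n * Complex.I)), ⟨_, ⟨hmn, ?_⟩, rfl⟩, ?_⟩
    · rw [e]; exact hVsat _ _ _ hz
    · rw [e, hlat]; push_cast; ring
  have hnull : volume (h '' V) = 0 := by
    refine measure_mono_null hcover (measure_iUnion_null fun p => ?_)
    rw [image_add_right, measure_preimage_add_right]
    exact h0
  exact absurd hnull ((hopen _ hVo).measure_pos volume ⟨_, _, hz₁V, rfl⟩).ne'

/-- The linear map which sends the basis `v₁, v₂` to the standard one. -/
noncomputable def latticeNormalizer (v₁ v₂ : ℂ) : ℂ →L[ℝ] ℂ :=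
  (v₁.re * v₂.im - v₂.re * v₁.im)⁻¹ •
    (Complex.reCLM.smulRight (v₂.im - v₁.im * Complex.I) +
      Complex.imCLM.smulRight (-v₂.re + v₁.re * Complex.I))

theorem latticeNormalizer_apply (v₁ v₂ w : ℂ) : latticeNormalizer v₁ v₂ w =
    ((v₁.re * v₂.im - v₂.re * v₁.im)⁻¹ : ℝ) * (w.re * (v₂.im - v₁.im * Complex.I) +
      w.im * (-v₂.re + v₁.re * Complex.I)) := by
  simp [latticeNormalizer]; ring

theorem latticeNormalizer_left {v₁ v₂ : ℂ} (h : v₁.re * v₂.im - v₂.re * v₁.im ≠ 0) :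
    latticeNormalizer v₁ v₂ v₁ = 1 := by
  rw [latticeNormalizer_apply]
  apply Complex.ext
  · simp [-Complex.ofReal_inv]; field_simp; ring
  · simp [-Complex.ofReal_inv]; right; ring

theorem latticeNormalizer_right {v₁ v₂ : ℂ} (h : v₁.re * v₂.im - v₂.re * v₁.im ≠ 0) :
    latticeNormalizer v₁ v₂ v₂ = Complex.I := by
  rw [latticeNormalizer_apply]
  apply Complex.ext
  · simp [-Complex.ofReal_inv]; right; ring
  · simp [-Complex.ofReal_inv]; field_simp; ring

theorem det_latticeNormalizer (v₁ v₂ : ℂ) :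
    (latticeNormalizer v₁ v₂).det = (v₁.re * v₂.im - v₂.re * v₁.im)⁻¹ := by
  rw [det_eq_re_mul_im_sub, latticeNormalizer_apply, latticeNormalizer_apply]
  by_cases h : v₁.re * v₂.im - v₂.re * v₁.im = 0
  · simp [-Complex.ofReal_inv, h]
  · simp [-Complex.ofReal_inv]; field_simp

theorem bijective_latticeNormalizer {v₁ v₂ : ℂ} (h : v₁.re * v₂.im - v₂.re * v₁.im ≠ 0) :
    Bijective (latticeNormalizer v₁ v₂) := by
  have hs : Surjective (latticeNormalizer v₁ v₂) := fun w =>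
    ⟨w.re • v₁ + w.im • v₂, by
      rw [map_add, map_smul, map_smul, latticeNormalizer_left h, latticeNormalizer_right h]
      simp⟩
  exact ⟨(LinearMap.injective_iff_surjective (f := (latticeNormalizer v₁ v₂ : ℂ →ₗ[ℝ] ℂ))).2 hs, hs⟩

theorem det_comp (L M : ℂ →L[ℝ] ℂ) : (L.comp M).det = L.det * M.det :=
  LinearMap.det_comp (L : ℂ →ₗ[ℝ] ℂ) (M : ℂ →ₗ[ℝ] ℂ)

/-- An open `C^2` map of the plane with nonnegative Jacobian which commutes with the Gaussian
lattice up to translations is bijective, and the translations span a positive parallelogram. -/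
theorem bijective_of_periods {X : Type*} [TopologicalSpace X] [T2Space X]
    {π : ℂ → X} (hπ : Continuous π)
    (hfib : ∀ z w : ℂ, π z = π w ↔ ∃ m n : ℤ, z - w = m + n * Complex.I)
    {f : ℂ → ℂ} (hf : ContDiff ℝ 2 f) (hopen : IsOpenMap f) {v₁ v₂ : ℂ}
    (h₁ : ∀ z, f (z + 1) = f z + v₁) (h₂ : ∀ z, f (z + Complex.I) = f z + v₂)
    (hdet : ∀ z, 0 ≤ (fderiv ℝ f z).det) :
    0 < v₁.re * v₂.im - v₂.re * v₁.im ∧ Bijective f := by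
  have hA : 0 < v₁.re * v₂.im - v₂.re * v₁.im := by
    rw [← integral_det_unitSquare hf h₁ h₂]
    exact integral_det_unitSquare_pos (hf.of_le (by norm_num)) hdet hopen
  refine ⟨hA, ?_⟩
  set R := latticeNormalizer v₁ v₂
  have hR : Bijective R := bijective_latticeNormalizer hA.ne'
  have hRo : IsOpenMap R := R.isOpenMap hR.2
  have hcd : ContDiff ℝ 2 (R ∘ f) := R.contDiff.comp hf
  have ho : IsOpenMap (R ∘ f) := hRo.comp hopen
  have e₁ : ∀ z, (R ∘ f) (z + 1) = (R ∘ f) z + 1 := fun z => by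
    simp only [comp_apply, h₁, map_add, R, latticeNormalizer_left hA.ne']
  have e₂ : ∀ z, (R ∘ f) (z + Complex.I) = (R ∘ f) z + Complex.I := fun z => by
    simp only [comp_apply, h₂, map_add, R, latticeNormalizer_right hA.ne']
  have hd : ∀ z, 0 ≤ (fderiv ℝ (R ∘ f) z).det := fun z => by
    rw [(R.hasFDerivAt.comp z (hf.differentiable (by norm_num) z).hasFDerivAt).fderiv, det_comp,
      det_latticeNormalizer]
    exact mul_nonneg (inv_nonneg.2 hA.le) (hdet z)
  have hbij : Bijective (R ∘ f) :=
    ⟨injective_of_lattice_equivariant hπ hfib hcd ho e₁ e₂ hd,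
      surjective_of_lattice_equivariant hcd.continuous ho e₁ e₂⟩
  refine ⟨hbij.1.of_comp, fun w => ?_⟩
  obtain ⟨z, hz⟩ := hbij.2 (R w)
  exact ⟨z, hR.1 hz⟩

/-- An injective holomorphic map has no critical points. -/
theorem deriv_ne_zero_of_openPartialHomeomorph (e : OpenPartialHomeomorph ℂ ℂ)
    (he : DifferentiableOn ℂ e e.source) {z : ℂ} (hz : z ∈ e.source) : deriv e z ≠ 0 := by
  have han : AnalyticAt ℂ e z := he.analyticAt (e.open_source.mem_nhds hz)
  have hzt : e z ∈ e.target := e.map_source hz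
  -- Zeros of the derivative are isolated, since otherwise `e` would be locally constant. Hence the
  -- inverse is holomorphic off one point, where continuity makes the singularity removable, and the
  -- chain rule applies at `z` itself.
  have hne : ∀ᶠ w in 𝓝[≠] z, deriv e w ≠ 0 := by
    rcases han.deriv.eventually_eq_zero_or_eventually_ne_zero with h0 | h
    · exfalso
      obtain ⟨r, hr, hball⟩ := Metric.eventually_nhds_iff_ball.1
        (h0.and (e.open_source.mem_nhds hz))
      have hconst : ∀ w ∈ Metric.ball z r, e w = e z := fun w hw =>
        (convex_ball z r).is_const_of_fderivWithin_eq_zero (𝕜 := ℂ)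
          (fun y hy => (he y (hball y hy).2).mono fun x hx => (hball x hx).2)
          (fun y hy => by
            rw [fderivWithin_of_isOpen Metric.isOpen_ball hy]
            ext
            simpa using (hball y hy).1) hw (Metric.mem_ball_self hr)
      have hmem : z + (r / 2 : ℝ) ∈ Metric.ball z r := by
        simp [abs_of_pos hr, hr]
      have := e.injOn (hball _ hmem).2 hz (hconst _ hmem)
      simp [hr.ne'] at this
    · exact h
  have hsym : ∀ᶠ w in 𝓝[≠] (e z), DifferentiableAt ℂ e.symm w := by
    have hcont : Filter.Tendsto e.symm (𝓝[≠] (e z)) (𝓝[≠] z) := by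
      refine tendsto_nhdsWithin_iff.2 ⟨?_, ?_⟩
      · have := (e.continuousAt_symm hzt).tendsto
        rw [e.left_inv hz] at this
        exact this.mono_left nhdsWithin_le_nhds
      · filter_upwards [self_mem_nhdsWithin, nhdsWithin_le_nhds (e.open_target.mem_nhds hzt)]
          with w hw hwt h
        apply hw
        rw [mem_singleton_iff] at h ⊢
        rw [← h, e.right_inv hwt]
    filter_upwards [hcont.eventually hne, nhdsWithin_le_nhds (e.open_target.mem_nhds hzt)]
      with w hw hwt
    exact (e.hasDerivAt_symm hwt hw
      ((he _ (e.map_target hwt)).differentiableAt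
        (e.open_source.mem_nhds (e.map_target hwt))).hasDerivAt).differentiableAt
  have hsa : AnalyticAt ℂ e.symm (e z) :=
    Complex.analyticAt_of_differentiable_on_punctured_nhds_of_continuousAt hsym
      (e.continuousAt_symm hzt)
  have hcomp : HasDerivAt (e.symm ∘ e) (deriv e.symm (e z) * deriv e z) z :=
    hsa.differentiableAt.hasDerivAt.comp z han.differentiableAt.hasDerivAt
  have hid : HasDerivAt (e.symm ∘ e) 1 z := by
    refine (hasDerivAt_id z).congr_of_eventuallyEq ?_
    filter_upwards [e.open_source.mem_nhds hz] with w hw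
    simp [e.left_inv hw]
  intro h
  have := hcomp.unique hid
  rw [h, mul_zero] at this
  exact zero_ne_one this

/-! ### Derivatives, charts and orientation -/

section Derivative

variable {M : Type*} [TopologicalSpace M] [ChartedSpace ℂ M]
  {N : Type*} [TopologicalSpace N] [ChartedSpace ℂ N]
  {P : Type*} [TopologicalSpace P] [ChartedSpace ℂ P]

/-- The derivative of a map of surfaces, read in the preferred charts. -/
noncomputable def mderiv (f : M → N) (x : M) : ℂ →L[ℝ] ℂ := mfderiv 𝓘(ℝ, ℂ) 𝓘(ℝ, ℂ) f x

/-- The value of a `1`-form at a point, read in the preferred chart. -/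
def OneForm.coeff (α : OneForm M) (x : M) : ℂ →L[ℝ] ℂ := α x

theorem mderiv_comp {g : N → P} {f : M → N} {x : M}
    (hg : MDifferentiableAt 𝓘(ℝ, ℂ) 𝓘(ℝ, ℂ) g (f x))
    (hf : MDifferentiableAt 𝓘(ℝ, ℂ) 𝓘(ℝ, ℂ) f x) :
    mderiv (g ∘ f) x = (mderiv g (f x)).comp (mderiv f x) :=
  mfderiv_comp x hg hf

theorem mderiv_congr {f g : M → N} {x : M} (h : f =ᶠ[𝓝 x] g) : mderiv f x = mderiv g x := by
  have := h.mfderiv_eq (I := 𝓘(ℝ, ℂ)) (I' := 𝓘(ℝ, ℂ))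
  ext v
  exact congrArg (fun L => (L : ℂ →L[ℝ] ℂ) v) this

theorem mderiv_eq_fderiv {f : ℂ → ℂ} {z : ℂ} : mderiv f z = fderiv ℝ f z := mfderiv_eq_fderiv

theorem coeff_pullback (f : M → N) (α : OneForm N) (x : M) :
    (OneForm.pullback f α).coeff x = (α.coeff (f x)).comp (mderiv f x) := rfl

theorem inChart_eq (φ : OpenPartialHomeomorph M ℂ) (α : OneForm M) (z : ℂ) :
    OneForm.inChart φ α z = (α.coeff (φ.symm z)).comp (mderiv φ.symm z) := rfl

theorem OneForm.ext_coeff {α β : OneForm M} (h : ∀ x, α.coeff x = β.coeff x) : α = β :=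
  funext h

theorem mdifferentiable_of_mem_maximalAtlas {φ : OpenPartialHomeomorph M ℂ}
    (hφ : φ ∈ IsManifold.maximalAtlas 𝓘(ℝ, ℂ) ∞ M) : φ.MDifferentiable 𝓘(ℝ, ℂ) 𝓘(ℝ, ℂ) :=
  ⟨(contMDiffOn_of_mem_maximalAtlas hφ).mdifferentiableOn (by simp),
    (contMDiffOn_symm_of_mem_maximalAtlas hφ).mdifferentiableOn (by simp)⟩

theorem mderiv_comp_symm {φ : OpenPartialHomeomorph M ℂ}
    (hφ : φ ∈ IsManifold.maximalAtlas 𝓘(ℝ, ℂ) ∞ M) {z : ℂ} (hz : z ∈ φ.target) :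
    (mderiv φ (φ.symm z)).comp (mderiv φ.symm z) = ContinuousLinearMap.id ℝ ℂ :=
  (mdifferentiable_of_mem_maximalAtlas hφ).comp_symm_deriv hz

theorem mderiv_symm_comp {φ : OpenPartialHomeomorph M ℂ}
    (hφ : φ ∈ IsManifold.maximalAtlas 𝓘(ℝ, ℂ) ∞ M) {x : M} (hx : x ∈ φ.source) :
    (mderiv φ.symm (φ x)).comp (mderiv φ x) = ContinuousLinearMap.id ℝ ℂ :=
  (mdifferentiable_of_mem_maximalAtlas hφ).symm_comp_deriv hx

theorem det_mderiv_mul_symm {φ : OpenPartialHomeomorph M ℂ}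
    (hφ : φ ∈ IsManifold.maximalAtlas 𝓘(ℝ, ℂ) ∞ M) {z : ℂ} (hz : z ∈ φ.target) :
    (mderiv φ (φ.symm z)).det * (mderiv φ.symm z).det = 1 := by
  rw [← det_comp, mderiv_comp_symm hφ hz]
  exact LinearMap.det_id

theorem fderiv_comp_symm {φ : OpenPartialHomeomorph M ℂ} {F : M → ℂ}
    (hφ : φ ∈ IsManifold.maximalAtlas 𝓘(ℝ, ℂ) ∞ M) {z : ℂ} (hz : z ∈ φ.target)
    (hF : MDifferentiableAt 𝓘(ℝ, ℂ) 𝓘(ℝ, ℂ) F (φ.symm z)) :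
    fderiv ℝ (F ∘ φ.symm) z = (mderiv F (φ.symm z)).comp (mderiv φ.symm z) := by
  rw [← mderiv_eq_fderiv,
    mderiv_comp hF ((mdifferentiable_of_mem_maximalAtlas hφ).mdifferentiableAt_symm hz)]

theorem IsOrientedChart.mdifferentiableAt {φ : OpenPartialHomeomorph M ℂ} (hφ : IsOrientedChart φ)
    {x : M} (hx : x ∈ φ.source) : MDifferentiableAt 𝓘(ℝ, ℂ) 𝓘(ℝ, ℂ) φ x :=
  (mdifferentiable_of_mem_maximalAtlas hφ.1).mdifferentiableAt hx

variable [IsManifold 𝓘(ℝ, ℂ) ∞ M]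

theorem mderiv_chartAt_self (x : M) :
    mderiv (chartAt ℂ x) x = ContinuousLinearMap.id ℝ ℂ := by
  have : IsManifold 𝓘(ℝ, ℂ) 1 M := IsManifold.of_le (n := ∞) (by simp)
  have h := mfderiv_extChartAt_self (I := 𝓘(ℝ, ℂ)) (x := x)
  have e : (extChartAt 𝓘(ℝ, ℂ) x : M → ℂ) = chartAt ℂ x := by ext; simp
  exact (congrArg (fun f : M → ℂ => mderiv f x) e).symm.trans h

theorem IsOrientedChart.det_pos {φ : OpenPartialHomeomorph M ℂ} (hφ : IsOrientedChart φ) {x : M}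
    (hx : x ∈ φ.source) : 0 < (mderiv φ x).det := by
  have hz := φ.map_source hx
  have h := hφ.2 (chartAt ℂ x) (chart_mem_atlas ℂ x) (φ x) (by
    simp [φ.left_inv hx, hz])
  rw [fderiv_comp_symm hφ.1 hz, det_comp, φ.left_inv hx, mderiv_chartAt_self] at h
  · have h2 := det_mderiv_mul_symm hφ.1 hz
    rw [φ.left_inv hx] at h2
    have e : (ContinuousLinearMap.id ℝ ℂ).det = 1 := LinearMap.det_id
    rw [e, one_mul] at h
    exact (pos_iff_pos_of_mul_pos (h2 ▸ one_pos)).2 h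
  · rw [φ.left_inv hx]
    exact (mdifferentiable_chart x).mdifferentiableAt (mem_chart_source ℂ x)

end Derivative

section Oriented

variable {M : Type*} [TopologicalSpace M] [ChartedSpace ℂ M] [ClosedSurface M]

theorem isOrientedChart_of_mem_atlas {φ : OpenPartialHomeomorph M ℂ} (hφ : φ ∈ atlas ℂ M) :
    IsOrientedChart φ :=
  ⟨IsManifold.subset_maximalAtlas hφ, fun ψ hψ z hz => ClosedSurface.oriented φ hφ ψ hψ z hz⟩

/-- Preferred charts are oriented, so compatibility becomes the sign of one determinant, which
multiplies under composition. -/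
theorem isOrientedChart_iff {φ : OpenPartialHomeomorph M ℂ} : IsOrientedChart φ ↔
    φ ∈ IsManifold.maximalAtlas 𝓘(ℝ, ℂ) ∞ M ∧ ∀ x ∈ φ.source, 0 < (mderiv φ x).det := by
  refine ⟨fun h => ⟨h.1, fun x hx => h.det_pos hx⟩, fun h => ⟨h.1, fun ψ hψ z hz => ?_⟩⟩
  rw [OpenPartialHomeomorph.trans_source, φ.symm_source] at hz
  have hψ' := isOrientedChart_of_mem_atlas hψ
  rw [fderiv_comp_symm h.1 hz.1 (hψ'.mdifferentiableAt hz.2), det_comp]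
  refine mul_pos (hψ'.det_pos hz.2) ?_
  have h2 := det_mderiv_mul_symm h.1 hz.1
  exact (pos_iff_pos_of_mul_pos (h2 ▸ one_pos)).1 (h.2 _ (φ.map_target hz.1))

theorem IsOrientedChart.restr {φ : OpenPartialHomeomorph M ℂ} (hφ : IsOrientedChart φ) {s : Set M}
    (hs : IsOpen s) : IsOrientedChart (φ.restr s) := by
  rw [isOrientedChart_iff]
  refine ⟨restr_mem_maximalAtlas _ hφ.1 hs, fun x hx => ?_⟩
  exact hφ.det_pos (φ.restr_source_inter s ▸ hx).1

/-- A local diffeomorphism to the plane which preserves the orientation restricts to a chart. -/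
theorem exists_isOrientedChart_eqOn {F : M → ℂ} {W : Set M} (hW : IsOpen W)
    (hF : ContMDiffOn 𝓘(ℝ, ℂ) 𝓘(ℝ, ℂ) ∞ F W) {x : M} (hx : x ∈ W) (hdet : 0 < (mderiv F x).det) :
    ∃ φ : OpenPartialHomeomorph M ℂ, IsOrientedChart φ ∧ x ∈ φ.source ∧ φ.source ⊆ W ∧
      EqOn φ F φ.source := by
  set c := chartAt ℂ x
  have hc : IsOrientedChart c := isOrientedChart_of_mem_atlas (chart_mem_atlas ℂ x)
  have hxc : x ∈ c.source := mem_chart_source ℂ x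
  set g : ℂ → ℂ := F ∘ c.symm with hg
  set O : Set ℂ := c.target ∩ c.symm ⁻¹' W with hO
  have hOo : IsOpen O := c.isOpen_inter_preimage_symm hW
  have hgs : ContDiffOn ℝ ∞ g O := by
    rw [← contMDiffOn_iff_contDiffOn]
    exact hF.comp ((contMDiffOn_symm_of_mem_maximalAtlas hc.1).mono inter_subset_left)
      fun z hz => hz.2
  have hFd : ∀ y ∈ W, MDifferentiableAt 𝓘(ℝ, ℂ) 𝓘(ℝ, ℂ) F y := fun y hy =>
    (hF.mdifferentiableOn (by simp) y hy).mdifferentiableAt (hW.mem_nhds hy)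
  have hcx : c x ∈ O := ⟨c.map_source hxc, by simpa [c.left_inv hxc] using hx⟩
  have hfd : ∀ z ∈ O, fderiv ℝ g z = (mderiv F (c.symm z)).comp (mderiv c.symm z) :=
    fun z hz => fderiv_comp_symm hc.1 hz.1 (hFd _ hz.2)
  have hsymmdet : ∀ z ∈ c.target, 0 < (mderiv c.symm z).det := fun z hz => by
    have h2 := det_mderiv_mul_symm hc.1 hz
    exact (pos_iff_pos_of_mul_pos (h2 ▸ one_pos)).1 (hc.det_pos (c.map_target hz))
  have hdetx : 0 < (fderiv ℝ g (c x)).det := by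
    rw [hfd _ hcx, det_comp, c.left_inv hxc]
    exact mul_pos hdet (hsymmdet _ hcx.1)
  have hcontdet : ContinuousOn (fun z => (fderiv ℝ g z).det) O :=
    ContinuousLinearMap.continuous_det.comp_continuousOn
      (hgs.continuousOn_fderiv_of_isOpen hOo (by simp))
  -- The inverse function theorem is applied at one point. Restricting to where the Jacobian stays
  -- positive makes the inverse smooth and the chart oriented throughout.
  set O' : Set ℂ := O ∩ {z | 0 < (fderiv ℝ g z).det} with hO'
  have hO'o : IsOpen O' := hcontdet.isOpen_inter_preimage hOo isOpen_Ioi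
  have hgat : ∀ z ∈ O, ContDiffAt ℝ ∞ g z := fun z hz => hgs.contDiffAt (hOo.mem_nhds hz)
  have hfde : ∀ z (hz : z ∈ O'), HasFDerivAt g
      ((fderiv ℝ g z).toContinuousLinearEquivOfDetNeZero hz.2.ne' : ℂ →L[ℝ] ℂ) z := fun z hz => by
    rw [ContinuousLinearMap.coe_toContinuousLinearEquivOfDetNeZero]
    exact ((hgat z hz.1).differentiableAt (by simp)).hasFDerivAt
  have hcxO' : c x ∈ O' := ⟨hcx, hdetx⟩
  set e := ((hgat _ hcx).toOpenPartialHomeomorph g (hfde _ hcxO') (by simp)).restr O' with he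
  have heg : (e : ℂ → ℂ) = g := rfl
  have hes : e.source ⊆ O' := by
    rw [he, OpenPartialHomeomorph.restr_source, hO'o.interior_eq]
    exact inter_subset_right
  have hesmooth : ContDiffOn ℝ ∞ e e.source := fun z hz =>
    ((hgat z (hes hz).1).contDiffWithinAt)
  have hesymm : ContDiffOn ℝ ∞ e.symm e.target := fun w hw =>
    (e.contDiffAt_symm hw (hfde _ (hes (e.map_target hw)))
      (hgat _ (hes (e.map_target hw)).1)).contDiffWithinAt
  refine ⟨c.trans e, ?_, ?_, ?_, ?_⟩
  · rw [isOrientedChart_iff]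
    have hmem : c.trans e ∈ IsManifold.maximalAtlas 𝓘(ℝ, ℂ) ∞ M := by
      apply OpenPartialHomeomorph.mem_maximalAtlas_of_contMDiffOn
      · exact (contMDiffOn_iff_contDiffOn.2 hesmooth).comp
          ((contMDiffOn_of_mem_maximalAtlas hc.1).mono fun y hy => hy.1) fun y hy => hy.2
      · refine (contMDiffOn_symm_of_mem_maximalAtlas hc.1).comp
          ((contMDiffOn_iff_contDiffOn.2 hesymm).mono fun y hy => hy.1) fun y hy => hy.2
    refine ⟨hmem, fun y hy => ?_⟩
    have hyO' : c y ∈ O' := hes hy.2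
    have : ((c.trans e : OpenPartialHomeomorph M ℂ) : M → ℂ) = g ∘ c := rfl
    rw [this, mderiv_comp (x := y)
      ((hgat _ hyO'.1).differentiableAt (by simp)).mdifferentiableAt (hc.mdifferentiableAt hy.1),
      det_comp, mderiv_eq_fderiv]
    exact mul_pos hyO'.2 (hc.det_pos hy.1)
  · refine ⟨hxc, ?_⟩
    change c x ∈ e.source
    rw [he, OpenPartialHomeomorph.restr_source, hO'o.interior_eq]
    exact ⟨(hgat _ hcx).mem_toOpenPartialHomeomorph_source (hfde _ hcxO') (by simp), hcxO'⟩
  · intro y hy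
    have h1 : c.symm (c y) ∈ W := (hes hy.2).1.2
    rwa [c.left_inv hy.1] at h1
  · intro y hy
    change F (c.symm (c y)) = F y
    rw [c.left_inv hy.1]

end Oriented

/-! ### Closed and holomorphic forms through local primitives -/

section Primitive

variable {M : Type*} [TopologicalSpace M] [ChartedSpace ℂ M]
  {N : Type*} [TopologicalSpace N] [ChartedSpace ℂ N]

/-- `F` is a smooth primitive of the `1`-form `α` on `W`. -/
structure OneForm.HasPrimitiveOn (α : OneForm M) (F : M → ℂ) (W : Set M) : Prop where
  contMDiffOn : ContMDiffOn 𝓘(ℝ, ℂ) 𝓘(ℝ, ℂ) ∞ F W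
  mderiv_eq : ∀ y ∈ W, mderiv F y = α.coeff y

/-- The `1`-form `α` has smooth primitives locally. -/
def OneForm.IsLocallyExact (α : OneForm M) : Prop :=
  ∀ x, ∃ W : Set M, IsOpen W ∧ x ∈ W ∧ ∃ F : M → ℂ, α.HasPrimitiveOn F W

/-- In the oriented chart `φ`, the form `α` is `g(z) dz` with `g` holomorphic. -/
structure OneForm.IsHolomorphicIn (α : OneForm M) (φ : OpenPartialHomeomorph M ℂ) (g : ℂ → ℂ) :
    Prop where
  oriented : IsOrientedChart φ
  differentiableOn : DifferentiableOn ℂ g φ.target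
  inChart_apply : ∀ z ∈ φ.target, ∀ v : ℂ, OneForm.inChart φ α z v = g z * v

namespace OneForm

theorem HasPrimitiveOn.mono {α : OneForm M} {F : M → ℂ} {W W' : Set M} (h : α.HasPrimitiveOn F W)
    (hW : W' ⊆ W) : α.HasPrimitiveOn F W' :=
  ⟨h.1.mono hW, fun y hy => h.2 y (hW hy)⟩

theorem HasPrimitiveOn.mdifferentiableAt {α : OneForm M} {F : M → ℂ} {W : Set M}
    (h : α.HasPrimitiveOn F W) (hW : IsOpen W) {y : M} (hy : y ∈ W) :
    MDifferentiableAt 𝓘(ℝ, ℂ) 𝓘(ℝ, ℂ) F y :=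
  (h.1.mdifferentiableOn (by simp) y hy).mdifferentiableAt (hW.mem_nhds hy)

theorem HasPrimitiveOn.inChart_eq {α : OneForm M} {F : M → ℂ} {W : Set M}
    (h : α.HasPrimitiveOn F W) (hW : IsOpen W) {φ : OpenPartialHomeomorph M ℂ}
    (hφ : φ ∈ IsManifold.maximalAtlas 𝓘(ℝ, ℂ) ∞ M) {z : ℂ} (hz : z ∈ φ.target)
    (hzW : φ.symm z ∈ W) : inChart φ α z = fderiv ℝ (F ∘ φ.symm) z := by
  rw [fderiv_comp_symm hφ hz (h.mdifferentiableAt hW hzW), h.2 _ hzW, FlatSurface.inChart_eq]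

theorem HasPrimitiveOn.pullback {α : OneForm N} {F : N → ℂ} {W : Set N}
    (h : α.HasPrimitiveOn F W) (hW : IsOpen W) {p : M → N}
    (hp : ContMDiff 𝓘(ℝ, ℂ) 𝓘(ℝ, ℂ) ∞ p) :
    (OneForm.pullback p α).HasPrimitiveOn (F ∘ p) (p ⁻¹' W) := by
  refine ⟨h.1.comp hp.contMDiffOn subset_rfl, fun y hy => ?_⟩
  rw [mderiv_comp (h.mdifferentiableAt hW hy) (hp.mdifferentiable (by simp) y), h.2 _ hy,
    coeff_pullback]

theorem IsLocallyExact.pullback {α : OneForm N} (h : α.IsLocallyExact) {p : M → N}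
    (hp : ContMDiff 𝓘(ℝ, ℂ) 𝓘(ℝ, ℂ) ∞ p) : (OneForm.pullback p α).IsLocallyExact := fun x => by
  obtain ⟨W, hW, hx, F, hF⟩ := h (p x)
  exact ⟨p ⁻¹' W, hW.preimage hp.continuous, hx, F ∘ p, hF.pullback hW hp⟩

theorem IsLocallyExact.contDiffOn_inChart {α : OneForm M} (h : α.IsLocallyExact)
    {φ : OpenPartialHomeomorph M ℂ} (hφ : φ ∈ IsManifold.maximalAtlas 𝓘(ℝ, ℂ) ∞ M) :
    ContDiffOn ℝ ∞ (inChart φ α) φ.target := by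
  intro z hz
  obtain ⟨W, hW, hx, F, hF⟩ := h (φ.symm z)
  have hO : IsOpen (φ.target ∩ φ.symm ⁻¹' W) := φ.isOpen_inter_preimage_symm hW
  have hzO : z ∈ φ.target ∩ φ.symm ⁻¹' W := ⟨hz, hx⟩
  have hcd : ContDiffOn ℝ ∞ (F ∘ φ.symm) (φ.target ∩ φ.symm ⁻¹' W) := by
    rw [← contMDiffOn_iff_contDiffOn]
    exact hF.1.comp ((contMDiffOn_symm_of_mem_maximalAtlas hφ).mono inter_subset_left)
      fun z hz => hz.2
  have hfd : ContDiffOn ℝ ∞ (fderiv ℝ (F ∘ φ.symm)) (φ.target ∩ φ.symm ⁻¹' W) :=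
    hcd.fderiv_of_isOpen hO (by simp)
  refine ((hfd.contDiffAt (hO.mem_nhds hzO)).congr_of_eventuallyEq ?_).contDiffWithinAt
  filter_upwards [hO.mem_nhds hzO] with w hw
  exact hF.inChart_eq hW hφ hw.1 hw.2

theorem IsLocallyExact.isSmooth [IsManifold 𝓘(ℝ, ℂ) ∞ M] {α : OneForm M} (h : α.IsLocallyExact) :
    α.IsSmooth := fun _ hφ => h.contDiffOn_inChart (IsManifold.subset_maximalAtlas hφ)

theorem coeff_eq_inChart_comp {α : OneForm M} {φ : OpenPartialHomeomorph M ℂ}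
    (hφ : φ ∈ IsManifold.maximalAtlas 𝓘(ℝ, ℂ) ∞ M) {y : M} (hy : y ∈ φ.source) :
    α.coeff y = (inChart φ α (φ y)).comp (mderiv φ y) := by
  rw [FlatSurface.inChart_eq, φ.left_inv hy, ContinuousLinearMap.comp_assoc,
    mderiv_symm_comp hφ hy, ContinuousLinearMap.comp_id]

theorem IsHolomorphicIn.coeff_apply {α : OneForm M} {φ : OpenPartialHomeomorph M ℂ} {g : ℂ → ℂ}
    (h : α.IsHolomorphicIn φ g) {y : M} (hy : y ∈ φ.source) (v : ℂ) :
    α.coeff y v = g (φ y) * mderiv φ y v := by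
  rw [coeff_eq_inChart_comp h.1.1 hy, ContinuousLinearMap.comp_apply,
    h.inChart_apply _ (φ.map_source hy)]

theorem _root_.FlatSurface.surjective_of_det_pos {L : ℂ →L[ℝ] ℂ} (h : 0 < L.det) : Surjective L :=
  fun w => by
    obtain ⟨v, hv⟩ := (L.toContinuousLinearEquivOfDetNeZero h.ne').surjective w
    exact ⟨v, by simpa using hv⟩

theorem _root_.FlatSurface.det_mul_left (a : ℂ) :
    (ContinuousLinearMap.mul ℝ ℂ a).det = Complex.normSq a := by
  rw [det_eq_re_mul_im_sub]; simp [Complex.normSq_apply]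

/-- The primitive itself restricts to an oriented chart, in which the form is `dz`. -/
theorem HasPrimitiveOn.exists_flat_chart [ClosedSurface M] {α : OneForm M} {F : M → ℂ} {W : Set M}
    (h : α.HasPrimitiveOn F W) (hW : IsOpen W) {x : M} (hx : x ∈ W) (hdet : 0 < (α.coeff x).det) :
    ∃ φ : OpenPartialHomeomorph M ℂ, x ∈ φ.source ∧ φ.source ⊆ W ∧ α.IsHolomorphicIn φ 1 := by
  obtain ⟨φ, hφ, hxφ, hφW, heq⟩ := exists_isOrientedChart_eqOn hW h.1 hx (by rwa [h.2 x hx])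
  refine ⟨φ, hxφ, hφW, hφ, differentiableOn_const _, fun z hz v => ?_⟩
  rw [h.inChart_eq hW hφ.1 hz (hφW (φ.map_target hz))]
  have : F ∘ φ.symm =ᶠ[𝓝 z] id := by
    filter_upwards [φ.open_target.mem_nhds hz] with w hw
    rw [comp_apply, ← heq (φ.map_target hw), φ.right_inv hw, id]
  rw [this.fderiv_eq, fderiv_id]
  simp

theorem IsHolomorphicIn.restr [ClosedSurface M] {α β : OneForm M} {φ : OpenPartialHomeomorph M ℂ}
    {g : ℂ → ℂ} (h : α.IsHolomorphicIn φ g) {s : Set M} (hs : IsOpen s)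
    (hαβ : ∀ y ∈ s, β.coeff y = α.coeff y) : β.IsHolomorphicIn (φ.restr s) g := by
  have hsub : ∀ z ∈ (φ.restr s).target, z ∈ φ.target ∧ φ.symm z ∈ s := fun z hz =>
    ⟨hz.1, interior_subset hz.2⟩
  refine ⟨h.1.restr hs, h.2.mono fun z hz => (hsub z hz).1, fun z hz v => ?_⟩
  rw [← h.3 z (hsub z hz).1 v, FlatSurface.inChart_eq, FlatSurface.inChart_eq,
    φ.restr_symm_apply, hαβ _ (hsub z hz).2]

/-- A form which is holomorphic in charts covering the surface and does not vanish on open sets is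
holomorphic for some complex structure. -/
theorem exists_complexStructure [ClosedSurface M] {α : OneForm M}
    (hdense : Dense {x | α.coeff x ≠ 0})
    (hloc : ∀ x, ∃ φ g, x ∈ φ.source ∧ α.IsHolomorphicIn φ g) :
    ∃ J : ComplexStructure M, α.IsHolomorphic J := by
  refine ⟨⟨{φ | ∃ g, α.IsHolomorphicIn φ g}, fun x => ?_, ?_, ?_⟩, ?_⟩
  · obtain ⟨φ, g, hx, h⟩ := hloc x
    exact ⟨φ, ⟨g, h⟩, hx⟩
  · rintro φ ⟨g, h⟩
    exact h.1
  · rintro φ ⟨g, hφ⟩ ψ ⟨k, hψ⟩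
    set O := (φ.symm.trans ψ).source
    have hO : IsOpen O := (φ.symm.trans ψ).open_source
    have hOmem : ∀ z ∈ O, z ∈ φ.target ∧ φ.symm z ∈ ψ.source := fun z hz => hz
    have hcd : ContDiffOn ℝ ∞ (ψ ∘ φ.symm) O := by
      rw [← contMDiffOn_iff_contDiffOn]
      exact (contMDiffOn_of_mem_maximalAtlas hψ.1.1).comp
        ((contMDiffOn_symm_of_mem_maximalAtlas hφ.1.1).mono fun z hz => hz.1) fun z hz => hz.2
    have hcont : ContinuousOn (fderiv ℝ (ψ ∘ φ.symm)) O :=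
      hcd.continuousOn_fderiv_of_isOpen hO (by simp)
    -- `Z` is the open set where the Cauchy-Riemann equations fail. Where the form is nonzero, the
    -- transition derivative is the quotient of the two coefficients, hence complex linear; density
    -- of such points empties `Z`.
    set Z : Set ℂ := O ∩ {z | fderiv ℝ (ψ ∘ φ.symm) z Complex.I -
      Complex.I • fderiv ℝ (ψ ∘ φ.symm) z 1 ≠ 0} with hZ
    have hZo : IsOpen Z := by
      have : ContinuousOn (fun z => fderiv ℝ (ψ ∘ φ.symm) z Complex.I -
        Complex.I • fderiv ℝ (ψ ∘ φ.symm) z 1) O := by fun_prop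
      exact this.isOpen_inter_preimage hO isOpen_ne
    have hZe : Z = ∅ := by
      by_contra hne
      obtain ⟨z₀, hz₀⟩ := nonempty_iff_ne_empty.2 hne
      have himg : IsOpen (φ.source ∩ φ ⁻¹' Z) := φ.isOpen_inter_preimage hZo
      obtain ⟨y, hy, hyα⟩ := hdense.inter_open_nonempty _ himg
        ⟨φ.symm z₀, φ.map_target (hOmem _ hz₀.1).1, by
          simpa [φ.right_inv (hOmem _ hz₀.1).1] using hz₀⟩
      obtain ⟨hyO, hyne⟩ := hy.2
      apply hyne
      obtain ⟨hz, hyψ⟩ := hOmem _ hyO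
      rw [φ.left_inv hy.1] at hyψ
      have hk : k (ψ y) ≠ 0 := by
        intro h0
        apply hyα
        ext v
        rw [hψ.coeff_apply hyψ, h0]; simp
      have hlin : ∀ v : ℂ, k (ψ y) * fderiv ℝ (ψ ∘ φ.symm) (φ y) v = g (φ y) * v := fun v => by
        rw [fderiv_comp_symm hφ.1.1 hz
          (hψ.1.mdifferentiableAt (by rwa [φ.left_inv hy.1])), ← hφ.inChart_apply _ hz,
          FlatSurface.inChart_eq, φ.left_inv hy.1, ContinuousLinearMap.comp_apply,
          ContinuousLinearMap.comp_apply, hψ.coeff_apply hyψ]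
      rw [← mul_right_inj' hk, mul_sub, hlin, smul_eq_mul, mul_left_comm, hlin]
      ring
    intro z hz
    have hd : DifferentiableAt ℝ (ψ ∘ φ.symm) z :=
      (hcd.contDiffAt (hO.mem_nhds hz)).differentiableAt (by simp)
    refine (differentiableAt_complex_iff_differentiableAt_real.2 ⟨hd, ?_⟩).differentiableWithinAt
    by_contra hne
    have : z ∈ Z := ⟨hz, sub_ne_zero.2 hne⟩
    rw [hZe] at this
    exact this
  · rintro φ ⟨g, h⟩
    exact ⟨g, h.2, h.3⟩

theorem IsHolomorphic.exists_isHolomorphicIn {α : OneForm M} {J : ComplexStructure M}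
    (h : α.IsHolomorphic J) (x : M) : ∃ φ g, x ∈ φ.source ∧ α.IsHolomorphicIn φ g := by
  obtain ⟨φ, hφ, hx⟩ := J.cover x
  obtain ⟨g, hg, hgα⟩ := h φ hφ
  exact ⟨φ, g, hx, J.compatible φ hφ, hg, hgα⟩

theorem IsHolomorphicIn.exists_primitive {α : OneForm M} {φ : OpenPartialHomeomorph M ℂ} {g : ℂ → ℂ}
    (h : α.IsHolomorphicIn φ g) {x : M} (hx : x ∈ φ.source) :
    ∃ r > 0, Metric.ball (φ x) r ⊆ φ.target ∧ ∃ G : ℂ → ℂ,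
      (∀ z ∈ Metric.ball (φ x) r, HasDerivAt G (g z) z) ∧
      α.HasPrimitiveOn (G ∘ φ) (φ.source ∩ φ ⁻¹' Metric.ball (φ x) r) := by
  obtain ⟨r, hr, hball⟩ := Metric.isOpen_iff.1 φ.open_target _ (φ.map_source hx)
  obtain ⟨G, hG⟩ := (h.2.mono hball).isExactOn_ball
  have hGd : DifferentiableOn ℂ G (Metric.ball (φ x) r) := fun z hz =>
    (hG z hz).differentiableAt.differentiableWithinAt
  have hGs : ContDiffOn ℝ ∞ G (Metric.ball (φ x) r) :=
    (hGd.contDiffOn Metric.isOpen_ball).restrict_scalars ℝ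
  refine ⟨r, hr, hball, G, hG, ?_, fun y hy => ?_⟩
  · exact (contMDiffOn_iff_contDiffOn.2 hGs).comp
      ((contMDiffOn_of_mem_maximalAtlas h.1.1).mono inter_subset_left) fun y hy => hy.2
  · have hGr := (hG _ hy.2).hasFDerivAt.restrictScalars ℝ
    rw [mderiv_comp (x := y) hGr.differentiableAt.mdifferentiableAt (h.1.mdifferentiableAt hy.1),
      mderiv_eq_fderiv, hGr.fderiv]
    ext v
    rw [h.coeff_apply hy.1]
    simp [mul_comm]

theorem IsHolomorphic.isLocallyExact {α : OneForm M} {J : ComplexStructure M}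
    (h : α.IsHolomorphic J) : α.IsLocallyExact := fun x => by
  obtain ⟨φ, g, hx, hφ⟩ := h.exists_isHolomorphicIn x
  obtain ⟨r, hr, -, G, -, hG⟩ := hφ.exists_primitive hx
  exact ⟨_, φ.isOpen_inter_preimage Metric.isOpen_ball, ⟨hx, Metric.mem_ball_self hr⟩, _, hG⟩

theorem IsHolomorphicIn.det_coeff {α : OneForm M} {φ : OpenPartialHomeomorph M ℂ} {g : ℂ → ℂ}
    (h : α.IsHolomorphicIn φ g) {y : M} (hy : y ∈ φ.source) :
    (α.coeff y).det = Complex.normSq (g (φ y)) * (mderiv φ y).det := by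
  have : α.coeff y = (ContinuousLinearMap.mul ℝ ℂ (g (φ y))).comp (mderiv φ y) := by
    ext v
    rw [h.coeff_apply hy]; simp
  rw [this, det_comp, det_mul_left]

theorem IsHolomorphic.det_coeff_nonneg [ClosedSurface M] {α : OneForm M} {J : ComplexStructure M}
    (h : α.IsHolomorphic J) (y : M) : 0 ≤ (α.coeff y).det := by
  obtain ⟨φ, g, hx, hφ⟩ := h.exists_isHolomorphicIn y
  rw [hφ.det_coeff hx]
  exact mul_nonneg (Complex.normSq_nonneg _) (hφ.1.det_pos hx).le

/-- The identity theorem for holomorphic `1`-forms. -/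
theorem IsHolomorphic.dense_coeff_ne_zero [ClosedSurface M] {α : OneForm M}
    {J : ComplexStructure M} (h : α.IsHolomorphic J) (hα : α ≠ 0) :
    Dense {x | α.coeff x ≠ 0} := by
  set Z := interior {x | α.coeff x = 0} with hZ
  have hclosed : IsClosed Z := by
    refine isClosed_of_closure_subset fun x hx => ?_
    obtain ⟨φ, g, hxφ, hφ⟩ := h.exists_isHolomorphicIn x
    have hg0 : ∀ y ∈ φ.source, α.coeff y = 0 ↔ g (φ y) = 0 := fun y hy => by
      constructor
      · intro h0
        obtain ⟨v, hv⟩ := surjective_of_det_pos (hφ.1.det_pos hy) 1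
        have := hφ.coeff_apply hy v
        rw [h0, hv] at this
        simpa using this.symm
      · intro h0
        ext v
        rw [hφ.coeff_apply hy, h0]; simp
    have han : AnalyticAt ℂ g (φ x) :=
      hφ.2.analyticAt (φ.open_target.mem_nhds (φ.map_source hxφ))
    -- A limit point of the open set `Z` cannot be an isolated zero, since `Z` meets every
    -- neighbourhood in a nonempty open set.
    have hz : ∀ᶠ z in 𝓝 (φ x), g z = 0 := by
      rcases han.eventually_eq_zero_or_eventually_ne_zero with h0 | h0
      · exact h0
      · exfalso
        obtain ⟨V, hV, hVo, hxV⟩ := mem_nhds_iff.1 (eventually_nhdsWithin_iff.1 h0)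
        have hO : IsOpen (φ.source ∩ φ ⁻¹' V) := φ.isOpen_inter_preimage hVo
        obtain ⟨y, hy, hyZ⟩ := mem_closure_iff.1 hx _ hO ⟨hxφ, hxV⟩
        have hO2 : IsOpen (φ.source ∩ φ ⁻¹' V ∩ Z) := hO.inter isOpen_interior
        have hO3 : IsOpen (φ '' (φ.source ∩ φ ⁻¹' V ∩ Z)) :=
          φ.isOpen_image_of_subset_source hO2 fun _ hy => hy.1.1
        have hsub : φ '' (φ.source ∩ φ ⁻¹' V ∩ Z) ⊆ {φ x} := by
          rintro _ ⟨w, ⟨⟨hw, hwV⟩, hwZ⟩, rfl⟩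
          by_contra hne
          exact hV hwV hne ((hg0 w hw).1 (interior_subset hwZ : w ∈ {x | α.coeff x = 0}))
        have heq := (subset_singleton_iff_eq.1 hsub).resolve_left
          (Nonempty.ne_empty ⟨φ y, y, ⟨hy, hyZ⟩, rfl⟩)
        rw [heq] at hO3
        exact not_isOpen_singleton (φ x) hO3
    rw [hZ, mem_interior_iff_mem_nhds]
    filter_upwards [φ.open_source.mem_nhds hxφ, (φ.continuousAt hxφ).eventually hz] with y hy hy0
    exact (hg0 y hy).2 hy0
  have hZe : Z = ∅ := by
    refine (isClopen_iff.1 ⟨hclosed, isOpen_interior⟩).resolve_right fun hu => hα ?_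
    refine OneForm.ext_coeff fun x => ?_
    have hx : x ∈ Z := hu ▸ mem_univ x
    exact (interior_subset hx : x ∈ {x | α.coeff x = 0})
  rw [show {x | α.coeff x ≠ 0} = {x | α.coeff x = 0}ᶜ from rfl,
    ← interior_eq_empty_iff_dense_compl]
  exact hZe

end OneForm

end Primitive

/-! ### Developing maps of tori -/

section Torus

variable {T : Type*} [TopologicalSpace T] [ChartedSpace ℂ T]

/-- `f` is a developing map of the `1`-form `α` on a torus with parametrization `π`, and `v₁, v₂`
are the periods. -/
structure IsDevelopingMap (π : ℂ → T) (α : OneForm T) (f : ℂ → ℂ) (v₁ v₂ : ℂ) : Prop where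
  contDiff : ContDiff ℝ ∞ f
  fderiv_eq : ∀ z, fderiv ℝ f z = (OneForm.pullback π α).coeff z
  add_one : ∀ z, f (z + 1) = f z + v₁
  add_I : ∀ z, f (z + Complex.I) = f z + v₂

theorem IsDevelopingMap.hasFDerivAt {π : ℂ → T} {α : OneForm T} {f : ℂ → ℂ} {v₁ v₂ : ℂ}
    (h : IsDevelopingMap π α f v₁ v₂) (z : ℂ) :
    HasFDerivAt f ((OneForm.pullback π α).coeff z) z :=
  h.fderiv_eq z ▸ (h.contDiff.differentiable (by simp) z).hasFDerivAt

namespace IsTorusParametrization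

theorem mdifferentiableAt {π : ℂ → T} (hπ : IsTorusParametrization π) (z : ℂ) :
    MDifferentiableAt 𝓘(ℝ, ℂ) 𝓘(ℝ, ℂ) π z :=
  hπ.smooth.mdifferentiable (by simp) z

theorem apply_add {π : ℂ → T} (hπ : IsTorusParametrization π) (z : ℂ) (m n : ℤ) :
    π (z + (m + n * Complex.I)) = π z :=
  (hπ.fibres _ _).2 ⟨m, n, by ring⟩

theorem coeff_pullback_add {π : ℂ → T} (hπ : IsTorusParametrization π) (α : OneForm T) (z : ℂ)
    (m n : ℤ) : (OneForm.pullback π α).coeff (z + (m + n * Complex.I)) =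
      (OneForm.pullback π α).coeff z := by
  set c : ℂ := m + n * Complex.I with hc
  have h1 : π ∘ (fun w => w + c) = π := funext fun w => hπ.apply_add w m n
  have hd : HasFDerivAt (fun w : ℂ => w + c) (ContinuousLinearMap.id ℝ ℂ) z :=
    (hasFDerivAt_id z).add_const c
  have h2 := mderiv_comp (g := π) (f := fun w : ℂ => w + c) (x := z) (hπ.mdifferentiableAt _)
    hd.differentiableAt.mdifferentiableAt
  rw [h1, mderiv_eq_fderiv, hd.fderiv, ContinuousLinearMap.comp_id] at h2
  rw [coeff_pullback, coeff_pullback, ← h2, hπ.apply_add z m n]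

/-- Poincaré lemma on the plane for the pulled back form. Invariance of that form under lattice
translations makes the increments of the primitive constant. -/
theorem exists_isDevelopingMap {π : ℂ → T} (hπ : IsTorusParametrization π) {α : OneForm T}
    (hα : α.IsLocallyExact) : ∃ f v₁ v₂, IsDevelopingMap π α f v₁ v₂ := by
  set η : ℂ → ℂ →L[ℝ] ℂ := (OneForm.pullback π α).coeff
  have hloc : ∀ z, ∃ W : Set ℂ, IsOpen W ∧ z ∈ W ∧ ∃ H : ℂ → ℂ, ContDiffOn ℝ ∞ H W ∧
      ∀ w ∈ W, fderiv ℝ H w = η w := fun z => by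
    obtain ⟨W, hW, hz, H, hH⟩ := hα.pullback hπ.smooth z
    exact ⟨W, hW, hz, H, contMDiffOn_iff_contDiffOn.1 hH.1,
      fun w hw => mderiv_eq_fderiv.symm.trans (hH.2 w hw)⟩
  have hη : ContDiff ℝ ∞ η := contDiff_iff_contDiffAt.2 fun z => by
    obtain ⟨W, hW, hz, H, hH, hHη⟩ := hloc z
    refine ((hH.fderiv_of_isOpen hW (by simp)).contDiffAt
      (hW.mem_nhds hz)).congr_of_eventuallyEq ?_
    filter_upwards [hW.mem_nhds hz] with w hw using (hHη w hw).symm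
  -- Closedness, read off from the symmetric second derivative of a local primitive.
  have hsymm : ∀ z ∈ (univ : Set ℂ), ∀ x y, fderiv ℝ η z x y = fderiv ℝ η z y x := by
    intro z _ x y
    obtain ⟨W, hW, hz, H, hH, hHη⟩ := hloc z
    have : η =ᶠ[𝓝 z] fderiv ℝ H := by
      filter_upwards [hW.mem_nhds hz] with w hw using (hHη w hw).symm
    rw [this.fderiv_eq]
    exact ((hH.contDiffAt (hW.mem_nhds hz)).isSymmSndFDerivAt
      (by simpa using (ENat.LEInfty.out : (2 : ℕ∞ω) ≤ ∞))).eq _ _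
  obtain ⟨f, hf⟩ := convex_univ.exists_forall_hasFDerivAt_of_fderiv_symmetric isOpen_univ
    (hη.differentiable (by simp)).differentiableOn hsymm
  have hfd : fderiv ℝ f = η := funext fun z => (hf z (mem_univ z)).fderiv
  have hdiff : Differentiable ℝ f := fun z => (hf z (mem_univ z)).differentiableAt
  have hper : ∀ m n : ℤ, ∃ v, ∀ z, f (z + (m + n * Complex.I)) = f z + v := fun m n => by
    have h0 : ∀ z, fderiv ℝ (fun w => f (w + (m + n * Complex.I)) - f w) z = 0 := fun z => by
      rw [fderiv_fun_sub (by fun_prop) (hdiff z), fderiv_comp_add_right, hfd, sub_eq_zero]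
      exact hπ.coeff_pullback_add α z m n
    refine ⟨f (0 + (m + n * Complex.I)) - f 0, fun z => ?_⟩
    have hd : Differentiable ℝ fun w => f (w + (m + n * Complex.I)) - f w := by fun_prop
    have := is_const_of_fderiv_eq_zero hd h0 z 0
    rw [← this]; ring
  obtain ⟨v₁, h₁⟩ := hper 1 0
  obtain ⟨v₂, h₂⟩ := hper 0 1
  refine ⟨f, v₁, v₂, contDiff_infty_iff_fderiv.2 ⟨hdiff, hfd ▸ hη⟩, fun z => congrFun hfd z,
    fun z => by simpa using h₁ z, fun z => by simpa using h₂ z⟩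

theorem contDiffAt_comp_chart {π : ℂ → T} (hπ : IsTorusParametrization π)
    {φ : OpenPartialHomeomorph T ℂ} (hφ : IsOrientedChart φ) {z : ℂ} (hz : π z ∈ φ.source) :
    ContDiffAt ℝ ∞ (φ ∘ π) z := by
  rw [← contMDiffAt_iff_contDiffAt]
  exact (contMDiffAt_of_mem_maximalAtlas hφ.1 hz).comp z hπ.smooth.contMDiffAt

variable [ClosedSurface T]

theorem det_mderiv_pos {π : ℂ → T} (hπ : IsTorusParametrization π) (z : ℂ) :
    0 < (mderiv π z).det := by
  set φ := chartAt ℂ (π z)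
  have hφ : IsOrientedChart φ := isOrientedChart_of_mem_atlas (chart_mem_atlas ℂ _)
  have h := hπ.oriented φ (chart_mem_atlas ℂ _) z (mem_chart_source ℂ _)
  rw [← mderiv_eq_fderiv, mderiv_comp (hφ.mdifferentiableAt (mem_chart_source ℂ _))
    (hπ.mdifferentiableAt z), det_comp] at h
  exact (pos_iff_pos_of_mul_pos h).1 (hφ.det_pos (mem_chart_source ℂ _))

theorem det_fderiv_comp_chart_pos {π : ℂ → T} (hπ : IsTorusParametrization π)
    {φ : OpenPartialHomeomorph T ℂ} (hφ : IsOrientedChart φ) {z : ℂ} (hz : π z ∈ φ.source) :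
    0 < (fderiv ℝ (φ ∘ π) z).det := by
  rw [← mderiv_eq_fderiv, mderiv_comp (hφ.mdifferentiableAt hz) (hπ.mdifferentiableAt z), det_comp]
  exact mul_pos (hφ.det_pos hz) (hπ.det_mderiv_pos z)

theorem hasFDerivAt_comp_chart {π : ℂ → T} (hπ : IsTorusParametrization π)
    {φ : OpenPartialHomeomorph T ℂ} (hφ : IsOrientedChart φ) {z : ℂ} (hz : π z ∈ φ.source) :
    HasFDerivAt (φ ∘ π) ((fderiv ℝ (φ ∘ π) z).toContinuousLinearEquivOfDetNeZero
      (hπ.det_fderiv_comp_chart_pos hφ hz).ne' : ℂ →L[ℝ] ℂ) z := by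
  rw [ContinuousLinearMap.coe_toContinuousLinearEquivOfDetNeZero]
  exact ((hπ.contDiffAt_comp_chart hφ hz).differentiableAt (by simp)).hasFDerivAt

theorem isOpenMap {π : ℂ → T} (hπ : IsTorusParametrization π) : IsOpenMap π := by
  refine IsOpenMap.of_nhds_le fun z => ?_
  set φ := chartAt ℂ (π z)
  have hφ : IsOrientedChart φ := isOrientedChart_of_mem_atlas (chart_mem_atlas ℂ _)
  have hz : π z ∈ φ.source := mem_chart_source ℂ _
  have hmap : Filter.map (φ ∘ π) (𝓝 z) = 𝓝 (φ (π z)) :=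
    ((hπ.contDiffAt_comp_chart hφ hz).hasStrictFDerivAt'
      (hπ.hasFDerivAt_comp_chart hφ hz) (by simp)).map_nhds_eq_of_equiv
  have h2 : Filter.map φ.symm (𝓝 (φ (π z))) = 𝓝 (π z) := by
    rw [φ.symm_map_nhds_eq hz]
  rw [← h2, ← hmap, Filter.map_map]
  refine (Filter.map_congr ?_).le
  filter_upwards [hπ.smooth.continuous.continuousAt.preimage_mem_nhds
    (φ.open_source.mem_nhds hz)] with w hw
  exact φ.left_inv hw

end IsTorusParametrization

namespace IsDevelopingMap

variable {π : ℂ → T} {α : OneForm T} {f : ℂ → ℂ} {v₁ v₂ : ℂ}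

theorem apply_add (h : IsDevelopingMap π α f v₁ v₂) (z : ℂ) (m n : ℤ) :
    f (z + (m + n * Complex.I)) = f z + (m * v₁ + n * v₂) :=
  apply_add_lattice h.add_one h.add_I z m n

theorem eventually_eq_primitive (h : IsDevelopingMap π α f v₁ v₂) (hπ : IsTorusParametrization π)
    {F : T → ℂ} {W : Set T} (hF : α.HasPrimitiveOn F W) (hW : IsOpen W) {z : ℂ} (hz : π z ∈ W) :
    ∃ c, ∀ᶠ w in 𝓝 z, f w = F (π w) + c := by
  obtain ⟨r, hr, hball⟩ := Metric.isOpen_iff.1 (hW.preimage hπ.smooth.continuous) z hz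
  have hFπ : ∀ w ∈ Metric.ball z r, HasFDerivAt (F ∘ π) ((OneForm.pullback π α).coeff w) w :=
    fun w hw => by
      have h1 := (hF.pullback hW hπ.smooth).mdifferentiableAt (hW.preimage hπ.smooth.continuous)
        (hball hw)
      have h2 := (hF.pullback hW hπ.smooth).2 w (hball hw)
      rw [mderiv_eq_fderiv] at h2
      exact h2 ▸ (mdifferentiableAt_iff_differentiableAt.1 h1).hasFDerivAt
  have hd : ∀ w ∈ Metric.ball z r, HasFDerivAt (fun w => f w - F (π w)) (0 : ℂ →L[ℝ] ℂ) w :=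
    fun w hw => by
      have := (h.hasFDerivAt w).sub (hFπ w hw)
      rw [sub_self] at this
      exact this
  refine ⟨f z - F (π z), ?_⟩
  filter_upwards [Metric.ball_mem_nhds z hr] with w hw
  have := (convex_ball z r).is_const_of_fderivWithin_eq_zero (𝕜 := ℝ)
    (fun y hy => (hd y hy).differentiableAt.differentiableWithinAt)
    (fun y hy => by
      rw [fderivWithin_of_isOpen Metric.isOpen_ball hy, (hd y hy).fderiv])
    hw (Metric.mem_ball_self hr)
  rw [← this]; ring

/-- Locally `f` is a holomorphic function after the local diffeomorphism `φ ∘ π`, so openness and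
the absence of critical points reduce to complex analysis. -/
theorem comp_primitive {J : ComplexStructure T} (h : IsDevelopingMap π α f v₁ v₂)
    (hπ : IsTorusParametrization π) (hα : α.IsHolomorphic J) (z : ℂ) :
    ∃ φ g G c, π z ∈ φ.source ∧ α.IsHolomorphicIn φ g ∧
      (∀ᶠ u in 𝓝 (φ (π z)), HasDerivAt G (g u) u) ∧ ∀ᶠ w in 𝓝 z, f w = G (φ (π w)) + c := by
  obtain ⟨φ, g, hz, hφ⟩ := hα.exists_isHolomorphicIn (π z)
  obtain ⟨r, hr, -, G, hG, hprim⟩ := hφ.exists_primitive hz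
  obtain ⟨c, hc⟩ := h.eventually_eq_primitive hπ hprim (φ.isOpen_inter_preimage Metric.isOpen_ball)
    ⟨hz, Metric.mem_ball_self hr⟩
  refine ⟨φ, g, G, c, hz, hφ, ?_, hc⟩
  filter_upwards [Metric.ball_mem_nhds _ hr] with u hu using hG u hu

theorem torusArea_eq (h : IsDevelopingMap π α f v₁ v₂) :
    torusArea π α = v₁.re * v₂.im - v₂.re * v₁.im := by
  rw [← integral_det_unitSquare (contDiff_infty.1 h.contDiff 2) h.add_one h.add_I]
  simp only [h.fderiv_eq]
  rfl

variable [ClosedSurface T]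

/-- Open mapping theorem for the holomorphic factor; it is not locally constant because a nonzero
holomorphic form cannot vanish on an open set. -/
theorem isOpenMap {J : ComplexStructure T} (h : IsDevelopingMap π α f v₁ v₂)
    (hπ : IsTorusParametrization π) (hα : α.IsHolomorphic J) (hα0 : α ≠ 0) : IsOpenMap f := by
  refine IsOpenMap.of_nhds_le fun z => ?_
  obtain ⟨φ, g, G, c, hz, hφ, hG, hfG⟩ := h.comp_primitive hπ hα z
  have hmap : Filter.map (φ ∘ π) (𝓝 z) = 𝓝 (φ (π z)) :=
    ((hπ.contDiffAt_comp_chart hφ.1 hz).hasStrictFDerivAt'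
      (hπ.hasFDerivAt_comp_chart hφ.1 hz) (by simp)).map_nhds_eq_of_equiv
  have han : AnalyticAt ℂ G (φ (π z)) := Complex.analyticAt_iff_eventually_differentiableAt.2
    (hG.mono fun u hu => hu.differentiableAt)
  have hopen : 𝓝 (G (φ (π z))) ≤ Filter.map G (𝓝 (φ (π z))) := by
    refine han.eventually_constant_or_nhds_le_map_nhds.resolve_left fun hconst => ?_
    have hg0 : ∀ᶠ u in 𝓝 (φ (π z)), g u = 0 := by
      filter_upwards [hG, hconst.eventually_nhds] with u hu hcu
      refine hu.unique ((hasDerivAt_const u (G (φ (π z)))).congr_of_eventuallyEq ?_)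
      exact hcu
    have hα' : ∀ᶠ y in 𝓝 (π z), α.coeff y = 0 := by
      filter_upwards [φ.open_source.mem_nhds hz, (φ.continuousAt hz).eventually hg0] with y hy hy0
      ext v
      rw [hφ.coeff_apply hy, hy0]; simp
    obtain ⟨y, hy, hy0⟩ := (hα.dense_coeff_ne_zero hα0).inter_nhds_nonempty hα'
    exact hy hy0
  have hfmap : Filter.map f (𝓝 z) = Filter.map (fun w => w + c) (Filter.map G (𝓝 (φ (π z)))) := by
    rw [← hmap, Filter.map_map, Filter.map_map]
    exact Filter.map_congr hfG
  rw [hfmap, hfG.self_of_nhds]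
  have : 𝓝 (G (φ (π z)) + c) = Filter.map (fun w => w + c) (𝓝 (G (φ (π z)))) :=
    (map_add_right_nhds c _).symm
  rw [this]
  exact Filter.map_mono hopen

theorem periods_pos_and_bijective {J : ComplexStructure T} (h : IsDevelopingMap π α f v₁ v₂)
    (hπ : IsTorusParametrization π) (hα : α.IsHolomorphic J) (hα0 : α ≠ 0) :
    0 < v₁.re * v₂.im - v₂.re * v₁.im ∧ Bijective f := by
  refine bijective_of_periods hπ.smooth.continuous hπ.fibres (contDiff_infty.1 h.contDiff 2)
    (h.isOpenMap hπ hα hα0) h.add_one h.add_I fun z => ?_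
  rw [h.fderiv_eq, coeff_pullback, det_comp]
  exact mul_nonneg (hα.det_coeff_nonneg _) (hπ.det_mderiv_pos z).le

/-- An Abelian differential on a torus has no zeros. -/
theorem det_coeff_pos {J : ComplexStructure T} (h : IsDevelopingMap π α f v₁ v₂)
    (hπ : IsTorusParametrization π) (hα : α.IsHolomorphic J) (hα0 : α ≠ 0) (x : T) :
    0 < (α.coeff x).det := by
  obtain ⟨z, rfl⟩ := hπ.surjective x
  obtain ⟨φ, g, G, c, hz, hφ, hG, hfG⟩ := h.comp_primitive hπ hα z
  set F : ℂ ≃ₜ ℂ :=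
    (Equiv.ofBijective f (h.periods_pos_and_bijective hπ hα hα0).2).toHomeomorphOfContinuousOpen
    h.contDiff.continuous (h.isOpenMap hπ hα hα0)
  have hFf : ∀ w, F w = f w := fun w => rfl
  set k := (hπ.contDiffAt_comp_chart hφ.1 hz).toOpenPartialHomeomorph (φ ∘ π)
    (hπ.hasFDerivAt_comp_chart hφ.1 hz) (by simp)
  have hkz : z ∈ k.source := ContDiffAt.mem_toOpenPartialHomeomorph_source _ _ _
  have hkφ : ∀ w, k w = φ (π w) := fun w => rfl
  set u := φ (π z) with hu
  have hut : u ∈ k.target := k.map_source hkz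
  have hks : k.symm u = z := k.left_inv hkz
  have hev : ∀ᶠ y in 𝓝 u, y ∈ k.target ∧ HasDerivAt G (g y) y ∧ f (k.symm y) = G y + c := by
    have hc : Filter.Tendsto k.symm (𝓝 u) (𝓝 z) := by
      have := (k.continuousAt_symm hut).tendsto
      rwa [hks] at this
    filter_upwards [k.open_target.mem_nhds hut, hG, hc.eventually hfG] with y hy hGy hfy
    refine ⟨hy, hGy, ?_⟩
    rw [hfy, ← hkφ, k.right_inv hy]
  obtain ⟨V, hV, hVo, huV⟩ := mem_nhds_iff.1 hev
  -- On `V` this map is `G + c`, and it is injective because `f` is bijective. An injective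
  -- holomorphic map has nonzero derivative, here the coefficient of the form.
  set e := (k.symm.trans F.toOpenPartialHomeomorph).restr V
  have hes : ∀ y ∈ e.source, y ∈ V := fun y hy => interior_subset hy.2
  have hue : u ∈ e.source := by
    refine ⟨⟨hut, mem_univ _⟩, ?_⟩
    rwa [hVo.interior_eq]
  have hder : ∀ y ∈ V, HasDerivAt e (g y) y := fun y hy => by
    refine ((hV hy).2.1.add_const c).congr_of_eventuallyEq ?_
    filter_upwards [hVo.mem_nhds hy] with w hw using (hV hw).2.2
  have hne := deriv_ne_zero_of_openPartialHomeomorph e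
    (fun y hy => (hder y (hes y hy)).differentiableAt.differentiableWithinAt) hue
  rw [(hder u huV).deriv] at hne
  rw [hφ.det_coeff hz]
  exact mul_pos (Complex.normSq_pos.2 hne) (hφ.1.det_pos hz)

end IsDevelopingMap

end Torus

/-! ### Path lifting, flat lengths and the vertical flow -/

theorem homotopic_refl_of_lift {X : Type*} [TopologicalSpace X] {π : ℂ → X} (hπ : Continuous π)
    {x : X} {γ : Path x x} {z : ℂ}
    (Γ : Path z z) (h : ∀ t, π (Γ t) = γ t) : γ.Homotopic (Path.refl x) := by
  obtain rfl : π z = x := by simpa using h 0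
  have hγ : γ = Γ.map hπ := by
    ext t
    exact (h t).symm
  have hr : Path.refl (π z) = (Path.refl z).map hπ := by
    ext t
    rfl
  rw [hγ, hr]
  exact (SimplyConnectedSpace.paths_homotopic Γ (Path.refl z)).map ⟨π, hπ⟩

section Lifting

variable {T : Type*} [TopologicalSpace T] [ChartedSpace ℂ T]

/-- The lattice of Gaussian integers. -/
def gaussianLattice : AddSubgroup ℂ where
  carrier := {z | ∃ m n : ℤ, z = m + n * Complex.I}
  zero_mem' := ⟨0, 0, by simp⟩
  add_mem' := by
    rintro _ _ ⟨m, n, rfl⟩ ⟨m', n', rfl⟩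
    exact ⟨m + m', n + n', by push_cast; ring⟩
  neg_mem' := by
    rintro _ ⟨m, n, rfl⟩
    exact ⟨-m, -n, by push_cast; ring⟩

theorem IsTorusParametrization.isCoveringMap [ClosedSurface T] {π : ℂ → T}
    (hπ : IsTorusParametrization π) : IsCoveringMap π := by
  have h : IsAddQuotientCoveringMap π gaussianLattice :=
    { toIsQuotientMap := hπ.isOpenMap.isQuotientMap hπ.smooth.continuous hπ.surjective
      continuous_const_vadd := fun g => continuous_const.add continuous_id
      apply_eq_iff_mem_orbit := by
        intro z w
        rw [hπ.fibres]
        constructor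
        · rintro ⟨m, n, h⟩
          refine ⟨⟨m + n * Complex.I, m, n, rfl⟩, ?_⟩
          change (m + n * Complex.I : ℂ) + w = z
          rw [← h]; ring
        · rintro ⟨⟨_, m, n, rfl⟩, h⟩
          change (m + n * Complex.I : ℂ) + w = z at h
          exact ⟨m, n, by rw [← h]; ring⟩
      disjoint := fun e => by
        -- Two points of this ball differ by less than one, the least norm of a nonzero Gaussian
        -- integer.
        refine ⟨Metric.ball e (1 / 2), Metric.ball_mem_nhds e (by norm_num), ?_⟩
        rintro ⟨_, m, n, rfl⟩ ⟨_, ⟨w, hw, rfl⟩, hw'⟩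
        change (m + n * Complex.I : ℂ) + w ∈ Metric.ball e (1 / 2) at hw'
        have hlt : ‖(m + n * Complex.I : ℂ)‖ < 1 := by
          rw [Metric.mem_ball, dist_eq_norm] at hw hw'
          have e1 : (m + n * Complex.I : ℂ) = (m + n * Complex.I + w - e) - (w - e) := by ring
          rw [e1]
          refine (norm_sub_le _ _).trans_lt ?_
          linarith
        have h1 := (Complex.abs_re_le_norm _).trans_lt hlt
        have h2 := (Complex.abs_im_le_norm _).trans_lt hlt
        simp only [Complex.add_re, Complex.intCast_re, Complex.mul_re, Complex.I_re, mul_zero,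
          Complex.intCast_im, Complex.I_im, mul_one, sub_self, add_zero, Complex.add_im,
          Complex.mul_im, zero_add] at h1 h2
        have hm : m = 0 := Int.abs_lt_one_iff.1 (by exact_mod_cast h1)
        have hn : n = 0 := Int.abs_lt_one_iff.1 (by exact_mod_cast h2)
        subst hm hn
        ext
        simp }
  exact h.isCoveringMap

namespace IsDevelopingMap

variable [ClosedSurface T] {π : ℂ → T} {α : OneForm T} {f : ℂ → ℂ} {v₁ v₂ : ℂ}

/-- A path on the torus lifts to the plane, and its length is at least the distance of the images
of the end points of the lift under the developing map. -/
theorem exists_lift_enorm_sub_le_length (h : IsDevelopingMap π α f v₁ v₂)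
    (hπ : IsTorusParametrization π) (hα : α.IsLocallyExact) {x y : T} {γ : Path x y}
    (hγ : IsC1Path γ) {z : ℂ} (hz : π z = x) :
    ∃ (z' : ℂ) (Γ : Path z z'), π z' = y ∧ (∀ t, π (Γ t) = γ t) ∧ ‖f z' - f z‖ₑ ≤ α.length γ := by
  obtain ⟨Γ, hΓ, hΓ0⟩ := hπ.isCoveringMap.exists_path_lifts (γ : C(unitInterval, T)) z
    (by simp [hz])
  have hΓγ : ∀ t, π (Γ t) = γ t := fun t => congrFun hΓ t
  refine ⟨Γ 1, ⟨Γ, hΓ0, rfl⟩, by simpa using hΓγ 1, hΓγ, ?_⟩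
  set c : ℝ → ℂ := IccExtend zero_le_one Γ with hc
  have hcc : Continuous c := Γ.continuous.Icc_extend'
  have hcγ : ∀ t, π (c t) = γ.extend t := fun t => hΓγ _
  -- Differentiability of the lift `c` is not needed: `f ∘ c` is locally a primitive of `α` along
  -- `γ` plus a constant, with derivative the integrand of the length.
  have key : ∀ t ∈ Icc (0 : ℝ) 1, ContDiffWithinAt ℝ 1 (f ∘ c) (Icc 0 1) t ∧
      derivWithin (f ∘ c) (Icc 0 1) t = α.coeff (γ.extend t)
        (mfderivWithin 𝓘(ℝ, ℝ) 𝓘(ℝ, ℂ) γ.extend (Icc 0 1) t (1 : ℝ)) := by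
    intro t ht
    obtain ⟨W, hW, hxW, F, hF⟩ := hα (γ.extend t)
    obtain ⟨b, hb⟩ := h.eventually_eq_primitive hπ hF hW (z := c t) (by rwa [hcγ])
    have hev : ∀ᶠ s in 𝓝 t, (f ∘ c) s = (F ∘ γ.extend) s + b := by
      filter_upwards [hcc.continuousAt.eventually hb] with s hs
      rw [comp_apply, hs, hcγ, comp_apply]
    have hFat : ContMDiffAt 𝓘(ℝ, ℂ) 𝓘(ℝ, ℂ) 1 F (γ.extend t) :=
      ((hF.1 _ hxW).contMDiffAt (hW.mem_nhds hxW)).of_le (by simp)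
    have hcomp : ContMDiffWithinAt 𝓘(ℝ, ℝ) 𝓘(ℝ, ℂ) 1 (F ∘ γ.extend) (Icc 0 1) t :=
      hFat.comp_contMDiffWithinAt t (hγ t ht)
    constructor
    · exact ((contMDiffWithinAt_iff_contDiffWithinAt.1 hcomp).add contDiffWithinAt_const
        ).congr_of_eventuallyEq (nhdsWithin_le_nhds hev) hev.self_of_nhds
    · have h1 : HasMFDerivWithinAt 𝓘(ℝ, ℝ) 𝓘(ℝ, ℂ) γ.extend (Icc 0 1) t _ :=
        ((hγ t ht).mdifferentiableWithinAt (by simp)).hasMFDerivWithinAt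
      have h2 : HasMFDerivAt 𝓘(ℝ, ℂ) 𝓘(ℝ, ℂ) F (γ.extend t) _ :=
        (hFat.mdifferentiableAt (by simp)).hasMFDerivAt
      have h3 : HasFDerivWithinAt (F ∘ γ.extend) ((mderiv F (γ.extend t)).comp
          (mfderivWithin 𝓘(ℝ, ℝ) 𝓘(ℝ, ℂ) γ.extend (Icc 0 1) t : ℝ →L[ℝ] ℂ)) (Icc 0 1) t :=
        hasMFDerivWithinAt_iff_hasFDerivWithinAt.1 (h2.comp_hasMFDerivWithinAt t h1)
      have h4 := ((h3.hasDerivWithinAt.add_const b).congr_of_eventuallyEq (nhdsWithin_le_nhds hev)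
        hev.self_of_nhds).derivWithin (uniqueDiffOn_Icc_zero_one t ht)
      rw [h4, ← hF.2 _ hxW]
      rfl
  have hlen := enorm_sub_le_lintegral_derivWithin_Icc_of_contDiffOn_Icc
    (fun t ht => (key t ht).1) (zero_le_one' ℝ)
  have e0 : c 0 = z := by simp [c, hΓ0]
  have e1 : c 1 = Γ 1 := by simp [c]
  simp only [comp_apply, e0, e1] at hlen
  refine hlen.trans (le_of_eq ?_)
  refine setLIntegral_congr_fun measurableSet_Icc fun t ht => ?_
  simp only [(key t ht).2]
  rfl

theorem le_flatDist (h : IsDevelopingMap π α f v₁ v₂)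
    (hπ : IsTorusParametrization π) (hα : α.IsLocallyExact) {z : ℂ} {y : T} {C : ENNReal}
    (hC : ∀ z', π z' = y → C ≤ ‖f z' - f z‖ₑ) : C ≤ α.flatDist (π z) y := by
  refine le_iInf₂ fun γ hγ => ?_
  obtain ⟨z', -, hz', -, hle⟩ := h.exists_lift_enorm_sub_le_length hπ hα hγ rfl
  exact (hC z' hz').trans hle

/-- The endpoints of a lift of an essential loop differ by a nonzero lattice vector; otherwise the
lift would be a loop in the plane and contract. -/
theorem le_length_of_not_homotopic (h : IsDevelopingMap π α f v₁ v₂)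
    (hπ : IsTorusParametrization π) (hα : α.IsLocallyExact) {C : ENNReal}
    (hC : ∀ m n : ℤ, (m ≠ 0 ∨ n ≠ 0) → C ≤ ‖m * v₁ + n * v₂‖ₑ) {x : T} {γ : Path x x}
    (hγ : IsC1Path γ) (hess : ¬ γ.Homotopic (Path.refl x)) : C ≤ α.length γ := by
  obtain ⟨z, hz⟩ := hπ.surjective x
  obtain ⟨z', Γ, hz', hΓ, hle⟩ := h.exists_lift_enorm_sub_le_length hπ hα hγ hz
  obtain ⟨m, n, hmn⟩ := (hπ.fibres z' z).1 (hz'.trans hz.symm)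
  obtain rfl : z' = z + (m + n * Complex.I) := by rw [← hmn]; ring
  rw [h.apply_add, add_sub_cancel_left] at hle
  refine (hC m n ?_).trans hle
  by_contra! h0
  obtain ⟨rfl, rfl⟩ := h0
  refine hess (homotopic_refl_of_lift hπ.smooth.continuous
    (Γ.cast rfl (by simp) : Path z z) fun t => ?_)
  simpa using hΓ t

end IsDevelopingMap

/-- Postcomposition of a `1`-form with a linear map. -/
noncomputable def OneForm.postcomp {M : Type*} [TopologicalSpace M] [ChartedSpace ℂ M]
    (L : ℂ →L[ℝ] ℂ) (α : OneForm M) : OneForm M := fun x => L.comp (α x)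

/-- The linear map `diag (e^{t/2}, e^{-t/2})`. -/
noncomputable def teichmullerMap (t : ℝ) : ℂ →L[ℝ] ℂ :=
  Real.exp (t / 2) • Complex.ofRealCLM.comp Complex.reCLM +
    Real.exp (-t / 2) • Complex.I • Complex.ofRealCLM.comp Complex.imCLM

theorem teichmuller_eq_postcomp (t : ℝ) (α : OneForm T) :
    α.teichmuller t = α.postcomp (teichmullerMap t) := rfl

theorem teichmullerMap_apply (t : ℝ) (w : ℂ) : teichmullerMap t w =
    (Real.exp (t / 2) * w.re : ℝ) + (Real.exp (-t / 2) * w.im : ℝ) * Complex.I := by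
  simp [teichmullerMap]; ring

theorem sq_norm_teichmullerMap (t : ℝ) (w : ℂ) : ‖teichmullerMap t w‖ ^ 2 =
    (Real.exp (t / 2) * w.re) ^ 2 + (Real.exp (-t / 2) * w.im) ^ 2 := by
  rw [teichmullerMap_apply, Complex.sq_norm, Complex.normSq_add_mul_I]

theorem OneForm.IsLocallyExact.postcomp {α : OneForm T} (h : α.IsLocallyExact) (L : ℂ →L[ℝ] ℂ) :
    (α.postcomp L).IsLocallyExact := fun x => by
  obtain ⟨W, hW, hx, F, hF⟩ := h x
  refine ⟨W, hW, hx, L ∘ F, L.contDiff.contMDiff.comp_contMDiffOn hF.1, fun y hy => ?_⟩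
  rw [mderiv_comp L.differentiableAt.mdifferentiableAt (hF.mdifferentiableAt hW hy),
    mderiv_eq_fderiv, L.fderiv, hF.2 y hy]
  rfl

theorem IsDevelopingMap.postcomp {π : ℂ → T} {α : OneForm T} {f : ℂ → ℂ} {v₁ v₂ : ℂ}
    (h : IsDevelopingMap π α f v₁ v₂) (L : ℂ →L[ℝ] ℂ) :
    IsDevelopingMap π (α.postcomp L) (L ∘ f) (L v₁) (L v₂) where
  contDiff := L.contDiff.comp h.contDiff
  fderiv_eq z := by
    rw [(L.hasFDerivAt.comp z (h.hasFDerivAt z)).fderiv]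
    rfl
  add_one z := by simp [h.add_one]
  add_I z := by simp [h.add_I]

theorem IsDevelopingMap.isEventuallyThick [ClosedSurface T] {π : ℂ → T} {α : OneForm T}
    {f : ℂ → ℂ} {v₁ v₂ : ℂ} (h : IsDevelopingMap π α f v₁ v₂) (hπ : IsTorusParametrization π)
    (hα : α.IsLocallyExact) {ε N : ℝ}
    (hC : ∀ t > N, ∀ m n : ℤ, (m ≠ 0 ∨ n ≠ 0) → ε ≤ ‖teichmullerMap t (m * v₁ + n * v₂)‖) :
    IsEventuallyThick ε α := by
  refine ⟨N, fun t ht x γ hγ _ hess => ?_⟩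
  rw [teichmuller_eq_postcomp]
  refine (h.postcomp (teichmullerMap t)).le_length_of_not_homotopic hπ (hα.postcomp _)
    (fun m n hmn => ?_) hγ hess
  have e : (m : ℂ) * teichmullerMap t v₁ + n * teichmullerMap t v₂ =
      teichmullerMap t (m * v₁ + n * v₂) := by
    rw [map_add, ← zsmul_eq_mul, ← zsmul_eq_mul, ← zsmul_eq_mul, ← zsmul_eq_mul, map_zsmul,
      map_zsmul]
  rw [e, ← ofReal_norm]
  exact ENNReal.ofReal_le_ofReal (hC t ht m n hmn)

/-- The vertical flow of a form with bijective developing map. -/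
theorem IsDevelopingMap.exists_isVerticalFlow {π : ℂ → T} {α : OneForm T}
    {f : ℂ → ℂ} {v₁ v₂ : ℂ} (h : IsDevelopingMap π α f v₁ v₂) (hπ : IsTorusParametrization π)
    (hbij : Bijective f) (hdet : ∀ z, 0 < (fderiv ℝ f z).det) :
    ∃ F : ℝ → T → T, IsVerticalFlow α F ∧
      ∀ z t, ∃ z', π z' = F t (π z) ∧ f z' = f z + t * Complex.I := by
  have hfe : ∀ z, HasFDerivAt f ((fderiv ℝ f z).toContinuousLinearEquivOfDetNeZero (hdet z).ne' :
      ℂ →L[ℝ] ℂ) z := fun z => by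
    rw [ContinuousLinearMap.coe_toContinuousLinearEquivOfDetNeZero]
    exact (h.contDiff.differentiable (by simp) z).hasFDerivAt
  have hopen : IsOpenMap f := IsOpenMap.of_nhds_le fun z =>
    ((h.contDiff.contDiffAt.hasStrictFDerivAt' (hfe z) (by simp)).map_nhds_eq_of_equiv).ge
  set e : ℂ ≃ₜ ℂ := (Equiv.ofBijective f hbij).toHomeomorphOfContinuousOpen
    h.contDiff.continuous hopen
  have hef : ∀ z, e z = f z := fun z => rfl
  have hfes : ∀ w, f (e.symm w) = w := fun w => e.apply_symm_apply w
  have hsymm : ContDiff ℝ ∞ e.symm := contDiff_iff_contDiffAt.2 fun w =>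
    e.toOpenPartialHomeomorph.contDiffAt_symm (mem_univ w) (hfe _) h.contDiff.contDiffAt
  -- The section need not be continuous: each orbit uses one lift, and another lift changes
  -- developed coordinates only by a period.
  obtain ⟨σ, hσ⟩ := hπ.surjective.hasRightInverse
  refine ⟨fun t x => π (e.symm (f (σ x) + t * Complex.I)), fun x => ?_, fun z t => ?_⟩
  · set c : ℝ → ℂ := fun t => e.symm (f (σ x) + t * Complex.I) with hc
    have hcs : ContDiff ℝ ∞ c := hsymm.comp (by
      have : ContDiff ℝ ∞ fun t : ℝ => (t : ℂ) := Complex.ofRealCLM.contDiff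
      fun_prop)
    refine ⟨?_, ?_, fun t => ?_⟩
    · have : e.symm (f (σ x)) = σ x := e.symm_apply_apply (σ x)
      simp [this, hσ x]
    · exact (hπ.smooth.comp hcs.contMDiff).of_le (by simp)
    · have hcd : HasFDerivAt c (fderiv ℝ c t) t :=
        (hcs.differentiable (by simp) t).hasFDerivAt
      have h1 : HasMFDerivAt 𝓘(ℝ, ℝ) 𝓘(ℝ, ℂ) c t (fderiv ℝ c t) := hcd.hasMFDerivAt
      have h2 : HasMFDerivAt 𝓘(ℝ, ℂ) 𝓘(ℝ, ℂ) π (c t) _ := (hπ.mdifferentiableAt _).hasMFDerivAt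
      have h3 : mfderiv 𝓘(ℝ, ℝ) 𝓘(ℝ, ℂ) (fun t => π (c t)) t = _ := (h2.comp t h1).mfderiv
      rw [h3]
      have h4 : HasDerivAt (f ∘ c) ((OneForm.pullback π α).coeff (c t) (fderiv ℝ c t 1)) t :=
        ((h.hasFDerivAt (c t)).comp t hcd).hasDerivAt
      have h5 : HasDerivAt (f ∘ c) Complex.I t := by
        have : f ∘ c = fun t : ℝ => f (σ x) + t * Complex.I := funext fun t => hfes _
        rw [this]
        simpa using ((Complex.ofRealCLM.hasDerivAt (x := t)).mul_const Complex.I).const_add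
          (f (σ x))
      exact h4.unique h5
  · obtain ⟨m, n, hmn⟩ := (hπ.fibres (σ (π z)) z).1 (hσ (π z))
    have hσz : σ (π z) = z + (m + n * Complex.I) := by rw [← hmn]; ring
    refine ⟨e.symm (f (σ (π z)) + t * Complex.I) + ((-m : ℤ) + (-n : ℤ) * Complex.I),
      hπ.apply_add _ _ _, ?_⟩
    rw [h.apply_add, hfes, hσz, h.apply_add]
    push_cast; ring

end Lifting

/-! ### Shearing a form away from a point -/

section Perturbation

variable {M : Type*} [TopologicalSpace M] [ChartedSpace ℂ M]

theorem coeff_add_smul (α β : OneForm M) (s : ℝ) (x : M) :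
    (α + s • β).coeff x = α.coeff x + s • β.coeff x := rfl

theorem inChart_add_smul (φ : OpenPartialHomeomorph M ℂ) (α β : OneForm M) (s : ℝ) :
    OneForm.inChart φ (α + s • β) = OneForm.inChart φ α + s • OneForm.inChart φ β := rfl

/-- Lines in the space of smooth `1`-forms are continuous for the `C^∞` topology. -/
theorem tendsto_add_smul_cInftyTopology {α β : OneForm M} (hα : α.IsSmooth) (hβ : β.IsSmooth) :
    Filter.Tendsto (fun s : ℝ => α + s • β) (𝓝 0) (@nhds _ OneForm.cInftyTopology α) := by
  simp only [nhds_iInf, nhds_induced, Filter.tendsto_iInf,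
    Filter.tendsto_comap_iff]
  intro φ hφ r
  rw [UniformOnFun.tendsto_iff_tendstoUniformlyOn]
  rintro K ⟨hK, hKφ⟩
  have hu : UniqueDiffOn ℝ φ.target := φ.open_target.uniqueDiffOn
  have hrle : ((r : ℕ∞) : ℕ∞ω) ≤ ∞ := WithTop.coe_le_coe.2 le_top
  have hcont : ContinuousOn (iteratedFDerivWithin ℝ r (OneForm.inChart φ β) φ.target) φ.target :=
    (hβ φ hφ).continuousOn_iteratedFDerivWithin hrle hu
  obtain ⟨C, hC⟩ := hK.exists_bound_of_continuousOn (hcont.mono hKφ)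
  rw [Metric.tendstoUniformlyOn_iff]
  intro ε hε
  have hlim : Filter.Tendsto (fun s : ℝ => |s| * (|C| + 1)) (𝓝 0) (𝓝 0) := by
    have : Continuous fun s : ℝ => |s| * (|C| + 1) := by fun_prop
    simpa using this.tendsto 0
  filter_upwards [hlim.eventually_lt_const hε] with s hs z hz
  have h1 : ContDiffWithinAt ℝ r (OneForm.inChart φ α) φ.target z :=
    (hα φ hφ z (hKφ hz)).of_le hrle
  have h2 : ContDiffWithinAt ℝ r (OneForm.inChart φ β) φ.target z :=
    (hβ φ hφ z (hKφ hz)).of_le hrle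
  -- Derivatives along the line are affine in `s`, so a bound for those of `β` on `K` gives uniform
  -- convergence.
  have key : iteratedFDerivWithin ℝ r (OneForm.inChart φ (α + s • β)) φ.target z =
      iteratedFDerivWithin ℝ r (OneForm.inChart φ α) φ.target z +
        s • iteratedFDerivWithin ℝ r (OneForm.inChart φ β) φ.target z := by
    rw [inChart_add_smul, iteratedFDerivWithin_add_apply h1 (g := s • OneForm.inChart φ β)
        (h2.const_smul s) hu (hKφ hz),
      iteratedFDerivWithin_const_smul_apply h2 hu (hKφ hz)]
  change dist (iteratedFDerivWithin ℝ r (OneForm.inChart φ α) φ.target z)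
    (iteratedFDerivWithin ℝ r (OneForm.inChart φ (α + s • β)) φ.target z) < ε
  rw [key, dist_self_add_right, norm_smul, Real.norm_eq_abs]
  refine lt_of_le_of_lt ?_ hs
  gcongr
  exact (hC z hz).trans ((le_abs_self C).trans (by linarith))

theorem OneForm.HasPrimitiveOn.add_smul {α β : OneForm M} {F H : M → ℂ} {W : Set M}
    (hα : α.HasPrimitiveOn F W) (hβ : β.HasPrimitiveOn H W) (hW : IsOpen W) (s : ℝ) :
    (α + s • β).HasPrimitiveOn (F + s • H) W := by
  refine ⟨hα.1.add
    ((contMDiffOn_const : ContMDiffOn 𝓘(ℝ, ℂ) 𝓘(ℝ, ℝ) ∞ (fun _ : M => s) W).smul hβ.1), fun y hy => ?_⟩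
  have h1 : HasMFDerivAt 𝓘(ℝ, ℂ) 𝓘(ℝ, ℂ) F y _ := (hα.mdifferentiableAt hW hy).hasMFDerivAt
  have h2 : HasMFDerivAt 𝓘(ℝ, ℂ) 𝓘(ℝ, ℂ) H y _ := (hβ.mdifferentiableAt hW hy).hasMFDerivAt
  rw [coeff_add_smul, ← hα.2 y hy, ← hβ.2 y hy]
  exact (h1.add (h2.const_smul s)).mfderiv

theorem OneForm.IsLocallyExact.add_smul {α β : OneForm M} (hα : α.IsLocallyExact)
    (hβ : β.IsLocallyExact) (s : ℝ) : (α + s • β).IsLocallyExact := fun x => by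
  obtain ⟨W, hW, hx, F, hF⟩ := hα x
  obtain ⟨W', hW', hx', F', hF'⟩ := hβ x
  exact ⟨W ∩ W', hW.inter hW', ⟨hx, hx'⟩, _, (hF.mono inter_subset_left).add_smul
    (hF'.mono inter_subset_right) (hW.inter hW') s⟩

/-- A real-linear copy of the imaginary part, with values in `ℂ`. -/
noncomputable def imPart : ℂ →L[ℝ] ℂ := Complex.ofRealCLM.comp Complex.imCLM

theorem imPart_apply (z : ℂ) : imPart z = z.im := rfl

/-- Some closed form in the class of the imaginary part of `α` vanishes near a given point. -/
theorem exists_closed_im_eq_zero_near [ClosedSurface M] {α : OneForm M} (hα : α.IsLocallyExact)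
    (b : M) : ∃ u : M → ℂ, ContMDiff 𝓘(ℝ, ℂ) 𝓘(ℝ, ℂ) ∞ u ∧ ∃ V : Set M, IsOpen V ∧ b ∈ V ∧
      ∀ y ∈ V, mderiv u y = imPart.comp (α.coeff y) := by
  obtain ⟨W, hW, hb, F, hF⟩ := hα b
  obtain ⟨χ, -, hχ⟩ := (SmoothBumpFunction.nhds_basis_tsupport (I := 𝓘(ℝ, ℂ)) b).mem_iff.1
    (hW.mem_nhds hb)
  obtain ⟨V, hV, hVo, hbV⟩ := mem_nhds_iff.1 (Filter.inter_mem χ.eventuallyEq_one (hW.mem_nhds hb))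
  have hH : ContMDiffOn 𝓘(ℝ, ℂ) 𝓘(ℝ, ℂ) ∞ (imPart ∘ F) W :=
    imPart.contDiff.contMDiff.comp_contMDiffOn hF.1
  -- A cut-off local primitive of the imaginary part: smooth on all of `M`, since the support of `χ`
  -- lies in the domain of `F`.
  refine ⟨fun y => χ y • imPart (F y), ?_, V, hVo, hbV, fun y hy => ?_⟩
  · refine contMDiff_of_tsupport fun x hx => ?_
    have hxW : x ∈ W := hχ (tsupport_smul_subset_left _ _ hx)
    exact χ.contMDiffAt.smul ((hH x hxW).contMDiffAt (hW.mem_nhds hxW))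
  · have he : (fun y => χ y • imPart (F y)) =ᶠ[𝓝 y] imPart ∘ F := by
      filter_upwards [hVo.mem_nhds hy] with w hw
      have : χ w = 1 := (hV hw).1
      simp [this]
    rw [mderiv_congr he, mderiv_comp imPart.differentiableAt.mdifferentiableAt
      (hF.mdifferentiableAt hW (hV hy).2), mderiv_eq_fderiv, imPart.fderiv, hF.2 y (hV hy).2]

/-- The form `Im α - du`. -/
noncomputable def shearForm (α : OneForm M) (u : M → ℂ) : OneForm M :=
  fun x => (imPart.comp (α.coeff x) - mderiv u x : ℂ →L[ℝ] ℂ)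

theorem coeff_shearForm (α : OneForm M) (u : M → ℂ) (x : M) :
    (shearForm α u).coeff x = imPart.comp (α.coeff x) - mderiv u x := rfl

theorem isLocallyExact_shearForm {α : OneForm M} (hα : α.IsLocallyExact) {u : M → ℂ}
    (hu : ContMDiff 𝓘(ℝ, ℂ) 𝓘(ℝ, ℂ) ∞ u) : (shearForm α u).IsLocallyExact := fun x => by
  obtain ⟨W, hW, hx, F, hF⟩ := hα x
  refine ⟨W, hW, hx, imPart ∘ F - u,
    (imPart.contDiff.contMDiff.comp_contMDiffOn hF.1).sub hu.contMDiffOn, fun y hy => ?_⟩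
  have hFy := hF.mdifferentiableAt hW hy
  have hi : MDifferentiableAt 𝓘(ℝ, ℂ) 𝓘(ℝ, ℂ) imPart (F y) :=
    imPart.differentiableAt.mdifferentiableAt
  have h1 : HasMFDerivAt 𝓘(ℝ, ℂ) 𝓘(ℝ, ℂ) (imPart ∘ F) y _ := (hi.comp y hFy).hasMFDerivAt
  have h2 : HasMFDerivAt 𝓘(ℝ, ℂ) 𝓘(ℝ, ℂ) u y _ := (hu.mdifferentiable (by simp) y).hasMFDerivAt
  have h3 : mderiv (imPart ∘ F - u) y = mderiv (imPart ∘ F) y - mderiv u y := (h1.sub h2).mfderiv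
  rw [h3, mderiv_comp hi hFy, mderiv_eq_fderiv, imPart.fderiv, hF.2 y hy, coeff_shearForm]

end Perturbation

section TorusPerturbation

variable {T : Type*} [TopologicalSpace T] [ChartedSpace ℂ T]

/-- The exact correction `du` contributes a periodic function, so the periods change exactly as
under the linear shear. -/
theorem IsDevelopingMap.shear {π : ℂ → T} {α : OneForm T} {f : ℂ → ℂ} {v₁ v₂ : ℂ}
    (h : IsDevelopingMap π α f v₁ v₂) (hπ : IsTorusParametrization π) {u : T → ℂ}
    (hu : ContMDiff 𝓘(ℝ, ℂ) 𝓘(ℝ, ℂ) ∞ u) (s : ℝ) :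
    IsDevelopingMap π (α + s • shearForm α u) (fun z => f z + s • (imPart (f z) - u (π z)))
      (v₁ + s • imPart v₁) (v₂ + s • imPart v₂) := by
  have huπ : ContDiff ℝ ∞ (u ∘ π) := contMDiff_iff_contDiff.1 (hu.comp hπ.smooth)
  have hπ1 : ∀ z, π (z + 1) = π z := fun z => by simpa using hπ.apply_add z 1 0
  have hπI : ∀ z, π (z + Complex.I) = π z := fun z => by simpa using hπ.apply_add z 0 1
  refine ⟨?_, fun z => ?_, fun z => ?_, fun z => ?_⟩
  · exact h.contDiff.add (((imPart.contDiff.comp h.contDiff).sub huπ).const_smul s)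
  · have h1 := h.hasFDerivAt z
    have h2 : HasFDerivAt (u ∘ π) (mderiv (u ∘ π) z) z := by
      rw [mderiv_eq_fderiv]; exact (huπ.differentiable (by simp) z).hasFDerivAt
    have h3 := h1.add (((imPart.hasFDerivAt.comp z h1).sub h2).const_smul s)
    refine h3.fderiv.trans ?_
    rw [mderiv_comp (hu.mdifferentiable (by simp) _) (hπ.mdifferentiableAt z), coeff_pullback,
      coeff_pullback, coeff_add_smul, coeff_shearForm]
    ext v
    simp
  · simp only [h.add_one, hπ1, map_add, smul_sub, smul_add]; ring
  · simp only [h.add_I, hπI, map_add, smul_sub, smul_add]; ring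

variable [ClosedSurface T]

theorem det_coeff_pos_of_det_pullback_pos {π : ℂ → T} (hπ : IsTorusParametrization π)
    {α : OneForm T} {z : ℂ} (h : 0 < ((OneForm.pullback π α).coeff z).det) :
    0 < (α.coeff (π z)).det := by
  rw [coeff_pullback, det_comp] at h
  exact (pos_iff_pos_of_mul_pos h).2 (hπ.det_mderiv_pos z)

/-- Positivity is an open condition; compactness of the closed unit square makes it uniform over the
torus. -/
theorem eventually_det_coeff_add_smul_pos {π : ℂ → T} (hπ : IsTorusParametrization π)
    {α β : OneForm T} (hα : α.IsLocallyExact) (hβ : β.IsLocallyExact)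
    (hdet : ∀ x, 0 < (α.coeff x).det) :
    ∀ᶠ s : ℝ in 𝓝 0, ∀ x, 0 < ((α + s • β).coeff x).det := by
  obtain ⟨f, v₁, v₂, hf⟩ := hπ.exists_isDevelopingMap hα
  obtain ⟨k, w₁, w₂, hk⟩ := hπ.exists_isDevelopingMap hβ
  have hcf : Continuous (fderiv ℝ f) := hf.contDiff.continuous_fderiv (by simp)
  have hck : Continuous (fderiv ℝ k) := hk.contDiff.continuous_fderiv (by simp)
  have hcont : Continuous fun p : ℝ × ℂ => (fderiv ℝ f p.2 + p.1 • fderiv ℝ k p.2).det :=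
    ContinuousLinearMap.continuous_det.comp (by fun_prop)
  have hK : IsCompact (Icc (0 : ℝ) 1 ×ℂ Icc (0 : ℝ) 1) := isCompact_Icc.reProdIm isCompact_Icc
  have hev := hK.eventually_forall_of_forall_eventually (x₀ := (0 : ℝ))
    (P := fun s z => 0 < (fderiv ℝ f z + s • fderiv ℝ k z).det) fun z _ => by
      refine hcont.continuousAt.eventually_const_lt ?_
      simp only [zero_smul, add_zero]
      rw [hf.fderiv_eq, coeff_pullback, det_comp]
      exact mul_pos (hdet _) (hπ.det_mderiv_pos z)
  filter_upwards [hev] with s hs x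
  obtain ⟨z, rfl⟩ := hπ.surjective x
  obtain ⟨m, n, hmn⟩ := exists_sub_mem_unitSquare z
  have e : z - (m + n * Complex.I) = z + ((-m : ℤ) + (-n : ℤ) * Complex.I) := by push_cast; ring
  rw [← hπ.apply_add z (-m) (-n), ← e]
  refine det_coeff_pos_of_det_pullback_pos hπ ?_
  have := hs _ (unitSquare_subset_reProdIm hmn)
  rw [hf.fderiv_eq, hk.fderiv_eq] at this
  exact this

end TorusPerturbation

section Surface

variable {M : Type*} [TopologicalSpace M] [ChartedSpace ℂ M]

theorem det_zero : (0 : ℂ →L[ℝ] ℂ).det = 0 := by simp [det_eq_re_mul_im_sub]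

theorem OneForm.IsLocallyExact.exists_complexStructure_of_det_pos [ClosedSurface M] {α : OneForm M}
    (hα : α.IsLocallyExact) (hdet : ∀ x, 0 < (α.coeff x).det) :
    ∃ J : ComplexStructure M, α.IsHolomorphic J := by
  refine exists_complexStructure (fun x => subset_closure ?_) fun x => ?_
  · intro h
    have := hdet x
    rw [h, det_zero] at this
    exact this.false
  · obtain ⟨W, hW, hx, F, hF⟩ := hα x
    obtain ⟨φ, hxφ, -, hφ⟩ := hF.exists_flat_chart hW hx (hdet x)
    exact ⟨φ, 1, hxφ, hφ⟩

theorem ne_zero_of_det_pos {α : OneForm M} {x : M} (hdet : 0 < (α.coeff x).det) : α ≠ 0 := by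
  rintro rfl
  have : ((0 : OneForm M).coeff x) = 0 := rfl
  rw [this, det_zero] at hdet
  exact hdet.false

end Surface

/-! ### Branched covers and pullbacks -/

section Cover

variable {S : Type*} [TopologicalSpace S] [ChartedSpace ℂ S]
  {T : Type*} [TopologicalSpace T] [ChartedSpace ℂ T]

/-- Openness at `x`, inherited in charts from the open map `z ↦ z ^ m`. -/
theorem HasLocalDegree.nhds_le_map {p : S → T} {x : S} {m : ℕ} (h : HasLocalDegree p x m)
    (hm : m ≠ 0) : 𝓝 (p x) ≤ Filter.map p (𝓝 x) := by
  obtain ⟨φ, ψ, -, -, hx, hφ0, hpx, hψ0, hmaps, heq⟩ := h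
  have he : p =ᶠ[𝓝 x] ψ.symm ∘ (fun z : ℂ => z ^ m) ∘ φ := by
    filter_upwards [φ.open_source.mem_nhds hx] with y hy
    simp only [comp_apply]
    rw [← heq y hy, ψ.left_inv (hmaps hy)]
  have hpow : 𝓝 (0 : ℂ) ≤ Filter.map (fun z : ℂ => z ^ m) (𝓝 0) := by
    have han : AnalyticAt ℂ (fun z : ℂ => z ^ m) 0 := by fun_prop
    rcases han.eventually_constant_or_nhds_le_map_nhds with h | h
    · exfalso
      have hz : ∀ᶠ z : ℂ in 𝓝 0, z = 0 := by
        filter_upwards [h] with z hz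
        simpa [hm] using hz
      obtain ⟨V, hV, hVo, h0⟩ := mem_nhds_iff.1 hz
      have : V = {0} := (subset_singleton_iff_eq.1 hV).resolve_left (Nonempty.ne_empty ⟨0, h0⟩)
      exact not_isOpen_singleton (0 : ℂ) (this ▸ hVo)
    · simpa [hm] using h
  have h0 : (0 : ℂ) ∈ ψ.target := hψ0 ▸ ψ.map_source hpx
  rw [Filter.map_congr he, ← Filter.map_map, ← Filter.map_map, φ.map_nhds_eq hx, hφ0]
  refine le_trans ?_ (Filter.map_mono hpow)
  rw [ψ.symm.map_nhds_eq (by simpa using h0), ← hψ0, ψ.left_inv hpx]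

theorem IsBranchedOverOnePoint.nhds_le_map {p : S → T} (hp : IsBranchedOverOnePoint p) (x : S) :
    𝓝 (p x) ≤ Filter.map p (𝓝 x) := by
  obtain ⟨m, hm, h⟩ := hp.local_form x
  exact h.nhds_le_map (by omega)

theorem HasLocalDegree.det_mderiv_pos [ClosedSurface S] [ClosedSurface T] {p : S → T} {x : S}
    (h : HasLocalDegree p x 1) (hp : MDifferentiableAt 𝓘(ℝ, ℂ) 𝓘(ℝ, ℂ) p x) :
    0 < (mderiv p x).det := by
  obtain ⟨φ, ψ, hφ, hψ, hx, -, hpx, -, -, heq⟩ := h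
  have he : ψ ∘ p =ᶠ[𝓝 x] φ := by
    filter_upwards [φ.open_source.mem_nhds hx] with y hy
    simpa using heq y hy
  have h1 := hφ.det_pos hx
  rw [← mderiv_congr he, mderiv_comp (hψ.mdifferentiableAt hpx) hp, det_comp] at h1
  exact (pos_iff_pos_of_mul_pos h1).1 (hψ.det_pos hpx)

theorem not_isOpen_singleton_of_chartedSpace (b : T) : ¬ IsOpen ({b} : Set T) := fun h => by
  have := (chartAt ℂ b).isOpen_image_of_subset_source h
    (singleton_subset_iff.2 (mem_chart_source ℂ b))
  rw [image_singleton] at this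
  exact not_isOpen_singleton _ this

/-- If the fibre had interior, openness of `p` would make the point `b` open in a surface. -/
theorem IsBranchedOverOnePoint.dense_ne {p : S → T} (hp : IsBranchedOverOnePoint p) (b : T) :
    Dense {x | p x ≠ b} := by
  rw [show {x | p x ≠ b} = {x | p x = b}ᶜ from rfl, ← interior_eq_empty_iff_dense_compl,
    eq_empty_iff_forall_notMem]
  intro x hx
  have hx' : p ⁻¹' {b} ∈ 𝓝 x := mem_interior_iff_mem_nhds.1 hx
  have hxb : p x = b := (mem_of_mem_nhds hx' : x ∈ p ⁻¹' {b})
  have hb := hp.nhds_le_map x (Filter.mem_map.2 hx')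
  rw [hxb] at hb
  obtain ⟨V, hV, hVo, h0⟩ := mem_nhds_iff.1 hb
  have : V = {b} := (subset_singleton_iff_eq.1 hV).resolve_left (Nonempty.ne_empty ⟨b, h0⟩)
  exact not_isOpen_singleton_of_chartedSpace b (this ▸ hVo)

variable [ClosedSurface S] [ClosedSurface T]

/-- A closed form on the base which is positively oriented and agrees near the branch point with a
form whose pullback is holomorphic pulls back to an Abelian differential. -/
theorem IsBranchedOverOnePoint.exists_abelianDifferential {p : S → T}
    (hp : IsBranchedOverOnePoint p) {b : T} (hb : ∀ x, ∀ m ≥ 2, HasLocalDegree p x m → p x = b)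
    {α β : OneForm T} {J : ComplexStructure S} (hJ : (OneForm.pullback p α).IsHolomorphic J)
    (hβ : β.IsLocallyExact) (hdet : ∀ y, 0 < (β.coeff y).det) {V : Set T} (hV : IsOpen V)
    (hbV : b ∈ V) (hαβ : ∀ y ∈ V, β.coeff y = α.coeff y) :
    ∃ α' : AbelianDifferential S, α'.form = OneForm.pullback p β := by
  have hexact := hβ.pullback hp.smooth
  have hpos : ∀ x, p x ≠ b → 0 < ((OneForm.pullback p β).coeff x).det := fun x hx => by
    obtain ⟨m, hm, hd⟩ := hp.local_form x
    obtain rfl : m = 1 := by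
      by_contra hne
      exact hx (hb x m (by omega) hd)
    rw [coeff_pullback, det_comp]
    exact mul_pos (hdet _) (hd.det_mderiv_pos (hp.smooth.mdifferentiable (by simp) x))
  have hdense : Dense {x | (OneForm.pullback p β).coeff x ≠ 0} :=
    (hp.dense_ne b).mono fun x hx h0 => by
      have := hpos x hx
      rw [h0, det_zero] at this
      exact this.false
  obtain ⟨x₀, hx₀⟩ := hdense.nonempty
  refine ⟨⟨OneForm.pullback p β, hexact.isSmooth, ?_, ?_⟩, rfl⟩
  · refine OneForm.exists_complexStructure hdense fun x => ?_
    -- Over the branch point the old holomorphic chart still works because the form is unchanged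
    -- there. Elsewhere `p` is an oriented local diffeomorphism and a primitive of the new form is a
    -- chart.
    by_cases hx : p x = b
    · obtain ⟨φ, g, hxφ, hφ⟩ := hJ.exists_isHolomorphicIn x
      have hVo : IsOpen (p ⁻¹' V) := hV.preimage hp.smooth.continuous
      have hxV : x ∈ p ⁻¹' V := by rwa [mem_preimage, hx]
      refine ⟨φ.restr (p ⁻¹' V), g, ?_, hφ.restr hVo fun y hy => ?_⟩
      · rw [φ.restr_source, hVo.interior_eq]
        exact ⟨hxφ, hxV⟩
      · rw [coeff_pullback, coeff_pullback, hαβ _ hy]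
    · obtain ⟨W, hW, hxW, F, hF⟩ := hexact x
      obtain ⟨φ, hxφ, -, hφ⟩ := hF.exists_flat_chart hW hxW (hpos x hx)
      exact ⟨φ, 1, hxφ, hφ⟩
  · intro h0
    exact hx₀ (by rw [h0]; rfl)

end Cover

/-! ### Flat distance compared with chart distance -/

section Distance

variable {M : Type*} [TopologicalSpace M] [ChartedSpace ℂ M] [IsManifold 𝓘(ℝ, ℂ) ∞ M]

/-- The flat distance to a given point is at most a multiple of the distance in a chart. -/
theorem OneForm.IsSmooth.eventually_flatDist_lt {α : OneForm M} (hα : α.IsSmooth) (x : M) {δ : ℝ}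
    (hδ : 0 < δ) : ∀ᶠ y in 𝓝 x, α.flatDist x y < ENNReal.ofReal δ := by
  set c := chartAt ℂ x with hc
  have hca : c ∈ atlas ℂ M := chart_mem_atlas ℂ x
  have hcm : c ∈ IsManifold.maximalAtlas 𝓘(ℝ, ℂ) ∞ M := IsManifold.subset_maximalAtlas hca
  have hxc : x ∈ c.source := mem_chart_source ℂ x
  obtain ⟨r, hr, hball⟩ := Metric.nhds_basis_closedBall.mem_iff.1
    (c.open_target.mem_nhds (c.map_source hxc))
  obtain ⟨C, hC⟩ := (isCompact_closedBall (c x) r).exists_bound_of_continuousOn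
    ((hα c hca).continuousOn.mono hball)
  have hlim : Filter.Tendsto (fun y => (|C| + 1) * ‖c y - c x‖) (𝓝 x) (𝓝 0) := by
    have : ContinuousAt (fun y => (|C| + 1) * ‖c y - c x‖) x :=
      continuousAt_const.mul ((c.continuousAt hxc).sub continuousAt_const).norm
    simpa [ContinuousAt] using this
  filter_upwards [hlim.eventually_lt_const hδ, c.open_source.mem_nhds hxc,
    (c.continuousAt hxc).preimage_mem_nhds (Metric.closedBall_mem_nhds _ hr)] with y hy hyc hyr
  -- The straight segment in the chart; its flat length is controlled by a bound of the form on a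
  -- compact disc.
  set l : ℝ → ℂ := fun t => c x + t • (c y - c x) with hl
  have hlball : ∀ t ∈ Icc (0 : ℝ) 1, l t ∈ Metric.closedBall (c x) r := fun t ht => by
    have h1 : ‖c y - c x‖ ≤ r := by simpa [dist_eq_norm] using hyr
    rw [mem_closedBall_iff_norm, hl, add_sub_cancel_left, norm_smul, Real.norm_eq_abs,
      abs_of_nonneg ht.1]
    nlinarith [ht.2, norm_nonneg (c y - c x)]
  have hlc : ContDiff ℝ ∞ l := by fun_prop
  have hlt : ∀ t ∈ Icc (0 : ℝ) 1, l t ∈ c.target := fun t ht => hball (hlball t ht)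
  have hg : ContMDiffOn 𝓘(ℝ, ℝ) 𝓘(ℝ, ℂ) ∞ (c.symm ∘ l) (Icc 0 1) :=
    (contMDiffOn_symm_of_mem_maximalAtlas hcm).comp hlc.contMDiff.contMDiffOn hlt
  let γ : Path x y :=
    { toFun := fun t => c.symm (l t)
      continuous_toFun := hg.continuousOn.comp_continuous continuous_subtype_val fun t => t.2
      source' := by simp [hl, c.left_inv hxc]
      target' := by simp [hl, c.left_inv hyc] }
  have hγ : EqOn γ.extend (c.symm ∘ l) (Icc 0 1) := fun t ht => by
    rw [γ.extend_apply ht]; rfl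
  have hγ1 : IsC1Path γ := (hg.of_le (by simp)).congr hγ
  have hd : ∀ t ∈ Icc (0 : ℝ) 1,
      α (γ.extend t) (mfderivWithin 𝓘(ℝ, ℝ) 𝓘(ℝ, ℂ) γ.extend (Icc 0 1) t (1 : ℝ)) =
        inChart c α (l t) (c y - c x) := fun t ht => by
    have hs : HasMFDerivAt 𝓘(ℝ, ℂ) 𝓘(ℝ, ℂ) c.symm (l t) _ :=
      ((mdifferentiable_of_mem_maximalAtlas hcm).mdifferentiableAt_symm (hlt t ht)).hasMFDerivAt
    have hl' : HasFDerivAt l (ContinuousLinearMap.toSpanSingleton ℝ (c y - c x)) t :=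
      (((hasDerivAt_id t).smul_const (c y - c x)).const_add (c x)).congr_deriv (one_smul ℝ _)
        |>.hasFDerivAt
    have h1 := (hs.comp t hl'.hasMFDerivAt).hasMFDerivWithinAt (s := Icc 0 1)
    have h2 := (h1.congr_of_eventuallyEq (hγ.eventuallyEq_of_mem self_mem_nhdsWithin)
      (hγ ht)).mfderivWithin (uniqueMDiffOn_iff_uniqueDiffOn.2 (uniqueDiffOn_Icc one_pos) t ht)
    rw [h2]
    change α (γ.extend t) (mderiv c.symm (l t) ((1 : ℝ) • (c y - c x))) = _
    have e : γ.extend t = c.symm (l t) := hγ ht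
    rw [one_smul, FlatSurface.inChart_eq, ← e]
    rfl
  calc α.flatDist x y ≤ α.length γ := iInf₂_le γ hγ1
    _ ≤ ∫⁻ t in Icc (0 : ℝ) 1, ENNReal.ofReal ((|C| + 1) * ‖c y - c x‖) := by
        refine setLIntegral_mono' measurableSet_Icc fun t ht => ?_
        rw [hd t ht, ← ofReal_norm]
        refine ENNReal.ofReal_le_ofReal (((inChart c α (l t)).le_opNorm _).trans ?_)
        gcongr
        exact (hC _ (hlball t ht)).trans ((le_abs_self C).trans (by linarith))
    _ = ENNReal.ofReal ((|C| + 1) * ‖c y - c x‖) := by simp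
    _ < ENNReal.ofReal δ := (ENNReal.ofReal_lt_ofReal_iff hδ).2 hy

end Distance

/-! ### Dense leaves and badly approximable points -/

section Lattice

/-- Nonzero vectors `X + iY` of the lattice spanned by `v₁` and `v₂` satisfy
`A / 3 ≤ |X| |Y| + K X ^ 2`; in particular the vertical direction is badly approximable. -/
def HasNormFormBound (v₁ v₂ : ℂ) (A K : ℝ) : Prop :=
  ∀ m n : ℤ, (m ≠ 0 ∨ n ≠ 0) →
    A / 3 ≤ |(m * v₁ + n * v₂).re| * |(m * v₁ + n * v₂).im| + K * (m * v₁ + n * v₂).re ^ 2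

theorem HasNormFormBound.re_ne_zero {v₁ v₂ : ℂ} {A K : ℝ} (h : HasNormFormBound v₁ v₂ A K)
    (hA : 0 < A) {m n : ℤ} (hmn : m ≠ 0 ∨ n ≠ 0) : (m * v₁ + n * v₂).re ≠ 0 := fun h0 => by
  have := h m n hmn
  rw [h0] at this
  norm_num at this
  linarith

/-- If the real parts of the two periods had rational ratio, some nonzero period would be vertical,
against the bound. So the real parts of periods are dense in the line. -/
theorem HasNormFormBound.exists_abs_re_sub_lt {v₁ v₂ : ℂ} {A K : ℝ}
    (h : HasNormFormBound v₁ v₂ A K) (hA : 0 < A) (x : ℝ) {r : ℝ} (hr : 0 < r) :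
    ∃ m n : ℤ, |(m * v₁ + n * v₂).re - x| < r := by
  have hirr : Irrational (v₁.re / v₂.re) := by
    rintro ⟨a, ha⟩
    have h2 : v₂.re ≠ 0 := by simpa using h.re_ne_zero hA (m := 0) (n := 1) (by simp)
    refine h.re_ne_zero hA (m := a.den) (n := -a.num) (Or.inl (by exact_mod_cast a.den_ne_zero)) ?_
    rw [Rat.cast_def, div_eq_div_iff (by exact_mod_cast a.den_ne_zero) h2] at ha
    simp
    linarith
  obtain ⟨y, hy, hxy⟩ := (Metric.dense_iff.1 (dense_addSubgroupClosure_pair_iff.2 hirr)) x r hr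
  obtain ⟨m, n, rfl⟩ := AddSubgroup.mem_closure_pair.1 hxy
  exact ⟨m, n, by simpa [Real.dist_eq] using hy⟩

/-- The constant of bad approximability for `k` points. -/
noncomputable def badConstant (k : ℕ) : ℝ := 1 / (6 * (k + 1) ^ 2)

theorem badConstant_pos (k : ℕ) : 0 < badConstant k := by unfold badConstant; positivity

/-- The `k + 1` in `badConstant` only serves positivity at `k = 0`; the estimate itself gives the
larger constant. -/
theorem badConstant_le {k : ℕ} (hk : 0 < k) : badConstant k ≤ 1 / (6 * k ^ 2) := by
  have : (0 : ℝ) < k := by exact_mod_cast hk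
  unfold badConstant
  gcongr
  linarith

end Lattice

namespace IsDevelopingMap

variable {T : Type*} [TopologicalSpace T] [ChartedSpace ℂ T] {π : ℂ → T} {α : OneForm T}
  {f : ℂ → ℂ} {v₁ v₂ : ℂ} {A K : ℝ}

/-- The leaf through a point of the vertical foliation is dense. -/
theorem exists_mem_leaf (h : IsDevelopingMap π α f v₁ v₂) (hπ : IsTorusParametrization π)
    (hf : IsOpenMap f) (hb : HasNormFormBound v₁ v₂ A K) (hA : 0 < A) {O : Set T} (hO : IsOpen O)
    (hne : O.Nonempty) (w : ℂ) : ∃ z, π z ∈ O ∧ ∃ a : ℝ, f z = w + a * Complex.I := by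
  obtain ⟨y, hy⟩ := hne
  obtain ⟨z₀, rfl⟩ := hπ.surjective y
  obtain ⟨r, hr, hball⟩ := Metric.isOpen_iff.1
    (hf _ (hO.preimage hπ.smooth.continuous)) _ (mem_image_of_mem f hy)
  obtain ⟨m, n, hmn⟩ := hb.exists_abs_re_sub_lt hA (f z₀ - w).re hr
  -- This height makes the remaining displacement to `f z₀` real, hence shorter than `r`.
  set a : ℝ := (f z₀ - w - (m * v₁ + n * v₂)).im with ha
  obtain ⟨z₁, hz₁, hfz₁⟩ : w + a * Complex.I + (m * v₁ + n * v₂) ∈ f '' (π ⁻¹' O) := by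
    apply hball
    have e : w + a * Complex.I + (m * v₁ + n * v₂) - f z₀ =
        (((m * v₁ + n * v₂).re - (f z₀ - w).re : ℝ) : ℂ) := by
      apply Complex.ext
      · simp; ring
      · simp [ha]; ring
    rw [mem_ball_iff_norm, e, Complex.norm_real]
    exact hmn
  have hz : z₁ = z₁ - (m + n * Complex.I) + (m + n * Complex.I) := by ring
  refine ⟨z₁ - (m + n * Complex.I), ?_, a, ?_⟩
  · rw [← hπ.apply_add _ m n, ← hz]; exact hz₁
  · have := h.apply_add (z₁ - (m + n * Complex.I)) m n
    rw [← hz, hfz₁] at this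
    exact (add_right_cancel this).symm

theorem isEventuallyThick_of_hasNormFormBound [ClosedSurface T] (h : IsDevelopingMap π α f v₁ v₂)
    (hπ : IsTorusParametrization π) (hα : α.IsLocallyExact) (hb : HasNormFormBound v₁ v₂ A K) :
    IsEventuallyThick (√(1 / 3) * √A) α := by
  refine h.isEventuallyThick hπ hα (N := Real.log (2 * |K| + 1)) fun t ht m n hmn => ?_
  have ht' : 2 * K ≤ Real.exp t := by
    have := (Real.lt_exp_of_log_lt ht).le
    linarith [le_abs_self K]
  have := norm_form_bound_le_teichmuller ht' (hb m n hmn)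
  rw [← sq_norm_teichmullerMap] at this
  rw [← Real.sqrt_mul (by norm_num)]
  refine Real.sqrt_le_iff.2 ⟨norm_nonneg _, ?_⟩
  linarith

variable {k : ℕ} {z : Fin k → ℂ} {a : Fin k → ℝ}

/-- The chosen leaves differ by `k`-torsion translations, so up to a vertical vector the
displacement is a period divided by `k`. The period is nonzero because the indices are distinct
modulo `k`. -/
theorem sub_eq_div_of_apply_eq (h : IsDevelopingMap π α f v₁ v₂) (hπ : IsTorusParametrization π)
    (hz : ∀ i, f (z i) = (i : ℕ) / k * v₁ + a i * Complex.I) {i j : Fin k} (hij : i ≠ j) {w : ℂ}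
    (hw : π w = π (z j)) : ∃ m n : ℤ, (m ≠ 0 ∨ n ≠ 0) ∧
      f w - f (z i) = (m * v₁ + n * v₂) / k + (a j - a i) * Complex.I := by
  obtain ⟨m, n, hmn⟩ := (hπ.fibres _ _).1 hw
  have hk : (k : ℂ) ≠ 0 := by exact_mod_cast (Fin.pos i).ne'
  refine ⟨(j : ℕ) - (i : ℕ) + k * m, k * n, ?_, ?_⟩
  · by_contra! h0
    apply hij
    have hdvd : (k : ℤ) ∣ (j : ℕ) - (i : ℕ) := ⟨-m, by linarith [h0.1]⟩
    have : ((j : ℕ) : ℤ) - (i : ℕ) = 0 := by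
      refine Int.eq_zero_of_abs_lt_dvd hdvd ?_
      rw [abs_lt]
      omega
    exact Fin.ext (by omega)
  · have hw' : w = z j + (m + n * Complex.I) := by rw [← hmn]; ring
    rw [hw', h.apply_add, hz, hz]
    push_cast
    field_simp
    ring

/-- Distinct indices give distinct vertical leaves on the torus. Hence no orbit of one point meets
another, and the points are distinct. -/
theorem re_sub_ne_zero (h : IsDevelopingMap π α f v₁ v₂) (hπ : IsTorusParametrization π)
    (hb : HasNormFormBound v₁ v₂ A K) (hA : 0 < A)
    (hz : ∀ i, f (z i) = (i : ℕ) / k * v₁ + a i * Complex.I) {i j : Fin k} (hij : i ≠ j) {w : ℂ}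
    (hw : π w = π (z j)) : (f w - f (z i)).re ≠ 0 := by
  obtain ⟨m, n, hmn, he⟩ := h.sub_eq_div_of_apply_eq hπ hz hij hw
  have hk : (k : ℝ) ≠ 0 := by exact_mod_cast (Fin.pos i).ne'
  have : (f w - f (z i)).re = (m * v₁ + n * v₂).re / k := by
    rw [he, Complex.add_re, ← Complex.ofReal_natCast, Complex.div_ofReal_re, ← Complex.ofReal_sub]
    simp
  rw [this]
  exact div_ne_zero (hb.re_ne_zero hA hmn) hk

theorem isBadlyApproximable (h : IsDevelopingMap π α f v₁ v₂) (hπ : IsTorusParametrization π)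
    [ClosedSurface T] (hα : α.IsLocallyExact)
    (hb : HasNormFormBound v₁ v₂ A K) (hA : 0 < A) (hK : 0 ≤ K)
    (hz : ∀ i, f (z i) = (i : ℕ) / k * v₁ + a i * Complex.I) {i j : Fin k} (hij : i ≠ j)
    {F : ℝ → T → T} (hF : ∀ z t, ∃ z', π z' = F t (π z) ∧ f z' = f z + t * Complex.I) :
    IsBadlyApproximable α.flatDist F (badConstant k * A) (π (z i)) (π (z j)) := by
  have hk : 0 < k := Fin.pos i
  have hkR : (k : ℝ) ≠ 0 := by exact_mod_cast hk.ne'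
  refine ⟨⟨1 + |a j - a i| + A * (1 + K), fun t ht => ?_⟩, fun t _ he => ?_⟩
  · have ht0 : 0 < t := by
      have := abs_nonneg (a j - a i)
      have := mul_nonneg hA.le (by linarith : 0 ≤ 1 + K)
      linarith
    obtain ⟨w, hw, hfw⟩ := hF (z i) t
    have key : ENNReal.ofReal (badConstant k * A / t) ≤ α.flatDist (π w) (π (z j)) := by
      refine h.le_flatDist hπ hα fun z' hz' => ?_
      obtain ⟨m, n, hmn, hd⟩ := h.sub_eq_div_of_apply_eq hπ hz hij hz'
      set X : ℝ := (m * v₁ + n * v₂).re / k with hX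
      set Y : ℝ := (m * v₁ + n * v₂).im / k with hY
      have hkX : k * X = (m * v₁ + n * v₂).re := mul_div_cancel₀ _ hkR
      have hkY : k * Y = (m * v₁ + n * v₂).im := mul_div_cancel₀ _ hkR
      have e : f z' - f w = (X : ℂ) + ((Y - t + (a j - a i) : ℝ) : ℂ) * Complex.I := by
        have e1 : (m * v₁ + n * v₂) / k = (X : ℂ) + Y * Complex.I := by
          apply Complex.ext
          · rw [← Complex.ofReal_natCast, Complex.div_ofReal_re]; simp [hX]
          · rw [← Complex.ofReal_natCast, Complex.div_ofReal_im]; simp [hY]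
        rw [hfw, ← sub_sub, hd, e1]
        push_cast
        ring
      have hbound := norm_form_bound_vertical hk hA hK (X := X) (Y := Y)
        (by rw [hkX, hkY]; exact hb m n hmn) ht
      rw [← e] at hbound
      rw [← ofReal_norm]
      refine ENNReal.ofReal_le_ofReal ((div_le_iff₀' ht0).2 (le_trans ?_ hbound))
      exact mul_le_mul_of_nonneg_right (badConstant_le hk) hA.le
    rw [← hw]
    calc ENNReal.ofReal (badConstant k * A)
        = ENNReal.ofReal t * ENNReal.ofReal (badConstant k * A / t) := by
          rw [← ENNReal.ofReal_mul ht0.le, mul_div_cancel₀ _ ht0.ne']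
      _ ≤ _ := by gcongr
  · obtain ⟨w, hw, hfw⟩ := hF (z i) t
    refine h.re_sub_ne_zero hπ hb hA hz hij (hw.trans he) ?_
    rw [hfw]
    simp

theorem injective_comp (h : IsDevelopingMap π α f v₁ v₂) (hπ : IsTorusParametrization π)
    (hb : HasNormFormBound v₁ v₂ A K) (hA : 0 < A)
    (hz : ∀ i, f (z i) = (i : ℕ) / k * v₁ + a i * Complex.I) : Injective (π ∘ z) := by
  intro i j hij
  by_contra hne
  exact h.re_sub_ne_zero hπ hb hA hz hne (w := z i) hij (by simp)

end IsDevelopingMap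

/-! ### The perturbed torus differential -/

section Existence

variable {T : Type*} [TopologicalSpace T] [ChartedSpace ℂ T] [ClosedSurface T]

/-- An Abelian differential on a torus can be perturbed, without changing it near a given point, so
that its vertical direction becomes badly approximable with uniform constants. -/
theorem IsTorusParametrization.exists_hasNormFormBound {π : ℂ → T} (hπ : IsTorusParametrization π)
    (α : AbelianDifferential T) {U : Set (AbelianDifferential T)} (hU : U ∈ 𝓝 α) (b : T) :
    ∃ α' ∈ U, (∃ V, IsOpen V ∧ b ∈ V ∧ ∀ y ∈ V, α'.form.coeff y = α.form.coeff y) ∧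
      torusArea π α'.form = torusArea π α.form ∧ 0 < torusArea π α.form ∧
      α'.form.IsLocallyExact ∧ (∀ y, 0 < (α'.form.coeff y).det) ∧
      ∃ f v₁ v₂ K, IsDevelopingMap π α'.form f v₁ v₂ ∧ Bijective f ∧ IsOpenMap f ∧ 0 ≤ K ∧
        HasNormFormBound v₁ v₂ (torusArea π α.form) K := by
  obtain ⟨hsm, ⟨J, hJ⟩, hne⟩ : α.form.IsSmooth ∧
    (∃ J : ComplexStructure T, α.form.IsHolomorphic J) ∧ α.form ≠ 0 := α.2
  have hα := hJ.isLocallyExact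
  obtain ⟨f, v₁, v₂, hf⟩ := hπ.exists_isDevelopingMap hα
  have hA := (hf.periods_pos_and_bijective hπ hJ hne).1
  obtain ⟨u, hu, V, hVo, hbV, hV⟩ := exists_closed_im_eq_zero_near hα b
  have hβ := isLocallyExact_shearForm hα hu
  obtain ⟨U', hU', hUU'⟩ := (@mem_nhds_induced _ _ OneForm.cInftyTopology
    AbelianDifferential.form α U).1 hU
  have hev := (tendsto_add_smul_cInftyTopology hsm hβ.isSmooth).eventually hU'
  have hev2 := eventually_det_coeff_add_smul_pos hπ hα hβ (hf.det_coeff_pos hπ hJ hne)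
  obtain ⟨η, hη, hball⟩ := Metric.eventually_nhds_iff.1 (hev.and hev2)
  -- Below `η` the sheared form stays in `U` and has positive Jacobian, so only the arithmetic of
  -- the periods remains to select `s`.
  obtain ⟨s, hs, K, hK, hbound⟩ := exists_shear_norm_form_bound hA hη
  obtain ⟨hsU, hdet⟩ := hball (y := s) (by simpa using hs)
  have hα' := hα.add_smul hβ s
  obtain ⟨J', hJ'⟩ := hα'.exists_complexStructure_of_det_pos hdet
  have hne' := ne_zero_of_det_pos (hdet b)
  have hf' := hf.shear hπ hu s
  refine ⟨⟨_, hα'.isSmooth, ⟨J', hJ'⟩, hne'⟩, hUU' hsU, ⟨V, hVo, hbV, fun y hy => ?_⟩, ?_, ?_, hα',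
    hdet, _, _, _, K, hf', (hf'.periods_pos_and_bijective hπ hJ' hne').2,
    hf'.isOpenMap hπ hJ' hne', hK, fun m n hmn => ?_⟩
  · change (α.form + s • shearForm α.form u).coeff y = _
    rw [coeff_add_smul, coeff_shearForm, hV y hy, sub_self, smul_zero, add_zero]
  · change torusArea π (α.form + s • shearForm α.form u) = _
    rw [hf'.torusArea_eq, hf.torusArea_eq]
    simp [imPart_apply]
    ring
  · rw [hf.torusArea_eq]; exact hA
  · rw [hf.torusArea_eq]
    have := hbound m n hmn
    simpa [imPart_apply] using this

end Existence

end FlatSurface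

/-! ### The main theorem -/

theorem mainTheorem9 :
    ∃ ε : ℝ, 0 < ε ∧ ∃ B : ℕ → ℝ, (∀ k, 0 < B k) ∧
      ∀ (S : Type u) [TopologicalSpace S] [ChartedSpace ℂ S] [FlatSurface.ClosedSurface S]
        (T : Type v) [TopologicalSpace T] [ChartedSpace ℂ T] [FlatSurface.ClosedSurface T]
        (π : ℂ → T) (p : S → T) (α : FlatSurface.AbelianDifferential S)
        (αT : FlatSurface.AbelianDifferential T) (k : ℕ) (q : Fin k → S),
        2 ≤ FlatSurface.genus S →
        FlatSurface.IsTorusParametrization π →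
        FlatSurface.IsBranchedOverOnePoint p →
        α.form = FlatSurface.OneForm.pullback p αT.form →
        Function.Injective q →
        ∀ U ∈ 𝓝 αT, ∀ δ : ℝ, 0 < δ →
          ∃ αT' ∈ U, ∃ (α' : FlatSurface.AbelianDifferential S) (q' : Fin k → S),
            α'.form = FlatSurface.OneForm.pullback p αT'.form ∧
            FlatSurface.torusArea π αT'.form = FlatSurface.torusArea π αT.form ∧
            Function.Injective q' ∧
            (∀ i, α.form.flatDist (q i) (q' i) < ENNReal.ofReal δ) ∧
            FlatSurface.IsTorusGoodVia (ε * √(FlatSurface.torusArea π αT.form))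
              (B k * FlatSurface.torusArea π αT.form) α' q' p αT' ∧
            (FlatSurface.IsRegularCover p →
              FlatSurface.IsTorusGood.{u, v} (ε * √(FlatSurface.torusArea π αT.form))
                (B k * FlatSurface.torusArea π αT.form) α' q') := by
  refine ⟨√(1 / 3), by positivity, FlatSurface.badConstant, FlatSurface.badConstant_pos, ?_⟩
  intro S _ _ _ T _ _ _ π p α αT k q _ hπ hp hpull _ U hU δ hδ
  obtain ⟨b, hb⟩ := hp.branch_point
  obtain ⟨αT', hαU, ⟨V, hVo, hbV, hV⟩, harea, hA, hexact, hdet, f, v₁, v₂, K, hf, hbij, hopen, hK,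
    hbound⟩ := hπ.exists_hasNormFormBound αT hU b
  obtain ⟨J, hJ⟩ := α.2.2.1
  obtain ⟨α', hα'⟩ := hp.exists_abelianDifferential (fun x m hm hd => (hb _).1 ⟨x, rfl, m, hm, hd⟩)
    (J := J) (hpull ▸ hJ) hexact hdet hVo hbV hV
  -- The image under `p` of the `δ`-ball at `q i` is a neighbourhood of `p (q i)`, so it meets the
  -- dense leaf through `(i/k) v₁`; the point met lifts back into the ball.
  have hpt : ∀ i, ∃ q' z, ∃ a : ℝ, α.form.flatDist (q i) q' < ENNReal.ofReal δ ∧ π z = p q' ∧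
      f z = (i : ℕ) / k * v₁ + a * Complex.I := fun i => by
    have himg := hp.nhds_le_map (q i) (Filter.image_mem_map
      (FlatSurface.OneForm.IsSmooth.eventually_flatDist_lt α.2.1 (q i) hδ))
    obtain ⟨O, hO, hOo, hqO⟩ := mem_nhds_iff.1 himg
    obtain ⟨z, hz, a, hza⟩ := hf.exists_mem_leaf hπ hopen hbound hA hOo ⟨_, hqO⟩ ((i : ℕ) / k * v₁)
    obtain ⟨q', hq', hpq'⟩ := hO hz
    exact ⟨q', z, a, hq', hpq'.symm, hza⟩
  choose q' z a hq' hzq' hza using hpt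
  obtain ⟨F, hF, hFz⟩ := hf.exists_isVerticalFlow hπ hbij fun w => by
    rw [hf.fderiv_eq, FlatSurface.coeff_pullback, FlatSurface.det_comp]
    exact mul_pos (hdet _) (hπ.det_mderiv_pos w)
  have hgood : FlatSurface.IsTorusGoodVia (√(1 / 3) * √(FlatSurface.torusArea π αT.form))
      (FlatSurface.badConstant k * FlatSurface.torusArea π αT.form) α' q' p αT' :=
    { torus := ⟨π, hπ⟩
      branched := hp
      thick := hf.isEventuallyThick_of_hasNormFormBound hπ hexact hbound
      pullback_eq := hα'
      badly_approximable := ⟨F, hF, fun i j hij => by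
        rw [← hzq', ← hzq']
        exact hf.isBadlyApproximable hπ hexact hbound hA hK hza hij hFz⟩ }
  refine ⟨αT', hαU, α', q', hα', harea, ?_, hq', hgood, fun hreg =>
    ⟨T, _, _, inferInstance, p, αT', hreg, hgood⟩⟩
  -- The new points are distinct because their images in the torus already are.
  have hinj := hf.injective_comp hπ hbound hA hza
  rw [show π ∘ z = p ∘ q' from funext hzq'] at hinj
  exact hinj.of_comp
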